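/- Work over $\mathbb C$. Let $X$ be a smooth projective toric variety of dimension $n$, let $k\ge 1$, and let $L$ be a line bundle on $X$ that is $k$-jet spanned: for every point $x\in X$ the map $j_{k,x}\colon V=H^0(X,L)\to H^0(X,L\otimes\mathcal O_X/\mathfrak m_x^{k+1})$ has rank $\binom{n+k}{n}$. Let $\gamma^k$ be the Gauss map of order $k$, which sends $x\in X$ to the $k$-th osculating space $\mathbb P(j_{k,x}(V))\subseteq\mathbb P(V)$, viewed as a point of the Grassmannian of $\left(\binom{n+k}{n}-1\right)$-dimensional linear subspaces of $\mathbb P(V)$. Then, unless $(X,L)\cong(\mathbb P^n,\mathcal O_{\mathbb P^n}(k))$, the general fiber of $\gamma^k$ is finite and $\gamma^k$ is birational onto the closure of its image. -/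

import Mathlib

/-! Complex varieties are modelled, in the style of Zariski and Chevalley, inside their function
field `K`: an (integral, separated) variety with function field `K` is the set of the local rings
`𝒪_x ⊆ K` of its closed points `x`. Two closed points agree exactly when their local rings
agree, so gluing affine varieties is taking the union of their sets of local rings. -/

noncomputable section

namespace ToricGauss

open IsLocalRing

/-! ### Points, affine varieties, Zariski topology -/

/-- A local `ℂ`-subalgebra of `K`; the local ring of a point of a variety with function
field `K`. -/
@[ext]
structure Point (K : Type*) [Field K] [Algebra ℂ K] where
  /-- The local ring `𝒪_x`. -/
  ring : Subalgebra ℂ K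
  isLocalRing : IsLocalRing ring

attribute [instance] Point.isLocalRing

section General

variable {K : Type*} [Field K] [Algebra ℂ K]

/-- The localization `A_𝔭 ⊆ K` of a subalgebra `A ⊆ K` at a prime ideal `𝔭`. -/
def Point.localization (A : Subalgebra ℂ K) (𝔭 : Ideal A) [h𝔭 : 𝔭.IsPrime] : Point K where
  ring :=
    { carrier := {z | ∃ a s : A, s ∉ 𝔭 ∧ z = (a : K) / (s : K)}
      mul_mem' := by
        rintro _ _ ⟨a, s, hs, rfl⟩ ⟨b, t, ht, rfl⟩
        refine ⟨a * b, s * t, fun h => (h𝔭.mem_or_mem h).elim hs ht, ?_⟩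
        push_cast
        rw [div_mul_div_comm]
      add_mem' := by
        rintro _ _ ⟨a, s, hs, rfl⟩ ⟨b, t, ht, rfl⟩
        have hs0 : (s : K) ≠ 0 := fun h => hs (by
          have : s = 0 := Subtype.ext h
          simp [this])
        have ht0 : (t : K) ≠ 0 := fun h => ht (by
          have : t = 0 := Subtype.ext h
          simp [this])
        refine ⟨a * t + s * b, s * t, fun h => (h𝔭.mem_or_mem h).elim hs ht, ?_⟩
        push_cast
        rw [div_add_div _ _ hs0 ht0]
      algebraMap_mem' := fun c =>
        ⟨algebraMap ℂ A c, 1, fun h => h𝔭.ne_top ((Ideal.eq_top_iff_one _).2 h), by simp⟩ }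
  isLocalRing := by
    refine IsLocalRing.of_isUnit_or_isUnit_one_sub_self ?_
    rintro ⟨z, a, s, hs, rfl⟩
    have hne : ∀ t : A, t ∉ 𝔭 → (t : K) ≠ 0 := fun t ht h => ht (by
      have : t = 0 := Subtype.ext h
      simp [this])
    by_cases ha : a ∈ 𝔭
    · right
      have hsa : s - a ∉ 𝔭 := fun h => hs (by simpa using 𝔭.add_mem h ha)
      have h1 := hne _ hsa
      have h2 := hne _ hs
      refine IsUnit.of_mul_eq_one ⟨(s : K) / ((s - a : A) : K), s, s - a, hsa, rfl⟩ ?_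
      apply Subtype.ext
      push_cast at h1 ⊢
      change (1 - (a : K) / s) * ((s : K) / (s - a)) = 1
      field_simp
    · left
      have h1 := hne _ ha
      have h2 := hne _ hs
      refine IsUnit.of_mul_eq_one ⟨(s : K) / (a : K), s, a, ha, rfl⟩ ?_
      apply Subtype.ext
      change ((a : K) / s) * ((s : K) / a) = 1
      field_simp

/-- The affine variety with coordinate ring `A ⊆ K`: the local rings of `A` at its maximal
ideals. -/
def affineVariety (A : Subalgebra ℂ K) : Set (Point K) :=
  {x | ∃ (𝔪 : Ideal A) (h : 𝔪.IsMaximal), x = Point.localization A 𝔪 (h𝔭 := h.isPrime)}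

/-- The Zariski topology: the sets `{x | f ∈ 𝒪_x}`, the domains of definition of the
`f ∈ K`, form a subbasis. Every variety `X ⊆ Point K` carries the induced topology. -/
instance zariskiTopology : TopologicalSpace (Point K) :=
  TopologicalSpace.generateFrom {U | ∃ f : K, U = {x | f ∈ x.ring}}

/-- The rational function `f` is regular at the closed point `x`, with value `f(x) = c`. -/
def HasValueAt (f : K) (x : Point K) (c : ℂ) : Prop :=
  ∃ z ∈ maximalIdeal x.ring, (z : K) = f - algebraMap ℂ K c

/-- The closed subvariety of `ℙ^r` with homogeneous coordinate functions `f_0, …, f_r`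
(nonzero, up to a common factor, elements of its function field `K`): the union of the affine
varieties with coordinate rings `ℂ[f_0/f_i, …, f_r/f_i]`. -/
def projectiveModel {r : ℕ} (f : Fin (r + 1) → K) : Set (Point K) :=
  {x | ∃ i, x ∈ affineVariety (Algebra.adjoin ℂ (Set.range fun j => f j / f i))}

/-- `X` is projective: it is isomorphic to a closed subvariety of some `ℙ^r`. (Coordinates of
`ℙ^r` that vanish identically on `X` may be left out.) -/
def IsProjective (X : Set (Point K)) : Prop :=
  ∃ (r : ℕ) (f : Fin (r + 1) → K), (∀ i, f i ≠ 0) ∧ X = projectiveModel f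

/-- `X` is smooth: all its local rings are regular. -/
def IsSmooth (X : Set (Point K)) : Prop :=
  ∀ x ∈ X, IsRegularLocalRing x.ring

/-! ### Line bundles, sections, jets -/

/-- A line bundle on `X`, as an invertible subsheaf of the constant sheaf `K`, given by its stalks
`L_x ⊆ K` at the closed points: around each point there is a `g ∈ K`, `g ≠ 0`, with
`L_y = g 𝒪_y` for all `y` in a neighbourhood. -/
structure LineBundle (X : Set (Point K)) where
  /-- The stalk `L_x`. -/
  stalk : (x : X) → Submodule x.1.ring K
  locallyTrivial : ∀ x : X, ∃ U : Set (Point K), IsOpen U ∧ x.1 ∈ U ∧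
    ∃ g : K, g ≠ 0 ∧ ∀ y : X, y.1 ∈ U → stalk y = Submodule.span y.1.ring {g}

namespace LineBundle

variable {X : Set (Point K)} (L : LineBundle X)

/-- The stalk `L_x`, as a complex vector space. -/
def stalkℂ (x : X) : Submodule ℂ K :=
  (L.stalk x).restrictScalars ℂ

/-- `𝔪_x^{k+1} L_x`, as a complex vector space. -/
def vanishingGerms (k : ℕ) (x : X) : Submodule ℂ K :=
  (maximalIdeal x.1.ring ^ (k + 1) • L.stalk x).restrictScalars ℂ

/-- `V = H⁰(X, L)`. -/
def globalSections : Submodule ℂ K :=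
  ⨅ x : X, L.stalkℂ x

/-- The fibre at `x` of the `k`-jet bundle: `J_k(L)_x = L_x / 𝔪_x^{k+1} L_x`. -/
abbrev JetFibre (k : ℕ) (x : X) : Type _ :=
  L.stalkℂ x ⧸ (L.vanishingGerms k x).submoduleOf (L.stalkℂ x)

/-- The map `j_{k,x} : H⁰(X, L) → J_k(L)_x`. -/
def jetMap (k : ℕ) (x : X) : L.globalSections →ₗ[ℂ] L.JetFibre k x :=
  (Submodule.mkQ _).comp (Submodule.inclusion (iInf_le L.stalkℂ x))

/-- `L` is `k`-jet spanned (on a variety of dimension `n`): `j_{k,x}` has rank `binom(n+k, n)`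
at every point `x`. -/
def IsJetSpanned (n k : ℕ) : Prop :=
  ∀ x : X, Module.finrank ℂ (L.jetMap k x).range = (n + k).choose n

variable {L}

open scoped Module.Grassmannian in
/-- The Gauss map `γ^k` of order `k`. It sends `x` to the osculating space
`Osc^k_x = ℙ(j_{k,x}(V)) ⊆ ℙ(V)`, that is, to the quotient `V → j_{k,x}(V)` of dimension
`binom(n+k, n)`, which is recorded through its kernel `ker j_{k,x} ⊆ V`. -/
def gaussMap {n k : ℕ} (h : L.IsJetSpanned n k) (x : X) :
    G((n + k).choose n, L.globalSections; ℂ) where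
  toSubmodule := (L.jetMap k x).ker
  finite_quotient := by
    have : Module.Finite ℂ (L.jetMap k x).range := by
      apply Module.finite_of_finrank_pos
      rw [h x]
      exact Nat.choose_pos (Nat.le_add_right n k)
    exact Module.Finite.equiv (L.jetMap k x).quotKerEquivRange.symm
  projective_quotient := inferInstance
  rankAtStalk_eq p := by
    rw [Module.rankAtStalk_eq_finrank_of_free, ← h x]
    exact (L.jetMap k x).quotKerEquivRange.finrank_eq

end LineBundle

/-- The pairs `(X, L)` and `(X', L')` are isomorphic: an isomorphism of varieties `X ≅ X'`
(i.e. an isomorphism of function fields that maps the local rings of `X` onto those of `X'`)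
carries `L` to a line bundle isomorphic to `L'` (isomorphisms of invertible subsheaves of the
function field are multiplications by some `h ≠ 0`). -/
def IsoPair {K' : Type*} [Field K'] [Algebra ℂ K'] {X : Set (Point K)} {X' : Set (Point K')}
    (L : LineBundle X) (L' : LineBundle X') : Prop :=
  ∃ φ : K ≃ₐ[ℂ] K',
    (∀ x ∈ X, ∃ x' ∈ X', x'.ring = x.ring.map φ.toAlgHom) ∧
    (∀ x' ∈ X', ∃ x ∈ X, x'.ring = x.ring.map φ.toAlgHom) ∧
    ∃ h : K', h ≠ 0 ∧ ∀ (x : X) (x' : X'), x'.1.ring = x.1.ring.map φ.toAlgHom →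
      (L'.stalk x' : Set K') = {t | ∃ s ∈ L.stalk x, t = h * φ s}

/-- The line bundle `𝒪(k)` on the projective variety with homogeneous coordinate functions
`f_0, …, f_r`: its stalks are generated by the monomials of degree `k` in the `f_i`. -/
def serreTwist {r : ℕ} (f : Fin (r + 1) → K) (hf : ∀ i, f i ≠ 0) (k : ℕ) :
    LineBundle (projectiveModel f) where
  stalk x := Submodule.span x.1.ring (Set.range f) ^ k
  locallyTrivial := by
    rintro ⟨x, i, 𝔪, hmax, hx⟩
    have hle : ∀ j, f j / f i ∈ x.ring := by
      intro j
      rw [hx]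
      refine ⟨⟨f j / f i, Algebra.subset_adjoin ⟨j, rfl⟩⟩, 1,
        fun h => hmax.ne_top ((Ideal.eq_top_iff_one _).2 h), by simp⟩
    refine ⟨⋂ j, {y | f j / f i ∈ y.ring}, ?_, ?_, f i ^ k, pow_ne_zero _ (hf i), ?_⟩
    · exact isOpen_iInter_of_finite fun j => TopologicalSpace.isOpen_generateFrom_of_mem ⟨_, rfl⟩
    · simpa using hle
    · rintro ⟨y, hy⟩ hyU
      simp only [Set.mem_iInter, Set.mem_ofPred_eq] at hyU
      have : Submodule.span y.ring (Set.range f) = Submodule.span y.ring {f i} := by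
        apply le_antisymm
        · rw [Submodule.span_le]
          rintro _ ⟨j, rfl⟩
          refine Submodule.mem_span_singleton.2 ⟨⟨_, hyU j⟩, ?_⟩
          change f j / f i * f i = f j
          exact div_mul_cancel₀ _ (hf i)
        · exact Submodule.span_mono (by simp)
      change Submodule.span y.ring (Set.range f) ^ k = _
      rw [this, Submodule.span_pow, Set.singleton_pow]

/-! ### Maps to a Grassmannian -/

section Grassmannian

open scoped Module.Grassmannian

variable {V : Type*} [AddCommGroup V] [Module ℂ V] {q : ℕ} {X : Set (Point K)}

/-- `ω` is a vector of Plücker coordinates of the `q`-dimensional quotient `V → V / W`: it spans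
the line of alternating `q`-forms on `V` that come from `V / W`. The Plücker coordinates
themselves are the numbers `ω v`, for `v : Fin q → V`. -/
def IsPlueckerVector (W : G(q, V; ℂ)) (ω : V [⋀^Fin q]→ₗ[ℂ] ℂ) : Prop :=
  ω ≠ 0 ∧ ∀ v : Fin q → V, (∃ i, v i ∈ W.toSubmodule) → ω v = 0

/-- The general fibre of `γ` is finite. -/
def HasFiniteGeneralFibre (γ : X → G(q, V; ℂ)) : Prop :=
  ∃ U : Set (Point K), IsOpen U ∧ (U ∩ X).Nonempty ∧
    ∀ x : X, x.1 ∈ U → {y : X | γ y = γ x}.Finite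

/-- The rational functions `f` on `X` of the form `f = γ^* g` with `g` a rational function on the
closure `Y` of the image of `γ`. Here `g` is a quotient `P / Q` of homogeneous polynomials of the
same degree in the Plücker coordinates, with `Q` not identically zero on `Y`. -/
def pulledBackFunctions (γ : X → G(q, V; ℂ)) : Set K :=
  {f | ∃ (d : ℕ) (P Q : MvPolynomial (Fin q → V) ℂ), P.IsHomogeneous d ∧ Q.IsHomogeneous d ∧
    ∃ U : Set (Point K), IsOpen U ∧ (U ∩ X).Nonempty ∧
      ∀ x : X, x.1 ∈ U → ∀ ω : V [⋀^Fin q]→ₗ[ℂ] ℂ, IsPlueckerVector (γ x) ω →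
        MvPolynomial.eval (fun v => ω v) Q ≠ 0 ∧
        HasValueAt f x (MvPolynomial.eval (fun v => ω v) P / MvPolynomial.eval (fun v => ω v) Q)}

/-- `γ` is birational onto (the closure `Y` of) its image: `γ^* : ℂ(Y) → ℂ(X) = K` is an
isomorphism. As a homomorphism of fields is injective, this says that it is onto. -/
def IsBirationalOntoImage (γ : X → G(q, V; ℂ)) : Prop :=
  pulledBackFunctions γ = Set.univ

end Grassmannian

end General

/-! ### Toric varieties -/

/-- The function field `ℂ(M)` of the torus `Spec ℂ[M]`, `M = ℤⁿ`. -/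
abbrev FunctionField (n : ℕ) : Type := FractionRing (AddMonoidAlgebra ℂ (Fin n → ℤ))

/-- The character `x^m` of the torus, for `m ∈ M = ℤⁿ`. -/
def character {n : ℕ} (m : Fin n → ℤ) : FunctionField n :=
  algebraMap (AddMonoidAlgebra ℂ (Fin n → ℤ)) (FunctionField n) (AddMonoidAlgebra.single m 1)

/-- A fan in `ℝⁿ` (with respect to the lattice `ℤⁿ`): a finite nonempty collection of strongly
convex rational polyhedral cones, closed under taking faces, any two of which meet in a common
face. -/
structure Fan (n : ℕ) where
  cones : Set (PointedCone ℝ (Fin n → ℝ))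
  finite : cones.Finite
  nonempty : cones.Nonempty
  rational : ∀ σ ∈ cones, ∃ S : Finset (Fin n → ℤ),
    σ = PointedCone.hull ℝ {u | ∃ s ∈ S, u = fun i => (s i : ℝ)}
  stronglyConvex : ∀ σ ∈ cones, ∀ u ∈ σ, -u ∈ σ → u = 0
  face_mem : ∀ σ ∈ cones, ∀ τ : PointedCone ℝ (Fin n → ℝ), τ.IsFaceOf σ → τ ∈ cones
  inf_isFaceOf : ∀ σ ∈ cones, ∀ τ ∈ cones, (σ ⊓ τ).IsFaceOf σ

/-- The coordinate ring `ℂ[σ^∨ ∩ M]` of the affine toric variety of the cone `σ`. -/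
def coneAlgebra {n : ℕ} (σ : PointedCone ℝ (Fin n → ℝ)) : Subalgebra ℂ (FunctionField n) :=
  Algebra.adjoin ℂ {f | ∃ m : Fin n → ℤ, (∀ u ∈ σ, 0 ≤ ∑ i, (m i : ℝ) * u i) ∧ f = character m}

/-- The toric variety of a fan: the affine toric varieties of its cones, glued inside their common
function field. -/
def toricVariety {n : ℕ} (F : Fan n) : Set (Point (FunctionField n)) :=
  {x | ∃ σ ∈ F.cones, x ∈ affineVariety (coneAlgebra σ)}

/-- The homogeneous coordinate functions `1, x_1, …, x_n` of `ℙⁿ`. -/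
def projectiveCoordinates (n : ℕ) : Fin (n + 1) → FunctionField n :=
  Fin.cons 1 fun i => character (Pi.single i 1)

theorem projectiveCoordinates_ne_zero (n : ℕ) (i : Fin (n + 1)) :
    projectiveCoordinates n i ≠ 0 := by
  refine Fin.cases ?_ (fun i => ?_) i
  · simp [projectiveCoordinates]
  · simp only [projectiveCoordinates, Fin.cons_succ, character]
    rw [Ne, IsFractionRing.to_map_eq_zero_iff]
    simp

/-- The line bundle `𝒪(k)` on `ℙⁿ`. -/
def projectiveSpaceO (n k : ℕ) : LineBundle (projectiveModel (projectiveCoordinates n)) :=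
  serreTwist (projectiveCoordinates n) (projectiveCoordinates_ne_zero n) k

end ToricGauss

end

/-! A smooth projective toric variety is covered by affine spaces, one for each full-dimensional
cone: the dual of such a cone is generated by a lattice basis `e` (`exists_basis_of_isSmooth`). On
each chart `L` is generated by a character times one common function (`exists_isLinearization`). So
`H⁰(X, L)` is spanned by monomials `x^b` in the chart coordinates, and jet spannedness at the origin
of the chart makes every `x^a` with `|a| ≤ k` a section (`mem_sectionExponents_of_degree_le`).

The key computation is the order `k` Taylor polynomial at `y` of a monomial `x^b` with `|b| > k`,
expanded in powers of `x` and not of `x - y`. The coefficient of `x^a` is a constant times the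
single monomial `y^(b-a)`, and the constant is nonzero as soon as `a ≤ b` and `|a| ≤ k`
(`chartGerm_sub_taylorMonomial_mem`, `taylorCoeff_ne_zero`). The kernel of `j_{k,y}` contains `x^b`
minus this polynomial, hence it determines the coefficients. If `x_i` divides `x^b`, the
coefficients at `a = 0` and `a = e_i` have ratio `y_i` up to a known constant. So a point of the
torus can be read off from its osculating space (`eq_of_ker_jetMap_eq`). The coefficients are also
ratios of Plücker coordinates by Cramer's rule, so the coordinate functions are pulled back from the
image (`isBirationalOntoImage`).

It remains to find, for each `i`, a monomial section of degree greater than `k` divisible by `x_i`.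
Suppose that there is none for some `j`. Comparing the chart with its neighbour across the wall `j`
shows that the corresponding edge of the polytope has length exactly `k` and that all sections have
degree at most `k` (`LineBundle.IsLinearization.exists_adjacent`). Then the same comparison applies
across every wall, the charts found are those of projective space, and the pair is `(ℙⁿ, 𝒪(k))`
(`isoPair`).

Completeness of the fan comes from the valuative criterion: a group order on the characters defines
a valuation, which has a centre on the projective variety (`exists_cone_of_order`). -/

noncomputable section

namespace ToricGauss

open IsLocalRing

/-! ### Local rings, residue fields and centres of valuations. -/

section PointLemmas

variable {K : Type*} [Field K] [Algebra ℂ K]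

namespace Point

theorem mem_maximalIdeal_iff (x : Point K) {f : K} (hf : f ∈ x.ring) :
    (⟨f, hf⟩ : x.ring) ∈ maximalIdeal x.ring ↔ ¬ (f ≠ 0 ∧ f⁻¹ ∈ x.ring) := by
  rw [mem_maximalIdeal, mem_nonunits_iff, not_iff_not]
  constructor
  · intro h
    obtain ⟨⟨g, hg⟩, hfg⟩ := h.exists_right_inv
    have h1 : f * g = 1 := congrArg Subtype.val hfg
    have h2 : f ≠ 0 := left_ne_zero_of_mul_eq_one h1
    refine ⟨h2, ?_⟩
    rwa [inv_eq_of_mul_eq_one_right h1]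
  · rintro ⟨h0, hinv⟩
    exact IsUnit.of_mul_eq_one ⟨f⁻¹, hinv⟩ (Subtype.ext (mul_inv_cancel₀ h0))

theorem coe_ne_zero_of_notMem {A : Subalgebra ℂ K} {𝔭 : Ideal A} {s : A} (hs : s ∉ 𝔭) :
    (s : K) ≠ 0 := fun h => hs (by
  have : s = 0 := Subtype.ext h
  simp [this])

theorem le_localization (A : Subalgebra ℂ K) (𝔭 : Ideal A) [h : 𝔭.IsPrime] :
    A ≤ (localization A 𝔭).ring := fun a ha =>
  ⟨⟨a, ha⟩, 1, fun h1 => h.ne_top ((Ideal.eq_top_iff_one _).2 h1), by simp⟩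

theorem inv_mem_localization {A : Subalgebra ℂ K} {𝔭 : Ideal A} [𝔭.IsPrime] {s : A}
    (hs : s ∉ 𝔭) : (s : K)⁻¹ ∈ (localization A 𝔭).ring :=
  ⟨1, s, hs, by simp⟩

theorem mem_maximalIdeal_localization {A : Subalgebra ℂ K} {𝔭 : Ideal A} [h𝔭 : 𝔭.IsPrime]
    (z : (localization A 𝔭).ring) :
    z ∈ maximalIdeal (localization A 𝔭).ring ↔
      ∃ a s : A, a ∈ 𝔭 ∧ s ∉ 𝔭 ∧ (z : K) = (a : K) / (s : K) := by
  obtain ⟨z, hz⟩ := z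
  rw [mem_maximalIdeal_iff]
  constructor
  · intro h
    obtain ⟨a, s, hs, rfl⟩ := hz
    refine ⟨a, s, ?_, hs, rfl⟩
    by_contra ha
    exact h ⟨div_ne_zero (coe_ne_zero_of_notMem ha) (coe_ne_zero_of_notMem hs),
      s, a, ha, by rw [inv_div]⟩
  · rintro ⟨a, s, ha, hs, h⟩ ⟨h0, b, t, ht, hb⟩
    simp only at h
    subst h
    have hs0 := coe_ne_zero_of_notMem hs
    have ht0 := coe_ne_zero_of_notMem ht
    have ha0 : (a : K) ≠ 0 := fun h => h0 (by simp [h])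
    rw [inv_div, div_eq_div_iff ha0 ht0] at hb
    have : s * t = b * a := Subtype.ext hb
    have h2 : s * t ∈ 𝔭 := this ▸ 𝔭.mul_mem_left _ ha
    exact (h𝔭.mem_or_mem h2).elim hs ht

theorem mem_maximalIdeal_localization_coe {A : Subalgebra ℂ K} {𝔭 : Ideal A} [h𝔭 : 𝔭.IsPrime]
    (a : A) : (⟨a, le_localization A 𝔭 a.2⟩ : (localization A 𝔭).ring) ∈
      maximalIdeal (localization A 𝔭).ring ↔ a ∈ 𝔭 := by
  rw [mem_maximalIdeal_localization]
  constructor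
  · rintro ⟨b, s, hb, hs, h⟩
    simp only at h
    rw [eq_div_iff (coe_ne_zero_of_notMem hs)] at h
    have : a * s = b := Subtype.ext h
    exact (h𝔭.mem_or_mem (this ▸ hb : a * s ∈ 𝔭)).resolve_right hs
  · intro h
    exact ⟨a, 1, h, fun h1 => h𝔭.ne_top ((Ideal.eq_top_iff_one _).2 h1), by simp⟩

/-- The residue field of `x` is `ℂ`. -/
def IsRational (x : Point K) : Prop := ∀ f ∈ x.ring, ∃ c, HasValueAt f x c

end Point

theorem hasValueAt_iff {f : K} {x : Point K} {c : ℂ} (hf : f ∈ x.ring) :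
    HasValueAt f x c ↔ (⟨f, hf⟩ - algebraMap ℂ x.ring c : x.ring) ∈ maximalIdeal x.ring := by
  constructor
  · rintro ⟨z, hz, h⟩
    convert hz
    exact Subtype.ext h.symm
  · intro h
    exact ⟨_, h, rfl⟩

theorem HasValueAt.mem {f : K} {x : Point K} {c : ℂ} (h : HasValueAt f x c) : f ∈ x.ring := by
  obtain ⟨z, -, h⟩ := h
  have := x.ring.add_mem z.2 (x.ring.algebraMap_mem c)
  rwa [h, sub_add_cancel] at this

/-- The point is the localization of `B` at the contraction of its maximal ideal. This contraction
is maximal because the residue field is `ℂ`: an element outside it is congruent to a nonzero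
constant. The criterion serves to move a point from one affine chart to another. -/
theorem mem_affineVariety_of_forall_eq_div {x : Point K} (hx : x.IsRational) {B : Subalgebra ℂ K}
    (hB : B ≤ x.ring)
    (h : ∀ f ∈ x.ring, ∃ b ∈ B, ∃ s ∈ B, s ≠ 0 ∧ s⁻¹ ∈ x.ring ∧ f = b / s) :
    x ∈ affineVariety B := by
  set i : B →+* x.ring := (Subalgebra.inclusion hB).toRingHom
  have hi : ∀ b : B, b ∈ (maximalIdeal x.ring).comap i ↔
      ¬ ((b : K) ≠ 0 ∧ (b : K)⁻¹ ∈ x.ring) := fun b => x.mem_maximalIdeal_iff (hB b.2)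
  have hmax : ((maximalIdeal x.ring).comap i).IsMaximal := by
    rw [Ideal.isMaximal_iff]
    refine ⟨?_, ?_⟩
    · rw [hi]; simp
    · intro J b hJ hb hbJ
      obtain ⟨c, hc⟩ := hx b (hB b.2)
      rw [hasValueAt_iff (hB b.2)] at hc
      have hc' : b - algebraMap ℂ B c ∈ (maximalIdeal x.ring).comap i := hc
      have hc0 : c ≠ 0 := by
        rintro rfl
        simp only [map_zero, sub_zero] at hc'
        exact hb hc'
      have h1 := J.sub_mem hbJ (hJ hc')
      rw [sub_sub_cancel] at h1
      have h2 := J.mul_mem_left (algebraMap ℂ B c⁻¹) h1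
      rwa [← map_mul, inv_mul_cancel₀ hc0, map_one] at h2
  refine ⟨_, hmax, ?_⟩
  have := hmax.isPrime
  apply Point.ext
  apply le_antisymm
  · intro f hf
    obtain ⟨b, hb, s, hs, hs0, hsx, rfl⟩ := h f hf
    refine ⟨⟨b, hb⟩, ⟨s, hs⟩, ?_, rfl⟩
    rw [hi]
    exact not_not.2 ⟨hs0, hsx⟩
  · rintro f ⟨b, s, hs, rfl⟩
    rw [hi, not_not] at hs
    rw [div_eq_mul_inv]
    exact x.ring.mul_mem (hB b.2) hs.2

/-- Nullstellensatz: `A ⧸ 𝔪` is finite over the algebraically closed field `ℂ`. -/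
theorem isRational_of_mem_affineVariety {A : Subalgebra ℂ K} (hA : Algebra.FiniteType ℂ A)
    {x : Point K} (hx : x ∈ affineVariety A) : x.IsRational := by
  obtain ⟨𝔪, hmax, rfl⟩ := hx
  have := hmax.isPrime
  have hval : ∀ a : A, ∃ c : ℂ, a - algebraMap ℂ A c ∈ 𝔪 := by
    intro a
    let := Ideal.Quotient.field 𝔪
    have hfin : Module.Finite ℂ (A ⧸ 𝔪) := finite_of_finite_type_of_isJacobsonRing ℂ (A ⧸ 𝔪)
    obtain ⟨c, hc⟩ := (IsAlgClosed.algebraMap_bijective_of_isIntegral (k := ℂ) (K := A ⧸ 𝔪)).2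
      (Ideal.Quotient.mk 𝔪 a)
    refine ⟨c, ?_⟩
    rw [← Ideal.Quotient.eq, ← hc]
    rfl
  rintro f ⟨a, s, hs, rfl⟩
  obtain ⟨c, hc⟩ := hval a
  obtain ⟨d, hd⟩ := hval s
  have hd0 : d ≠ 0 := by
    rintro rfl
    simp only [map_zero, sub_zero] at hd
    exact hs hd
  refine ⟨c / d, ?_⟩
  have hs0 := Point.coe_ne_zero_of_notMem hs
  have hmem : (a : K) / s ∈ (Point.localization A 𝔪).ring := ⟨a, s, hs, rfl⟩
  rw [hasValueAt_iff hmem, Point.mem_maximalIdeal_localization]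
  refine ⟨a - s * algebraMap ℂ A (c / d), s, ?_, hs, ?_⟩
  · have h1 : a - s * algebraMap ℂ A (c / d) =
        (a - algebraMap ℂ A c) - (s - algebraMap ℂ A d) * algebraMap ℂ A (c / d) := by
      rw [sub_mul, ← map_mul, mul_div_cancel₀ _ hd0]
      ring
    rw [h1]
    exact 𝔪.sub_mem hc (𝔪.mul_mem_right _ hd)
  · push_cast
    rw [sub_div, mul_div_cancel_left₀ _ hs0]

theorem isRational_of_isProjective {X : Set (Point K)} (hX : IsProjective X) {x : Point K}
    (hx : x ∈ X) : x.IsRational := by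
  obtain ⟨r, f, -, rfl⟩ := hX
  obtain ⟨i, hi⟩ := hx
  refine isRational_of_mem_affineVariety ?_ hi
  rw [← Subalgebra.fg_iff_finiteType]
  exact ⟨(Set.finite_range fun j => f j / f i).toFinset, by simp⟩

/-- A valuation on the function field of a projective variety has a centre. -/
theorem exists_ring_le_of_isProjective {X : Set (Point K)} (hX : IsProjective X)
    {Γ : Type*} [AddCommGroup Γ] [LinearOrder Γ] [IsOrderedAddMonoid Γ]
    (v : AddValuation K (WithTop Γ)) (hv : ∀ c : ℂ, 0 ≤ v (algebraMap ℂ K c)) :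
    ∃ x ∈ X, ∀ z ∈ x.ring, 0 ≤ v z := by
  obtain ⟨r, f, hf, rfl⟩ := hX
  -- Dividing by a coordinate of least value makes all the ratios `f j / f i` integral for `v`.
  obtain ⟨i, -, hi⟩ := Finset.exists_min_image Finset.univ (fun i => v (f i)) Finset.univ_nonempty
  let O : Subalgebra ℂ K :=
    { carrier := {z | 0 ≤ v z}
      mul_mem' := fun {a b} ha hb => by
        simp only [Set.mem_ofPred_eq] at *
        rw [v.map_mul]; exact add_nonneg ha hb
      add_mem' := fun {a b} ha hb => by
        simp only [Set.mem_ofPred_eq] at *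
        exact (le_min ha hb).trans (v.map_add a b)
      algebraMap_mem' := hv }
  set A := Algebra.adjoin ℂ (Set.range fun j => f j / f i) with hA
  have hAO : A ≤ O := by
    rw [hA, Algebra.adjoin_le_iff]
    rintro _ ⟨j, rfl⟩
    change 0 ≤ v (f j / f i)
    have h1 : v (f i) ≤ v (f j) := hi j (Finset.mem_univ _)
    have h2 : v (f j) = v (f j / f i) + v (f i) := by
      rw [← v.map_mul, div_mul_cancel₀ _ (hf i)]
    have h3 : v (f i) ≠ ⊤ := fun h => hf i (v.top_iff.1 h)
    rw [h2] at h1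
    obtain ⟨g, hg⟩ := WithTop.ne_top_iff_exists.1 h3
    rw [← hg] at h1
    by_cases h4 : v (f j / f i) = ⊤
    · rw [h4]; exact le_top
    · obtain ⟨g', hg'⟩ := WithTop.ne_top_iff_exists.1 h4
      rw [← hg'] at h1 ⊢
      norm_cast at h1 ⊢
      simpa using h1
  let 𝔭 : Ideal A :=
    { carrier := {a | 0 < v (a : K)}
      add_mem' := fun {a b} ha hb => by
        simp only [Set.mem_ofPred_eq] at *
        exact (lt_min ha hb).trans_le (v.map_add _ _)
      zero_mem' := by simp
      smul_mem' := fun c a ha => by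
        simp only [Set.mem_ofPred_eq, smul_eq_mul] at *
        have hc : 0 ≤ v (c : K) := hAO c.2
        push_cast
        rw [v.map_mul]
        exact lt_of_lt_of_le ha (le_add_of_nonneg_left hc) }
  have h𝔭 : 𝔭 ≠ ⊤ := by
    rw [Ne, Ideal.eq_top_iff_one]
    change ¬ (0 < v ((1 : A) : K))
    simp
  -- The centre `𝔭` need not be a closed point. Any maximal ideal above it works, since elements of
  -- `A` outside `𝔪` have value exactly `0`.
  obtain ⟨𝔪, hmax, hle⟩ := Ideal.exists_le_maximal 𝔭 h𝔭
  have := hmax.isPrime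
  refine ⟨Point.localization A 𝔪, ⟨i, 𝔪, hmax, rfl⟩, ?_⟩
  rintro _ ⟨a, s, hs, rfl⟩
  have hs0 := Point.coe_ne_zero_of_notMem hs
  have h1 : v (s : K) = 0 := by
    refine le_antisymm ?_ (hAO s.2)
    by_contra h
    exact hs (hle (not_le.1 h))
  have h2 : v (a : K) = v ((a : K) / s) + v (s : K) := by
    rw [← v.map_mul, div_mul_cancel₀ _ hs0]
  rw [h1, add_zero] at h2
  rw [← h2]
  exact hAO a.2

/-- A function that is regular at all points of an affine variety is in its coordinate ring. -/
theorem mem_of_forall_mem_affineVariety {A : Subalgebra ℂ K} {f : K}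
    (h : ∀ x ∈ affineVariety A, f ∈ x.ring) : f ∈ A := by
  -- The ideal of denominators of `f`; regularity of `f` at every closed point keeps it out of every
  -- maximal ideal.
  let I : Ideal A :=
    { carrier := {r | (r : K) * f ∈ A}
      add_mem' := fun {a b} ha hb => by
        simp only [Set.mem_ofPred_eq] at *
        push_cast
        rw [add_mul]; exact A.add_mem ha hb
      zero_mem' := by simp
      smul_mem' := fun c a ha => by
        simp only [Set.mem_ofPred_eq, smul_eq_mul] at *
        push_cast
        rw [mul_assoc]; exact A.mul_mem c.2 ha }
  by_cases hI : I = ⊤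
  · have h1 : (1 : A) ∈ I := hI ▸ Submodule.mem_top
    have h2 : ((1 : A) : K) * f ∈ A := h1
    simpa using h2
  · obtain ⟨𝔪, hmax, hle⟩ := Ideal.exists_le_maximal I hI
    have := hmax.isPrime
    obtain ⟨a, s, hs, hfs⟩ := h _ ⟨𝔪, hmax, rfl⟩
    refine absurd (hle ?_) hs
    change (s : K) * f ∈ A
    rw [hfs, mul_div_cancel₀ _ (Point.coe_ne_zero_of_notMem hs)]
    exact a.2

theorem le_ring_of_mem_affineVariety {A : Subalgebra ℂ K} {x : Point K} (hx : x ∈ affineVariety A) :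
    A ≤ x.ring := by
  obtain ⟨𝔪, hmax, rfl⟩ := hx
  have := hmax.isPrime
  exact Point.le_localization _ _

end PointLemmas

/-! ### Characters and monoid algebras. -/

section Characters

variable {n : ℕ}

@[simp]
theorem character_zero : character (0 : Fin n → ℤ) = 1 := by
  simp only [character]
  rw [← AddMonoidAlgebra.one_def, map_one]

theorem character_add (m m' : Fin n → ℤ) : character (m + m') = character m * character m' := by
  simp only [character, ← map_mul, AddMonoidAlgebra.single_mul_single, mul_one]

theorem character_ne_zero (m : Fin n → ℤ) : character m ≠ 0 := by
  simp only [character]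
  rw [Ne, IsFractionRing.to_map_eq_zero_iff]
  simp

theorem character_neg (m : Fin n → ℤ) : character (-m) = (character m)⁻¹ := by
  refine eq_inv_of_mul_eq_one_left ?_
  rw [← character_add, neg_add_cancel, character_zero]

theorem character_sub (m m' : Fin n → ℤ) : character (m - m') = character m / character m' := by
  rw [sub_eq_add_neg, character_add, character_neg, div_eq_mul_inv]

theorem character_sum {ι : Type*} (s : Finset ι) (f : ι → Fin n → ℤ) :
    character (∑ i ∈ s, f i) = ∏ i ∈ s, character (f i) := by
  classical
  induction s using Finset.induction_on with
  | empty => simp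
  | insert a s ha ih => rw [Finset.sum_insert ha, Finset.prod_insert ha, character_add, ih]

theorem character_nsmul (k : ℕ) (m : Fin n → ℤ) : character (k • m) = character m ^ k := by
  rw [← Fin.prod_const, ← character_sum]
  simp

theorem algebraMap_single (m : Fin n → ℤ) (c : ℂ) :
    algebraMap (AddMonoidAlgebra ℂ (Fin n → ℤ)) (FunctionField n) (AddMonoidAlgebra.single m c) =
      c • character m := by
  have h : AddMonoidAlgebra.single m c = c • (AddMonoidAlgebra.single m (1 : ℂ)) := by simp
  rw [h, character, algebraMap_smul_eq_smul_map]
where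
  algebraMap_smul_eq_smul_map {c : ℂ} {x : AddMonoidAlgebra ℂ (Fin n → ℤ)} :
      algebraMap (AddMonoidAlgebra ℂ (Fin n → ℤ)) (FunctionField n) (c • x) =
        c • algebraMap (AddMonoidAlgebra ℂ (Fin n → ℤ)) (FunctionField n) x :=
    map_smul (IsScalarTower.toAlgHom ℂ (AddMonoidAlgebra ℂ (Fin n → ℤ)) (FunctionField n)) c x

theorem algebraMap_eq_sum (f : AddMonoidAlgebra ℂ (Fin n → ℤ)) :
    algebraMap _ (FunctionField n) f = ∑ m ∈ f.coeff.support, f.coeff m • character m := by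
  conv_lhs => rw [← AddMonoidAlgebra.sum_coeff_single f]
  rw [Finsupp.sum, map_sum]
  exact Finset.sum_congr rfl fun m _ => algebraMap_single m _

/-- The lattice points of the dual cone. -/
def dualMonoid (σ : PointedCone ℝ (Fin n → ℝ)) : AddSubmonoid (Fin n → ℤ) where
  carrier := {m | ∀ u ∈ σ, 0 ≤ ∑ i, (m i : ℝ) * u i}
  zero_mem' := fun u _ => by simp
  add_mem' := fun {a b} ha hb u hu => by
    have := add_nonneg (ha u hu) (hb u hu)
    rw [← Finset.sum_add_distrib] at this
    refine this.trans_eq (Finset.sum_congr rfl fun i _ => ?_)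
    simp only [Pi.add_apply]
    push_cast
    ring

/-- The algebra `ℂ[S]` of a monoid of characters. -/
def monoidAlg (S : AddSubmonoid (Fin n → ℤ)) : Subalgebra ℂ (FunctionField n) where
  carrier := {f | ∃ g : AddMonoidAlgebra ℂ (Fin n → ℤ), (∀ m ∈ g.coeff.support, m ∈ S) ∧
    algebraMap _ (FunctionField n) g = f}
  add_mem' := by
    rintro _ _ ⟨f, hf, rfl⟩ ⟨g, hg, rfl⟩
    refine ⟨f + g, fun m hm => ?_, map_add _ _ _⟩
    classical
    rcases Finset.mem_union.1 (Finsupp.support_add hm) with h | h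
    · exact hf m h
    · exact hg m h
  mul_mem' := by
    rintro _ _ ⟨f, hf, rfl⟩ ⟨g, hg, rfl⟩
    refine ⟨f * g, fun m hm => ?_, map_mul _ _ _⟩
    classical
    rw [Finsupp.mem_support_iff, AddMonoidAlgebra.coeff_mul] at hm
    by_contra hmS
    refine hm ?_
    refine Finset.sum_eq_zero fun a ha => Finset.sum_eq_zero fun b hb => ?_
    refine if_neg ?_
    rintro rfl
    exact hmS (S.add_mem (hf a ha) (hg b hb))
  algebraMap_mem' c := by
    refine ⟨AddMonoidAlgebra.single 0 c, fun m hm => ?_, ?_⟩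
    · have : m = 0 := by
        by_contra h
        simp [h] at hm
      exact this ▸ S.zero_mem
    · rw [algebraMap_single, character_zero, Algebra.algebraMap_eq_smul_one]

theorem mem_monoidAlg {S : AddSubmonoid (Fin n → ℤ)} {f : FunctionField n} :
    f ∈ monoidAlg S ↔ ∃ g : AddMonoidAlgebra ℂ (Fin n → ℤ), (∀ m ∈ g.coeff.support, m ∈ S) ∧
      algebraMap _ (FunctionField n) g = f := Iff.rfl

theorem character_mem_monoidAlg {S : AddSubmonoid (Fin n → ℤ)} {m : Fin n → ℤ} :
    character m ∈ monoidAlg S ↔ m ∈ S := by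
  rw [mem_monoidAlg]
  constructor
  · rintro ⟨g, hg, h⟩
    have : g = AddMonoidAlgebra.single m 1 := IsFractionRing.injective _ (FunctionField n) h
    subst this
    exact hg m (by simp)
  · intro h
    refine ⟨AddMonoidAlgebra.single m 1, fun m' hm' => ?_, rfl⟩
    have : m' = m := by
      by_contra h
      simp at hm'
      exact h hm'
    exact this ▸ h

theorem monoidAlg_mono {S T : AddSubmonoid (Fin n → ℤ)} (h : S ≤ T) : monoidAlg S ≤ monoidAlg T :=
  fun _ ⟨g, hg, hf⟩ => ⟨g, fun m hm => h (hg m hm), hf⟩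

theorem monoidAlg_le {S : AddSubmonoid (Fin n → ℤ)} {A : Subalgebra ℂ (FunctionField n)}
    (h : ∀ m ∈ S, character m ∈ A) : monoidAlg S ≤ A := by
  rintro _ ⟨g, hg, rfl⟩
  rw [algebraMap_eq_sum]
  exact A.sum_mem fun m hm => A.smul_mem (h m (hg m hm)) _

theorem monoidAlg_eq_adjoin (S : AddSubmonoid (Fin n → ℤ)) :
    monoidAlg S = Algebra.adjoin ℂ (character '' S) := by
  apply le_antisymm
  · exact monoidAlg_le fun m hm => Algebra.subset_adjoin ⟨m, hm, rfl⟩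
  · rw [Algebra.adjoin_le_iff]
    rintro _ ⟨m, hm, rfl⟩
    exact character_mem_monoidAlg.2 hm

theorem coneAlgebra_eq (σ : PointedCone ℝ (Fin n → ℝ)) :
    coneAlgebra σ = monoidAlg (dualMonoid σ) := by
  rw [monoidAlg_eq_adjoin, coneAlgebra]
  congr 1
  ext f
  constructor
  · rintro ⟨m, hm, rfl⟩
    exact ⟨m, hm, rfl⟩
  · rintro ⟨m, hm, rfl⟩
    exact ⟨m, hm, rfl⟩

end Characters

/-! ### Monomial valuations and completeness of a projective fan. -/

section Valuations

variable {n : ℕ} {Γ : Type*} [AddCommGroup Γ] [LinearOrder Γ] [IsOrderedAddMonoid Γ]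

/-- The Hahn series expansion of Laurent polynomials with respect to a group order on the
characters. -/
def hahnMap (φ : (Fin n → ℤ) →+ Γ) : AddMonoidAlgebra ℂ (Fin n → ℤ) →ₐ[ℂ] HahnSeries Γ ℂ :=
  AddMonoidAlgebra.lift ℂ (HahnSeries Γ ℂ) (Fin n → ℤ)
    { toFun := fun m => HahnSeries.single (φ m.toAdd) 1
      map_one' := by simp
      map_mul' := fun a b => by simp }

theorem coeff_hahnMap {φ : (Fin n → ℤ) →+ Γ} (hφ : Function.Injective φ)
    (f : AddMonoidAlgebra ℂ (Fin n → ℤ)) (m : Fin n → ℤ) :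
    (hahnMap φ f).coeff (φ m) = f.coeff m := by
  classical
  induction f using AddMonoidAlgebra.induction_linear with
  | zero => simp
  | add f g hf hg => simp [hf, hg]
  | single a r =>
    simp [hahnMap, HahnSeries.coeff_single, hφ.eq_iff, Finsupp.single_apply, eq_comm]

theorem hahnMap_injective {φ : (Fin n → ℤ) →+ Γ} (hφ : Function.Injective φ) :
    Function.Injective (hahnMap φ : AddMonoidAlgebra ℂ (Fin n → ℤ) →+* HahnSeries Γ ℂ) := by
  rw [injective_iff_map_eq_zero]
  intro f hf
  rw [← AddMonoidAlgebra.coeff_eq_zero]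
  ext m
  rw [← coeff_hahnMap hφ]
  have hf' : hahnMap φ f = 0 := hf
  simp [hf']

/-- The valuation of `ℂ(M)` given by a group order on the characters. -/
def monomialValuation (φ : (Fin n → ℤ) →+ Γ) (hφ : Function.Injective φ) :
    AddValuation (FunctionField n) (WithTop Γ) :=
  (HahnSeries.addVal Γ ℂ).comap (IsFractionRing.lift (hahnMap_injective hφ))

theorem monomialValuation_laurent {φ : (Fin n → ℤ) →+ Γ} (hφ : Function.Injective φ)
    (f : AddMonoidAlgebra ℂ (Fin n → ℤ)) :
    monomialValuation φ hφ (algebraMap _ _ f) = (hahnMap φ f).orderTop := by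
  change HahnSeries.addVal Γ ℂ (IsFractionRing.lift (hahnMap_injective hφ) (algebraMap _ _ f)) = _
  rw [IsFractionRing.lift_algebraMap, HahnSeries.addVal_apply]
  rfl

theorem monomialValuation_character {φ : (Fin n → ℤ) →+ Γ} (hφ : Function.Injective φ)
    (m : Fin n → ℤ) : monomialValuation φ hφ (character m) = (φ m : WithTop Γ) := by
  have : (hahnMap φ) (AddMonoidAlgebra.single m 1) = HahnSeries.single (φ m) (1 : ℂ) := by
    simp [hahnMap]
  rw [character, monomialValuation_laurent, this, HahnSeries.orderTop_single one_ne_zero]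

theorem monomialValuation_algebraMap {φ : (Fin n → ℤ) →+ Γ} (hφ : Function.Injective φ)
    (c : ℂ) : 0 ≤ monomialValuation φ hφ (algebraMap ℂ (FunctionField n) c) := by
  rw [IsScalarTower.algebraMap_apply ℂ (AddMonoidAlgebra ℂ (Fin n → ℤ)) (FunctionField n)]
  have : (hahnMap φ) (algebraMap ℂ _ c) = HahnSeries.single (0 : Γ) c := by
    rw [AlgHom.commutes]; rfl
  rw [monomialValuation_laurent, this]
  by_cases hc : c = 0
  · simp [hc]
  · rw [HahnSeries.orderTop_single hc]; rfl

/-- The centre of the monomial valuation lies in some affine chart, whose coordinate ring then has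
nonnegative values. -/
theorem exists_cone_of_order {F : Fan n} (hF : IsProjective (toricVariety F))
    {φ : (Fin n → ℤ) →+ Γ} (hφ : Function.Injective φ) :
    ∃ σ ∈ F.cones, ∀ m ∈ dualMonoid σ, 0 ≤ φ m := by
  obtain ⟨x, ⟨σ, hσ, hx⟩, h⟩ := exists_ring_le_of_isProjective hF (monomialValuation φ hφ)
    (monomialValuation_algebraMap hφ)
  refine ⟨σ, hσ, fun m hm => ?_⟩
  have h1 := h (character m) (le_ring_of_mem_affineVariety hx
    (by rw [coneAlgebra_eq]; exact character_mem_monoidAlg.2 hm))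
  rw [monomialValuation_character] at h1
  exact_mod_cast h1

/-- A projective fan contains, for given weights `w₁` and `w₂`, a maximal cone such that
`(w₁, w₂)` is lexicographically nonnegative on its dual. -/
theorem exists_cone_of_weights {F : Fan n} (hF : IsProjective (toricVariety F))
    (w₁ w₂ : (Fin n → ℤ) →+ ℤ) :
    ∃ σ ∈ F.cones, (∀ m ∈ dualMonoid σ, 0 ≤ w₁ m ∧ (w₁ m = 0 → 0 ≤ w₂ m)) ∧
      ∀ m ∈ dualMonoid σ, -m ∈ dualMonoid σ → m = 0 := by
  -- The last component, `m` itself, only breaks ties. It makes `φ` injective, so that the valuation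
  -- exists and a pair `m`, `-m` in the dual monoid forces `m = 0`.
  let φ : (Fin n → ℤ) →+ Lex (ℤ × Lex (ℤ × Lex (Fin n → ℤ))) :=
    { toFun := fun m => toLex (w₁ m, toLex (w₂ m, toLex m))
      map_zero' := by simp
      map_add' := fun a b => by simp; rfl }
  have hφ : Function.Injective φ := by
    intro a b hab
    have h1 := congrArg (fun z => ofLex (ofLex (ofLex z).2).2) hab
    exact h1
  obtain ⟨σ, hσ, h⟩ := exists_cone_of_order hF hφ
  refine ⟨σ, hσ, fun m hm => ?_, fun m hm hm' => ?_⟩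
  · have h1 := h m hm
    rw [Prod.Lex.le_iff] at h1
    change 0 < w₁ m ∨ 0 = w₁ m ∧ _ at h1
    rcases h1 with h1 | ⟨h1, h2⟩
    · exact ⟨h1.le, fun h => absurd h h1.ne'⟩
    · refine ⟨h1.le, fun _ => ?_⟩
      rw [Prod.Lex.le_iff] at h2
      change 0 < w₂ m ∨ 0 = w₂ m ∧ _ at h2
      rcases h2 with h2 | ⟨h2, -⟩
      · exact h2.le
      · exact h2.le
  · have h1 := h m hm
    have h2 := h _ hm'
    rw [map_neg, neg_nonneg] at h2
    have := le_antisymm h2 h1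
    rw [← map_zero φ] at this
    exact hφ this

end Valuations

/-- Farkas' lemma. -/
theorem exists_nonneg_combination {k W ι : Type*} [Field k] [LinearOrder k] [IsStrictOrderedRing k]
    [AddCommGroup W] [Module k W] (s : Finset ι) (a : ι → W →ₗ[k] k) (γ : W →ₗ[k] k)
    (h : ∀ x, (∀ i ∈ s, 0 ≤ a i x) → 0 ≤ γ x) :
    ∃ l : ι → k, (∀ i ∈ s, 0 ≤ l i) ∧ γ = ∑ i ∈ s, l i • a i := by
  classical
  induction s using Finset.induction_on generalizing a γ with
  | empty =>
    refine ⟨0, by simp, ?_⟩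
    ext x
    have h1 := h x (by simp)
    have h2 := h (-x) (by simp)
    rw [map_neg, neg_nonneg] at h2
    simpa using le_antisymm h2 h1
  | insert j s hj ih =>
    by_cases hs : ∀ x, (∀ i ∈ s, 0 ≤ a i x) → 0 ≤ γ x
    · obtain ⟨l, hl, hγ⟩ := ih a γ hs
      refine ⟨Function.update l j 0, ?_, ?_⟩
      · intro i _
        rcases eq_or_ne i j with rfl | hij
        · simp
        · rw [Function.update_of_ne hij]
          exact hl i (by simp_all)
      · rw [Finset.sum_insert hj, hγ]
        simp only [Function.update_self, zero_smul, zero_add]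
        refine Finset.sum_congr rfl fun i hi => ?_
        rw [Function.update_of_ne (ne_of_mem_of_not_mem hi hj)]
    · push Not at hs
      obtain ⟨x₀, hx₀, hγ₀⟩ := hs
      have hc : a j x₀ < 0 := by
        by_contra hc
        refine absurd (h x₀ fun i hi => ?_) (not_le.2 hγ₀)
        rcases Finset.mem_insert.1 hi with rfl | hi
        · exact not_lt.1 hc
        · exact hx₀ i hi
      -- The modified functionals take at `x` the values of the original ones at the projection of
      -- `x` along `x₀` to the hyperplane `a j = 0`, where the hypothesis of the lemma applies.
      obtain ⟨l, hl, hγ⟩ := ih (fun i => a i - (a i x₀ / a j x₀) • a j) (γ - (γ x₀ / a j x₀) • a j)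
        (by
          intro x hx
          have h1 := h (x - (a j x / a j x₀) • x₀) (by
            intro i hi
            rcases Finset.mem_insert.1 hi with rfl | hi
            · simp [div_mul_cancel₀ _ hc.ne]
            · have := hx i hi
              simp only [LinearMap.sub_apply, LinearMap.smul_apply, smul_eq_mul, map_sub,
                map_smul] at this ⊢
              refine this.trans_eq ?_
              ring)
          simp only [LinearMap.sub_apply, LinearMap.smul_apply, smul_eq_mul, map_sub,
            map_smul] at h1 ⊢
          refine h1.trans_eq ?_
          ring)
      -- The coefficient of `a j` is nonnegative because `γ x₀` and `a j x₀` are negative while the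
      -- other `a i x₀` are not.
      refine ⟨Function.update l j (γ x₀ / a j x₀ - ∑ i ∈ s, l i * (a i x₀ / a j x₀)), ?_, ?_⟩
      · intro i hi
        rcases eq_or_ne i j with rfl | hij
        · rw [Function.update_self, sub_nonneg]
          refine (Finset.sum_nonpos fun i hi => ?_).trans (div_nonneg_of_nonpos hγ₀.le hc.le)
          exact mul_nonpos_of_nonneg_of_nonpos (hl i hi)
            (div_nonpos_of_nonneg_of_nonpos (hx₀ i hi) hc.le)
        · rw [Function.update_of_ne hij]
          exact hl i (by simp_all)
      · rw [Finset.sum_insert hj, Function.update_self]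
        have h2 : ∑ i ∈ s, Function.update l j
            (γ x₀ / a j x₀ - ∑ i ∈ s, l i * (a i x₀ / a j x₀)) i • a i = ∑ i ∈ s, l i • a i :=
          Finset.sum_congr rfl fun i hi => by
            rw [Function.update_of_ne (ne_of_mem_of_not_mem hi hj)]
        rw [h2]
        simp only [smul_sub, Finset.sum_sub_distrib, smul_smul, ← Finset.sum_smul] at hγ
        rw [sub_eq_iff_eq_add] at hγ
        refine hγ.trans ?_
        module

/-! ### Rational cones: double duals and interior vectors. -/

section Cones

variable {n : ℕ}

/-- The real vector of a lattice vector. -/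
def toReal (u : Fin n → ℤ) : Fin n → ℝ := fun i => (u i : ℝ)

theorem sum_mul_toReal (m u : Fin n → ℤ) :
    ∑ i, (m i : ℝ) * toReal u i = ((m ⬝ᵥ u : ℤ) : ℝ) := by
  simp [toReal, dotProduct]

theorem dotProduct_nonneg_of_mem {σ : PointedCone ℝ (Fin n → ℝ)} {m u : Fin n → ℤ}
    (hm : m ∈ dualMonoid σ) (hu : toReal u ∈ σ) : 0 ≤ m ⬝ᵥ u := by
  have := hm _ hu
  rw [sum_mul_toReal] at this
  exact_mod_cast this

theorem mem_dualMonoid_hull {S : Finset (Fin n → ℤ)} {m : Fin n → ℤ} :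
    m ∈ dualMonoid (PointedCone.hull ℝ {u | ∃ s ∈ S, u = fun i => (s i : ℝ)}) ↔
      ∀ s ∈ S, 0 ≤ m ⬝ᵥ s := by
  constructor
  · intro h s hs
    exact dotProduct_nonneg_of_mem h (PointedCone.subset_hull ⟨s, hs, rfl⟩)
  · intro h u hu
    refine Submodule.span_induction (p := fun u _ => 0 ≤ ∑ i, (m i : ℝ) * u i) ?_ ?_ ?_ ?_ hu
    · rintro _ ⟨s, hs, rfl⟩
      change 0 ≤ ∑ i, (m i : ℝ) * toReal s i
      rw [sum_mul_toReal]
      exact_mod_cast h s hs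
    · simp
    · intro x y _ _ hx hy
      have := add_nonneg hx hy
      rw [← Finset.sum_add_distrib] at this
      refine this.trans_eq (Finset.sum_congr rfl fun i _ => ?_)
      simp only [Pi.add_apply]
      ring
    · intro c x _ hx
      have := mul_nonneg c.2 hx
      rw [Finset.mul_sum] at this
      refine this.trans_eq (Finset.sum_congr rfl fun i _ => ?_)
      rw [Pi.smul_apply]
      change (c : ℝ) * _ = m i * ((c : ℝ) * x i)
      ring

/-- The double dual of a rational cone. -/
theorem mem_of_forall_dualMonoid {F : Fan n} {σ : PointedCone ℝ (Fin n → ℝ)} (hσ : σ ∈ F.cones)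
    {u : Fin n → ℤ} (h : ∀ m ∈ dualMonoid σ, 0 ≤ m ⬝ᵥ u) : toReal u ∈ σ := by
  obtain ⟨S, rfl⟩ := F.rational σ hσ
  let f : (Fin n → ℤ) → (Fin n → ℚ) →ₗ[ℚ] ℚ := fun s =>
    ∑ i, (s i : ℚ) • LinearMap.proj (R := ℚ) (φ := fun _ : Fin n => ℚ) i
  have hf : ∀ s x, f s x = ∑ i, (s i : ℚ) * x i := fun s x => by simp [f]
  -- Farkas is applied over `ℚ`: a rational test vector can be scaled to a lattice point of the dual
  -- cone.
  obtain ⟨l, hl, hul⟩ := exists_nonneg_combination S f (f u) (by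
    intro x hx
    obtain ⟨D, hD⟩ := IsLocalization.exist_integer_multiples_of_finite (nonZeroDivisors ℤ) x
    obtain ⟨D, hD0⟩ := D
    choose m hm using hD
    have hm' : ∀ i, (m i : ℚ) = D * x i := fun i => by simpa using hm i
    -- The denominator `D` may be negative; multiplying by `D` a second time makes the scaling
    -- factor positive.
    have key : ∀ s : Fin n → ℤ, (((D • m) ⬝ᵥ s : ℤ) : ℚ) = (D : ℚ) ^ 2 * f s x := by
      intro s
      rw [hf, Finset.mul_sum]
      simp only [dotProduct, Pi.smul_apply, smul_eq_mul]
      push_cast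
      refine Finset.sum_congr rfl fun i _ => ?_
      rw [hm']
      ring
    have hD2 : (0 : ℚ) < (D : ℚ) ^ 2 := by
      have : (D : ℚ) ≠ 0 := by exact_mod_cast nonZeroDivisors.ne_zero hD0
      positivity
    have h1 := h (D • m) (mem_dualMonoid_hull.2 fun s hs => by
      have := mul_nonneg hD2.le (hx s hs)
      rw [← key] at this
      exact_mod_cast this)
    have h2 : (0 : ℚ) ≤ (((D • m) ⬝ᵥ u : ℤ) : ℚ) := by exact_mod_cast h1
    rw [key] at h2
    exact nonneg_of_mul_nonneg_right h2 hD2)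
  have h3 : ∀ i, (u i : ℚ) = ∑ s ∈ S, l s * s i := by
    intro i
    have := LinearMap.congr_fun hul (Pi.single i 1)
    simpa [hf, Pi.single_apply, LinearMap.sum_apply] using this
  have h4 : toReal u = ∑ s ∈ S, (l s : ℝ) • toReal s := by
    ext i
    have : ((u i : ℚ) : ℝ) = ((∑ s ∈ S, l s * s i : ℚ) : ℝ) := by rw [h3]
    simp only [Finset.sum_apply, Pi.smul_apply, smul_eq_mul, toReal]
    push_cast at this
    exact this
  rw [h4]
  refine Submodule.sum_mem _ fun s hs => ?_
  have := Submodule.smul_mem (PointedCone.hull ℝ {u | ∃ s ∈ S, u = fun i => (s i : ℝ)})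
    (⟨(l s : ℝ), by exact_mod_cast hl s hs⟩ : {c : ℝ // 0 ≤ c})
    (PointedCone.subset_hull (R := ℝ) (s := {u | ∃ s ∈ S, u = fun i => (s i : ℝ)})
      ⟨s, hs, rfl⟩ : toReal s ∈ _)
  exact this

/-- Every cone of a fan has an interior lattice vector. -/
theorem exists_interior {F : Fan n} {τ : PointedCone ℝ (Fin n → ℝ)} (hτ : τ ∈ F.cones) :
    ∃ w : Fin n → ℤ, toReal w ∈ τ ∧ (∀ σ ∈ F.cones, toReal w ∈ σ → τ ≤ σ) ∧
      ∀ m ∈ dualMonoid τ, m ⬝ᵥ w = 0 → -m ∈ dualMonoid τ := by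
  classical
  obtain ⟨S, hS⟩ := F.rational τ hτ
  have hmem : ∀ s : S, toReal s.1 ∈ τ := fun s => hS ▸ PointedCone.subset_hull ⟨s.1, s.2, rfl⟩
  have hw : toReal (∑ s : S, s.1) = ∑ s : S, toReal s.1 := by
    ext i
    simp [toReal]
  -- The sum of the generators is interior: a face that contains a sum of elements of the cone
  -- contains every summand, and a nonnegative functional that vanishes on the sum vanishes on every
  -- generator.
  refine ⟨∑ s : S, s.1, ?_, fun σ hσ h => ?_, fun m hm h => ?_⟩
  · rw [hw]
    exact Submodule.sum_mem _ fun s _ => hmem s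
  · have hface := F.inf_isFaceOf τ hτ σ hσ
    have h2 : ∑ s : S, toReal s.1 ∈ τ ⊓ σ := by
      rw [← hw]
      refine ⟨?_, h⟩
      rw [hw]
      exact Submodule.sum_mem _ fun s _ => hmem s
    have h3 := hface.mem_of_sum_mem hmem h2
    have h4 : τ = PointedCone.hull ℝ {u | ∃ s ∈ S, u = fun i => (s i : ℝ)} := hS
    rw [h4]
    refine Submodule.span_le.2 ?_
    rintro _ ⟨s, hs, rfl⟩
    exact (h3 ⟨s, hs⟩).2
  · rw [dotProduct_sum] at h
    have h5 : ∀ s ∈ (Finset.univ : Finset S), m ⬝ᵥ s.1 = 0 :=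
      (Finset.sum_eq_zero_iff_of_nonneg
        (fun s _ => dotProduct_nonneg_of_mem hm (hmem s))).1 h
    rw [hS, mem_dualMonoid_hull]
    intro s hs
    rw [neg_dotProduct, h5 ⟨s, hs⟩ (Finset.mem_univ _), neg_zero]

/-- The pairing with a lattice vector. -/
def pairing (u : Fin n → ℤ) : (Fin n → ℤ) →+ ℤ where
  toFun m := m ⬝ᵥ u
  map_zero' := zero_dotProduct _
  map_add' _ _ := add_dotProduct _ _ _

@[simp]
theorem pairing_apply (u m : Fin n → ℤ) : pairing u m = m ⬝ᵥ u := rfl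

/-- The monoid `S` has no units; for `S = σ^∨ ∩ M`, this says that `σ` is full-dimensional. -/
def IsPointed (S : AddSubmonoid (Fin n → ℤ)) : Prop := ∀ m ∈ S, -m ∈ S → m = 0

theorem dualMonoid_anti {σ τ : PointedCone ℝ (Fin n → ℝ)} (h : τ ≤ σ) :
    dualMonoid σ ≤ dualMonoid τ := fun _ hm u hu => hm u (h hu)

/-- Weighing the characters by an interior vector of `τ` yields a full-dimensional cone that
contains this vector, hence all of `τ`. -/
theorem exists_pointed_ge {F : Fan n} (hF : IsProjective (toricVariety F))
    {τ : PointedCone ℝ (Fin n → ℝ)} (hτ : τ ∈ F.cones) :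
    ∃ σ ∈ F.cones, IsPointed (dualMonoid σ) ∧ τ ≤ σ := by
  obtain ⟨w, -, hw, -⟩ := exists_interior hτ
  obtain ⟨σ, hσ, h1, h2⟩ := exists_cone_of_weights hF (pairing w) 0
  exact ⟨σ, hσ, h2, hw σ hσ (mem_of_forall_dualMonoid hσ fun m hm => (h1 m hm).1)⟩

/-- The monoid of a face is obtained by inverting the characters that vanish on it. -/
theorem isFaceOf_of_le {F : Fan n} {σ τ : PointedCone ℝ (Fin n → ℝ)} (hσ : σ ∈ F.cones)
    (hτ : τ ∈ F.cones) (h : τ ≤ σ) : τ.IsFaceOf σ := by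
  have := F.inf_isFaceOf σ hσ τ hτ
  rwa [inf_eq_right.2 h] at this

end Cones

/-! ### Krull dimension is bounded by the rank of the lattice. -/

section Dimension

theorem Point.ringKrullDim_localization_le {K : Type*} [Field K] [Algebra ℂ K]
    (A : Subalgebra ℂ K) (𝔭 : Ideal A) [𝔭.IsPrime] :
    ringKrullDim (Point.localization A 𝔭).ring ≤ ringKrullDim A := by
  let i : A →+* (Point.localization A 𝔭).ring :=
    (Subalgebra.inclusion (Point.le_localization A 𝔭)).toRingHom
  refine Order.krullDim_le_of_strictMono (PrimeSpectrum.comap i) fun P Q hPQ => ?_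
  refine lt_of_le_not_ge (fun a ha => hPQ.le ha) fun hle => hPQ.not_ge ?_
  rintro ⟨_, a, s, hs, rfl⟩ hz
  have hs0 := Point.coe_ne_zero_of_notMem hs
  have h1 : i a ∈ Q.asIdeal := by
    have := Q.asIdeal.mul_mem_left (i s) hz
    convert this
    exact Subtype.ext (mul_div_cancel₀ _ hs0).symm
  have h2 : i a ∈ P.asIdeal := hle h1
  have := P.asIdeal.mul_mem_left ⟨(s : K)⁻¹, Point.inv_mem_localization hs⟩ h2
  convert this
  exact Subtype.ext (div_eq_inv_mul (a : K) (s : K))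

/-- Incomparability: contraction of primes along an integral map is strictly monotone. -/
theorem ringKrullDim_le_of_isIntegral {A B : Type*} [CommRing A] [CommRing B] (f : A →+* B)
    (hf : f.IsIntegral) : ringKrullDim B ≤ ringKrullDim A := by
  let _ := f.toAlgebra
  have : Algebra.IsIntegral A B := ⟨hf⟩
  exact Order.krullDim_le_of_strictMono (PrimeSpectrum.comap f)
    fun P Q hPQ => Ideal.IsIntegral.comap_lt_comap (R := A) hPQ

variable {n : ℕ}

theorem trdeg_functionField_le : Algebra.trdeg ℂ (FunctionField n) ≤ n := by
  set s : Set (FunctionField n) := Set.range fun i : Fin n => character (Pi.single i 1)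
  have hchar : ∀ m : Fin n → ℤ, IsAlgebraic (Algebra.adjoin ℂ s) (character m) := by
    intro m
    have h0 : ∀ i, IsAlgebraic (Algebra.adjoin ℂ s) (character (Pi.single i 1 : Fin n → ℤ)) :=
      fun i => isAlgebraic_algebraMap
        (⟨_, Algebra.subset_adjoin ⟨i, rfl⟩⟩ : Algebra.adjoin ℂ s)
    have h1 : ∀ i (k : ℕ), IsAlgebraic (Algebra.adjoin ℂ s)
        (character (Pi.single i (k : ℤ) : Fin n → ℤ)) := by
      intro i k
      have : (Pi.single i (k : ℤ) : Fin n → ℤ) = k • Pi.single i 1 := by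
        rw [← Pi.single_smul]; simp
      rw [this, character_nsmul]
      exact (h0 i).pow k
    have h2 : ∀ i (k : ℤ), IsAlgebraic (Algebra.adjoin ℂ s)
        (character (Pi.single i k : Fin n → ℤ)) := by
      intro i k
      obtain ⟨k, rfl | rfl⟩ := k.eq_nat_or_neg
      · exact h1 i k
      · rw [Pi.single_neg, character_neg]
        exact (h1 i k).inv
    rw [← Finset.univ_sum_single m, character_sum]
    exact Finset.prod_induction _ (IsAlgebraic (Algebra.adjoin ℂ s)) (fun a b ha hb => ha.mul hb)
      isAlgebraic_one fun i _ => h2 i _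
  have hlaur : ∀ f : AddMonoidAlgebra ℂ (Fin n → ℤ),
      IsAlgebraic (Algebra.adjoin ℂ s) (algebraMap _ (FunctionField n) f) := by
    intro f
    rw [algebraMap_eq_sum]
    refine Finset.sum_induction _ (IsAlgebraic (Algebra.adjoin ℂ s)) (fun a b ha hb => ha.add hb)
      isAlgebraic_zero fun m _ => ?_
    rw [Algebra.smul_def]
    refine IsAlgebraic.mul ?_ (hchar m)
    exact isAlgebraic_algebraMap (algebraMap ℂ (Algebra.adjoin ℂ s) (f.coeff m))
  have : Algebra.IsAlgebraic (Algebra.adjoin ℂ s) (FunctionField n) := by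
    constructor
    intro z
    obtain ⟨a, b, -, rfl⟩ := IsFractionRing.div_surjective (A := AddMonoidAlgebra ℂ (Fin n → ℤ)) z
    rw [div_eq_mul_inv]
    exact (hlaur a).mul (hlaur b).inv
  refine (Algebra.IsAlgebraic.trdeg_le_cardinalMk ℂ s).trans ?_
  refine Cardinal.mk_range_le.trans ?_
  simp

/-- By Noether normalization `A` is integral over a polynomial ring, whose number of variables is at
most the transcendence degree of the function field. -/
theorem ringKrullDim_le_of_finiteType (A : Subalgebra ℂ (FunctionField n))
    (hA : Algebra.FiniteType ℂ A) : ringKrullDim A ≤ n := by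
  obtain ⟨s, g, hg, hint⟩ := exists_integral_inj_algHom_of_fg ℂ A
  have h1 : AlgebraicIndependent ℂ fun i : Fin s => ((g (MvPolynomial.X i) : A) : FunctionField n) := by
    rw [algebraicIndependent_iff_injective_aeval]
    have : MvPolynomial.aeval (fun i : Fin s => ((g (MvPolynomial.X i) : A) : FunctionField n)) =
        A.val.comp g := by
      ext i
      simp
    rw [this]
    exact Subtype.val_injective.comp hg
  have h2 := h1.lift_cardinalMk_le_trdeg.trans (Cardinal.lift_le.2 trdeg_functionField_le)
  have h3 : s ≤ n := by simpa using h2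
  refine (ringKrullDim_le_of_isIntegral _ hint).trans ?_
  rw [MvPolynomial.ringKrullDim_of_isNoetherianRing, ringKrullDim_eq_zero_of_field]
  simpa using h3

end Dimension

/-! ### The torus fixed point and its cotangent space. -/

section Laurent

variable {n : ℕ}

theorem monoidAlg_le_range (S : AddSubmonoid (Fin n → ℤ)) :
    monoidAlg S ≤ (IsScalarTower.toAlgHom ℂ (AddMonoidAlgebra ℂ (Fin n → ℤ))
      (FunctionField n)).range := by
  rintro _ ⟨g, -, hg⟩
  exact ⟨g, hg⟩

/-- The Laurent polynomial of an element of `ℂ[S]`. -/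
def toLaurent (S : AddSubmonoid (Fin n → ℤ)) :
    monoidAlg S →ₐ[ℂ] AddMonoidAlgebra ℂ (Fin n → ℤ) :=
  ((AlgEquiv.ofInjective (IsScalarTower.toAlgHom ℂ (AddMonoidAlgebra ℂ (Fin n → ℤ))
    (FunctionField n)) (IsFractionRing.injective _ _)).symm.toAlgHom).comp
    (Subalgebra.inclusion (monoidAlg_le_range S))

variable {S : AddSubmonoid (Fin n → ℤ)}

theorem algebraMap_toLaurent (f : monoidAlg S) :
    algebraMap _ (FunctionField n) (toLaurent S f) = f := by
  let e := AlgEquiv.ofInjective (IsScalarTower.toAlgHom ℂ (AddMonoidAlgebra ℂ (Fin n → ℤ))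
    (FunctionField n)) (IsFractionRing.injective _ _)
  have := e.apply_symm_apply (Subalgebra.inclusion (monoidAlg_le_range S) f)
  exact congrArg Subtype.val this

theorem toLaurent_eq {f : monoidAlg S} {g : AddMonoidAlgebra ℂ (Fin n → ℤ)}
    (h : algebraMap _ (FunctionField n) g = f) : toLaurent S f = g :=
  IsFractionRing.injective _ (FunctionField n) ((algebraMap_toLaurent f).trans h.symm)

theorem toLaurent_character {m : Fin n → ℤ} (hm : character m ∈ monoidAlg S) :
    toLaurent S ⟨character m, hm⟩ = AddMonoidAlgebra.single m 1 := toLaurent_eq rfl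

theorem coeff_toLaurent_eq_zero (f : monoidAlg S) {m : Fin n → ℤ} (hm : m ∉ S) :
    (toLaurent S f).coeff m = 0 := by
  obtain ⟨f, g, hg, rfl⟩ := f
  rw [toLaurent_eq (g := g) rfl]
  by_contra h
  exact hm (hg m (Finsupp.mem_support_iff.2 h))

/-- `h` is not the sum of two nonzero elements of `S`. -/
def IsIndecomposable (S : AddSubmonoid (Fin n → ℤ)) (h : Fin n → ℤ) : Prop :=
  ∀ a ∈ S, ∀ b ∈ S, a + b = h → a = 0 ∨ b = 0

/-- Only pairs with `a + b = h` contribute. Indecomposability leaves `a = 0` or `b = 0`, and `a = 0`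
is excluded by `hf`. Thus the coefficient at an indecomposable nonzero `h` is a linear form on `𝔪 /
𝔪²`. -/
theorem coeff_mul_of_indecomposable {h : Fin n → ℤ} (hh : IsIndecomposable S h)
    (f g : monoidAlg S) (hf : (toLaurent S f).coeff 0 = 0) :
    (toLaurent S (f * g)).coeff h = (toLaurent S f).coeff h * (toLaurent S g).coeff 0 := by
  classical
  rw [map_mul, AddMonoidAlgebra.coeff_mul]
  simp only [Finsupp.sum]
  have hS : ∀ (f : monoidAlg S) (a : Fin n → ℤ), a ∈ (toLaurent S f).coeff.support → a ∈ S := by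
    intro f a ha
    by_contra h
    exact Finsupp.mem_support_iff.1 ha (coeff_toLaurent_eq_zero f h)
  rw [Finset.sum_congr rfl fun a ha => Finset.sum_congr (g := fun b =>
    if a = h ∧ b = 0 then (toLaurent S f).coeff a * (toLaurent S g).coeff b else 0) rfl
    fun b hb => ?_]
  · rw [Finset.sum_eq_single h, Finset.sum_eq_single 0]
    · simp
    · intro b _ hb
      simp [hb]
    · intro hb
      simp [Finsupp.notMem_support_iff.1 hb]
    · intro a _ ha
      simp [ha]
    · intro ha
      simp [Finsupp.notMem_support_iff.1 ha]
  · congr 1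
    rw [eq_iff_iff]
    constructor
    · intro hab
      have ha0 : a ≠ 0 := by
        rintro rfl
        exact Finsupp.mem_support_iff.1 ha hf
      have hb0 := (hh a (hS f a ha) b (hS g b hb) hab).resolve_left ha0
      exact ⟨by rw [← hab, hb0, add_zero], hb0⟩
    · rintro ⟨rfl, rfl⟩
      simp

theorem IsPointed.isIndecomposable_zero (hS : IsPointed S) : IsIndecomposable S 0 := by
  intro a ha b hb hab
  left
  refine hS a ha ?_
  rwa [neg_eq_of_add_eq_zero_right hab]

/-- The value at the torus fixed point. -/
def evalOrigin (hS : IsPointed S) : monoidAlg S →+* ℂ where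
  toFun f := (toLaurent S f).coeff 0
  map_one' := by
    rw [map_one, AddMonoidAlgebra.one_def]
    simp
  map_zero' := by simp
  map_add' f g := by simp
  map_mul' f g := by
    -- Splitting off the constant term of `f` reduces to the previous lemma with `h = 0`.
    have h1 : f * g = (f - algebraMap ℂ _ ((toLaurent S f).coeff 0)) * g +
        algebraMap ℂ _ ((toLaurent S f).coeff 0) * g := by ring
    have h0 : (toLaurent S (f - algebraMap ℂ _ ((toLaurent S f).coeff 0))).coeff 0 = 0 := by
      rw [map_sub, AlgHom.commutes, AddMonoidAlgebra.coeff_sub, Finsupp.sub_apply]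
      simp
    conv_lhs => rw [h1]
    rw [map_add, AddMonoidAlgebra.coeff_add, Finsupp.add_apply,
      coeff_mul_of_indecomposable hS.isIndecomposable_zero _ _ h0, h0, zero_mul, zero_add,
      ← Algebra.smul_def, map_smul, AddMonoidAlgebra.coeff_smul, Finsupp.smul_apply, smul_eq_mul]

theorem evalOrigin_apply (hS : IsPointed S) (f : monoidAlg S) :
    evalOrigin hS f = (toLaurent S f).coeff 0 := rfl

/-- The maximal ideal of the torus fixed point. -/
def originIdeal (hS : IsPointed S) : Ideal (monoidAlg S) := RingHom.ker (evalOrigin hS)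

instance (hS : IsPointed S) : (originIdeal hS).IsMaximal := by
  refine RingHom.ker_isMaximal_of_surjective _ fun c => ⟨algebraMap ℂ _ c, ?_⟩
  rw [evalOrigin_apply, AlgHom.commutes]
  simp

/-- The Hilbert basis of `S` injects into a basis of the cotangent space at the origin. -/
theorem card_indecomposable_le (hS : IsPointed S) {d : ℕ}
    (f : Fin d → (Point.localization (monoidAlg S) (originIdeal hS)).ring)
    (hf : Ideal.span (Set.range f) = maximalIdeal _) (T : Finset (Fin n → ℤ))
    (hT : ∀ h ∈ T, h ∈ S ∧ h ≠ 0 ∧ IsIndecomposable S h) : T.card ≤ d := by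
  classical
  have hfm : ∀ i, f i ∈ maximalIdeal _ := fun i => hf ▸ Ideal.subset_span ⟨i, rfl⟩
  choose a s ha hs has using fun i => (Point.mem_maximalIdeal_localization _).1 (hfm i)
  -- Clearing denominators: up to a factor `Q` invertible at the origin, every germ in the ideal is
  -- a combination of the numerators `a i`.
  have key : ∀ z ∈ Ideal.span (Set.range f), ∃ Q : monoidAlg S, Q ∉ originIdeal hS ∧
      ∃ p : Fin d → monoidAlg S, (z : FunctionField n) * Q = ((∑ i, p i * a i : monoidAlg S) : _) := by
    intro z hz
    induction hz using Submodule.span_induction with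
    | mem z hz =>
      obtain ⟨i, rfl⟩ := hz
      refine ⟨s i, hs i, Pi.single i 1, ?_⟩
      rw [has i, div_mul_cancel₀ _ (Point.coe_ne_zero_of_notMem (hs i))]
      congr 1
      rw [Finset.sum_eq_single i]
      · simp
      · intro j _ hj
        simp [hj]
      · simp
    | zero =>
      refine ⟨1, fun h => ?_, 0, by simp⟩
      exact (inferInstance : (originIdeal hS).IsMaximal).ne_top ((Ideal.eq_top_iff_one _).2 h)
    | add x y _ _ hx hy =>
      obtain ⟨Q, hQ, p, hp⟩ := hx
      obtain ⟨Q', hQ', p', hp'⟩ := hy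
      refine ⟨Q * Q', fun h => ?_, fun i => p i * Q' + p' i * Q, ?_⟩
      · exact ((inferInstance : (originIdeal hS).IsMaximal).isPrime.mem_or_mem h).elim hQ hQ'
      · have : (∑ i, (p i * Q' + p' i * Q) * a i) =
            (∑ i, p i * a i) * Q' + (∑ i, p' i * a i) * Q := by
          rw [Finset.sum_mul, Finset.sum_mul, ← Finset.sum_add_distrib]
          exact Finset.sum_congr rfl fun i _ => by ring
        have h2 : (((∑ i, p i * a i) * Q' + (∑ i, p' i * a i) * Q : monoidAlg S) :
            FunctionField n) = ((∑ i, p i * a i : monoidAlg S) : FunctionField n) * Q' +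
            ((∑ i, p' i * a i : monoidAlg S) : FunctionField n) * Q := rfl
        rw [this, h2, ← hp, ← hp']
        push_cast
        ring
    | smul c x _ hx =>
      obtain ⟨Q, hQ, p, hp⟩ := hx
      obtain ⟨u, v, hv, huv⟩ := c.2
      refine ⟨v * Q, fun h => ?_, fun i => u * p i, ?_⟩
      · exact ((inferInstance : (originIdeal hS).IsMaximal).isPrime.mem_or_mem h).elim hv hQ
      · have : (∑ i, u * p i * a i) = u * ∑ i, p i * a i := by
          rw [Finset.mul_sum]
          exact Finset.sum_congr rfl fun i _ => by ring
        have hv0 := Point.coe_ne_zero_of_notMem hv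
        have h2 : ((u * ∑ i, p i * a i : monoidAlg S) : FunctionField n) =
          u * ((∑ i, p i * a i : monoidAlg S) : FunctionField n) := rfl
        rw [this, h2, ← hp, smul_eq_mul]
        push_cast
        rw [huv]
        field_simp
  -- The coefficients at `h'` of `x^h * Q = ∑ p i * a i` give a matrix identity: a diagonal matrix
  -- with nonzero entries factors through `ℂ^d`.
  have hχ : ∀ h : T, ∃ Q : monoidAlg S, Q ∉ originIdeal hS ∧ ∃ p : Fin d → monoidAlg S,
      ∀ h' : T, (if h = h' then (1 : ℂ) else 0) * (toLaurent S Q).coeff 0 =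
        ∑ i, (toLaurent S (a i)).coeff h' * (toLaurent S (p i)).coeff 0 := by
    intro h
    have hmem : character h.1 ∈ monoidAlg S := character_mem_monoidAlg.2 (hT _ h.2).1
    have hχ0 : (toLaurent S ⟨character h.1, hmem⟩).coeff 0 = 0 := by
      rw [toLaurent_character, AddMonoidAlgebra.coeff_single, Finsupp.single_apply,
        if_neg (hT _ h.2).2.1]
    obtain ⟨Q, hQ, p, hp⟩ := key ⟨character h.1, Point.le_localization _ _ hmem⟩ (by
      rw [hf]
      exact (Point.mem_maximalIdeal_localization_coe (⟨character h.1, hmem⟩ : monoidAlg S)).2 hχ0)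
    refine ⟨Q, hQ, p, fun h' => ?_⟩
    have h1 : (⟨character h.1, hmem⟩ : monoidAlg S) * Q = ∑ i, p i * a i := Subtype.ext hp
    have h2 := congrArg (fun z => (toLaurent S z).coeff h'.1) h1
    rw [coeff_mul_of_indecomposable (hT _ h'.2).2.2 _ _ hχ0, toLaurent_character,
      AddMonoidAlgebra.coeff_single, Finsupp.single_apply] at h2
    simp only [← Subtype.ext_iff] at h2
    rw [h2, map_sum, AddMonoidAlgebra.coeff_sum, Finsupp.finsetSum_apply]
    refine Finset.sum_congr rfl fun i _ => ?_
    rw [mul_comm (p i), coeff_mul_of_indecomposable (hT _ h'.2).2.2 _ _ (ha i)]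
  choose Q hQ p hp using hχ
  have hli : LinearIndependent ℂ fun (h : T) (i : Fin d) => (toLaurent S (a i)).coeff h.1 := by
    rw [Fintype.linearIndependent_iff]
    intro g hg h
    have h1 : ∑ h' : T, g h' * ((if h = h' then (1 : ℂ) else 0) * (toLaurent S (Q h)).coeff 0) = 0 := by
      simp_rw [hp, Finset.mul_sum]
      rw [Finset.sum_comm]
      refine Finset.sum_eq_zero fun i _ => ?_
      have := congrFun hg i
      simp only [Finset.sum_apply, Pi.smul_apply, smul_eq_mul, Pi.zero_apply] at this
      simp_rw [← mul_assoc]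
      rw [← Finset.sum_mul, this, zero_mul]
    simp only [ite_mul, one_mul, zero_mul, mul_ite, mul_zero, Finset.sum_ite_eq, Finset.mem_univ,
      if_true] at h1
    exact (mul_eq_zero.1 h1).resolve_right (hQ h)
  simpa using hli.fintype_card_le_finrank

end Laurent

/-! ### Cones of a smooth fan are generated by lattice bases. -/

section SmoothCones

variable {n : ℕ}

/-- Otherwise both `u` and `-u` lie in `σ` by double duality, against strong convexity. -/
theorem exists_dotProduct_ne_zero {F : Fan n} {σ : PointedCone ℝ (Fin n → ℝ)} (hσ : σ ∈ F.cones)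
    {u : Fin n → ℤ} (hu : u ≠ 0) : ∃ m ∈ dualMonoid σ, m ⬝ᵥ u ≠ 0 := by
  by_contra! h
  refine hu ?_
  have h1 : toReal u ∈ σ := mem_of_forall_dualMonoid hσ fun m hm => (h m hm).ge
  have h2 : toReal (-u) ∈ σ := mem_of_forall_dualMonoid hσ fun m hm => by
    rw [dotProduct_neg, h m hm, neg_zero]
  have h3 : toReal (-u) = -toReal u := by ext i; simp [toReal]
  rw [h3] at h2
  have h4 := F.stronglyConvex σ hσ _ h1 h2
  ext i
  have := congrFun h4 i
  simpa [toReal] using this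

/-- The dual monoid of a strongly convex cone generates the lattice. -/
theorem exists_sub_of_mem {F : Fan n} {σ : PointedCone ℝ (Fin n → ℝ)} (hσ : σ ∈ F.cones)
    (m : Fin n → ℤ) : ∃ s ∈ dualMonoid σ, m + s ∈ dualMonoid σ := by
  let q : (Fin n → ℤ) → Fin n → ℚ := fun m i => (m i : ℚ)
  -- A rational functional vanishing on the dual monoid becomes, after clearing denominators, a
  -- lattice vector excluded by `exists_dotProduct_ne_zero`.
  have hspan : Submodule.span ℚ (q '' dualMonoid σ) = ⊤ := by
    by_contra hne
    obtain ⟨f, hf0, hf⟩ := Submodule.exists_le_ker_of_lt_top _ (lt_top_iff_ne_top.2 hne)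
    obtain ⟨⟨D, hD0⟩, hD⟩ := IsLocalization.exist_integer_multiples_of_finite (nonZeroDivisors ℤ)
      (fun i => f (Pi.single i 1))
    choose u hu using hD
    have hu' : ∀ i, (u i : ℚ) = D * f (Pi.single i 1) := fun i => by simpa using hu i
    have hD1 : (D : ℚ) ≠ 0 := by exact_mod_cast nonZeroDivisors.ne_zero hD0
    have hfx : ∀ x, f x = ∑ i, x i * f (Pi.single i 1) := by
      intro x
      conv_lhs => rw [← Finset.univ_sum_single x, map_sum]
      refine Finset.sum_congr rfl fun i _ => ?_
      have : (Pi.single i (x i) : Fin n → ℚ) = x i • Pi.single i 1 := by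
        rw [← Pi.single_smul]; simp
      rw [this, map_smul, smul_eq_mul]
    have hu0 : u ≠ 0 := by
      rintro rfl
      refine hf0 (LinearMap.ext fun x => ?_)
      rw [hfx]
      refine Finset.sum_eq_zero fun i _ => ?_
      have := hu' i
      simp only [Pi.zero_apply, Int.cast_zero, zero_eq_mul, hD1, false_or] at this
      rw [this, mul_zero]
    obtain ⟨m, hm, hmu⟩ := exists_dotProduct_ne_zero hσ hu0
    refine hmu ?_
    have h1 : f (q m) = 0 := hf (Submodule.subset_span ⟨m, hm, rfl⟩)
    rw [hfx] at h1
    have h2 : ((m ⬝ᵥ u : ℤ) : ℚ) = D * ∑ i, q m i * f (Pi.single i 1) := by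
      rw [Finset.mul_sum]
      simp only [dotProduct]
      push_cast
      refine Finset.sum_congr rfl fun i _ => ?_
      rw [hu']
      ring
    rw [h1, mul_zero] at h2
    exact_mod_cast h2
  have hx : ∀ x ∈ Submodule.span ℚ (q '' dualMonoid σ), ∃ N : ℕ, 0 < N ∧ ∃ s ∈ dualMonoid σ,
      ∃ t ∈ dualMonoid σ, (N : ℚ) • x = q s - q t := by
    intro x hx
    have qadd : ∀ a b, q (a + b) = q a + q b := fun a b => by ext i; simp [q]
    have qsmul : ∀ (k : ℕ) a, q (k • a) = (k : ℚ) • q a := fun k a => by ext i; simp [q]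
    have q0 : q 0 = 0 := by ext i; simp [q]
    induction hx using Submodule.span_induction with
    | mem x hx =>
      obtain ⟨m, hm, rfl⟩ := hx
      exact ⟨1, one_pos, m, hm, 0, zero_mem _, by simp [q0]⟩
    | zero => exact ⟨1, one_pos, 0, zero_mem _, 0, zero_mem _, by simp⟩
    | add x y _ _ hx hy =>
      obtain ⟨N, hN, s, hs, t, ht, h⟩ := hx
      obtain ⟨N', hN', s', hs', t', ht', h'⟩ := hy
      refine ⟨N * N', Nat.mul_pos hN hN', N' • s + N • s',
        add_mem (nsmul_mem hs _) (nsmul_mem hs' _), N' • t + N • t',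
        add_mem (nsmul_mem ht _) (nsmul_mem ht' _), ?_⟩
      have : ((N * N' : ℕ) : ℚ) • (x + y) = (N' : ℚ) • ((N : ℚ) • x) + (N : ℚ) • ((N' : ℚ) • y) := by
        push_cast
        module
      rw [this, h, h', qadd, qadd, qsmul, qsmul, qsmul, qsmul]
      module
    | smul c x _ hx =>
      obtain ⟨N, hN, s, hs, t, ht, h⟩ := hx
      have hc : (c.den : ℚ) * c = c.num := Rat.den_mul_eq_num c
      have h1 : ((c.den * N : ℕ) : ℚ) • c • x = (c.num : ℚ) • ((N : ℚ) • x) := by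
        rw [← hc]
        push_cast
        module
      obtain ⟨k, hk | hk⟩ := c.num.eq_nat_or_neg
      · refine ⟨c.den * N, Nat.mul_pos c.den_pos hN, k • s, nsmul_mem hs _, k • t, nsmul_mem ht _, ?_⟩
        rw [h1, h, qsmul, qsmul, hk]
        push_cast
        module
      · refine ⟨c.den * N, Nat.mul_pos c.den_pos hN, k • t, nsmul_mem ht _, k • s, nsmul_mem hs _, ?_⟩
        rw [h1, h, qsmul, qsmul, hk]
        push_cast
        module
  obtain ⟨N, hN, s, hs, t, ht, h⟩ := hx (q m) (hspan ▸ Submodule.mem_top)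
  have h1 : N • m + t = s := by
    ext i
    have := congrFun h i
    simp only [Pi.smul_apply, smul_eq_mul, Pi.sub_apply, q] at this
    simp only [Pi.add_apply, nsmul_eq_mul]
    have h2 : (N : ℚ) * m i + t i = s i := by linarith
    exact_mod_cast h2
  -- From `N • m + t = s` one gets `N • (m + t) = s + (N - 1) • t`, and the dual monoid is
  -- saturated, so the factor `N` can be divided out.
  refine ⟨t, ht, fun u hu => ?_⟩
  have h2 : N • (m + t) ∈ dualMonoid σ := by
    have : N • (m + t) = s + (N - 1) • t := by
      obtain ⟨N, rfl⟩ := Nat.exists_eq_add_of_le' hN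
      rw [← h1, smul_add, add_tsub_cancel_right, add_smul N 1 t, one_smul]
      abel
    rw [this]
    exact add_mem hs (nsmul_mem ht _)
  have h3 := h2 u hu
  have h4 : ∑ i, (((N • (m + t)) i : ℤ) : ℝ) * u i = N * ∑ i, (((m + t) i : ℤ) : ℝ) * u i := by
    rw [Finset.mul_sum]
    refine Finset.sum_congr rfl fun i _ => ?_
    simp only [Pi.smul_apply, nsmul_eq_mul, Pi.add_apply]
    push_cast
    ring
  rw [h4] at h3
  exact nonneg_of_mul_nonneg_right h3 (by exact_mod_cast hN)

/-- The indecomposable elements generate the dual monoid of a maximal cone. -/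
theorem dualMonoid_eq_closure {F : Fan n} {σ : PointedCone ℝ (Fin n → ℝ)} (hσ : σ ∈ F.cones)
    (hp : IsPointed (dualMonoid σ)) :
    dualMonoid σ = AddSubmonoid.closure
      {h | h ∈ dualMonoid σ ∧ h ≠ 0 ∧ IsIndecomposable (dualMonoid σ) h} := by
  obtain ⟨w, hw, -, hw0⟩ := exists_interior hσ
  apply le_antisymm
  · have key : ∀ (k : ℕ) (m : Fin n → ℤ), m ∈ dualMonoid σ → (m ⬝ᵥ w).toNat = k →
        m ∈ AddSubmonoid.closure
          {h | h ∈ dualMonoid σ ∧ h ≠ 0 ∧ IsIndecomposable (dualMonoid σ) h} := by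
      intro k
      induction k using Nat.strong_induction_on with
      | _ k ih =>
        intro m hm hk
        by_cases hm0 : m = 0
        · rw [hm0]; exact zero_mem _
        by_cases hi : IsIndecomposable (dualMonoid σ) m
        · exact AddSubmonoid.subset_closure ⟨hm, hm0, hi⟩
        · unfold IsIndecomposable at hi
          push Not at hi
          obtain ⟨a, ha, b, hb, rfl, ha0, hb0⟩ := hi
          have pos : ∀ c ∈ dualMonoid σ, c ≠ 0 → 0 < c ⬝ᵥ w := fun c hc hc0 =>
            lt_of_le_of_ne (dotProduct_nonneg_of_mem hc hw) fun h =>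
              hc0 (hp c hc (hw0 c hc h.symm))
          have h1 := pos a ha ha0
          have h2 := pos b hb hb0
          rw [add_dotProduct] at hk
          exact add_mem (ih _ (by omega) a ha rfl) (ih _ (by omega) b hb rfl)
    exact fun m hm => key _ m hm rfl
  · rw [AddSubmonoid.closure_le]
    exact fun h hh => hh.1

theorem localization_mem_toricVariety {F : Fan n} {σ : PointedCone ℝ (Fin n → ℝ)}
    (hσ : σ ∈ F.cones) (𝔪 : Ideal (monoidAlg (dualMonoid σ))) [h : 𝔪.IsMaximal] :
    Point.localization (monoidAlg (dualMonoid σ)) 𝔪 (h𝔭 := h.isPrime) ∈ toricVariety F :=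
  ⟨σ, hσ, by rw [coneAlgebra_eq]; exact ⟨𝔪, h, rfl⟩⟩

/-- A maximal cone of a smooth fan is generated by a basis of the lattice. -/
theorem exists_basis_of_isSmooth {F : Fan n} (hF : IsSmooth (toricVariety F))
    {σ : PointedCone ℝ (Fin n → ℝ)} (hσ : σ ∈ F.cones) (hp : IsPointed (dualMonoid σ)) :
    ∃ e : Module.Basis (Fin n) ℤ (Fin n → ℤ), ∀ m, m ∈ dualMonoid σ ↔ ∀ i, 0 ≤ e.repr m i := by
  classical
  set H := {h | h ∈ dualMonoid σ ∧ h ≠ 0 ∧ IsIndecomposable (dualMonoid σ) h} with hH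
  have hcl := dualMonoid_eq_closure hσ hp
  rw [← hH] at hcl
  have hprime : (originIdeal hp).IsPrime := Ideal.IsMaximal.isPrime inferInstance
  have hreg : IsRegularLocalRing (Point.localization _ (originIdeal hp)).ring :=
    hF _ (localization_mem_toricVariety hσ (originIdeal hp))
  obtain ⟨G, hGcard, hG⟩ := Submodule.FG.exists_span_finset_card_eq_spanFinrank
    (IsNoetherian.noetherian (maximalIdeal (Point.localization _ (originIdeal hp)).ring))
  let f : Fin G.card → (Point.localization _ (originIdeal hp)).ring := fun i => (G.equivFin.symm i).1
  have hf : Ideal.span (Set.range f) = maximalIdeal _ := by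
    rw [← hG]
    congr 1
    ext z
    constructor
    · rintro ⟨i, rfl⟩
      exact (G.equivFin.symm i).2
    · intro hz
      exact ⟨G.equivFin ⟨z, hz⟩, by simp [f]⟩
  have hcard := card_indecomposable_le hp f hf
  -- The cotangent bound gives finiteness of the Hilbert basis before any bound by `n`. Finiteness
  -- makes the algebra of finite type, and only then does the dimension bound apply.
  have hfin : H.Finite := by
    by_contra hinf
    obtain ⟨T, hT, hTc⟩ := Set.Infinite.exists_subset_card_eq hinf (G.card + 1)
    have := hcard T fun h hh => hT hh
    omega
  have hft : Algebra.FiniteType ℂ (monoidAlg (dualMonoid σ)) := by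
    rw [← Subalgebra.fg_iff_finiteType]
    refine ⟨(hfin.image character).toFinset, ?_⟩
    rw [Set.Finite.coe_toFinset]
    apply le_antisymm
    · rw [Algebra.adjoin_le_iff]
      rintro _ ⟨h, hh, rfl⟩
      exact character_mem_monoidAlg.2 hh.1
    · refine monoidAlg_le fun m hm => ?_
      rw [hcl] at hm
      induction hm using AddSubmonoid.closure_induction with
      | mem x hx => exact Algebra.subset_adjoin ⟨x, hx, rfl⟩
      | zero => rw [character_zero]; exact one_mem _
      | add x y _ _ hx hy => rw [character_add]; exact mul_mem hx hy
  -- Here smoothness enters: the minimal number of generators of the maximal ideal equals the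
  -- dimension.
  have hdim : G.card ≤ n := by
    have h1 := hreg.spanFinrank_maximalIdeal
    rw [← hGcard] at h1
    have h2 := (Point.ringKrullDim_localization_le _ (originIdeal hp)).trans
      (ringKrullDim_le_of_finiteType _ hft)
    rw [← h1] at h2
    exact_mod_cast h2
  have hHn : hfin.toFinset.card ≤ n :=
    (hcard hfin.toFinset fun h hh => (Set.Finite.mem_toFinset hfin).1 hh).trans hdim
  -- The Hilbert basis, padded by zeros to length `n`. The padding turns out to be empty, since `v`
  -- is shown to be a basis.
  let v : Fin n → Fin n → ℤ := fun i =>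
    if h : (i : ℕ) < hfin.toFinset.card then (hfin.toFinset.equivFin.symm ⟨i, h⟩).1 else 0
  have hvS : ∀ i, v i ∈ dualMonoid σ := by
    intro i
    simp only [v]
    split_ifs with h
    · exact ((Set.Finite.mem_toFinset hfin).1 (hfin.toFinset.equivFin.symm ⟨i, h⟩).2).1
    · exact zero_mem _
  have hHv : ∀ h ∈ H, ∃ i, v i = h := by
    intro h hh
    set j := hfin.toFinset.equivFin ⟨h, (Set.Finite.mem_toFinset hfin).2 hh⟩ with hj
    refine ⟨⟨j, j.2.trans_le hHn⟩, ?_⟩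
    simp only [v, dif_pos j.2]
    rw [show (⟨(j : ℕ), j.2⟩ : Fin _) = j from rfl, hj, Equiv.symm_apply_apply]
  have hSv : ∀ m ∈ dualMonoid σ, ∃ c : Fin n → ℕ, m = ∑ i, c i • v i := by
    intro m hm
    rw [hcl] at hm
    induction hm using AddSubmonoid.closure_induction with
    | mem x hx =>
      obtain ⟨i, rfl⟩ := hHv x hx
      exact ⟨Pi.single i 1, by simp [Pi.single_apply, ite_smul]⟩
    | zero => exact ⟨0, by simp⟩
    | add x y _ _ hx hy =>
      obtain ⟨c, rfl⟩ := hx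
      obtain ⟨d, rfl⟩ := hy
      exact ⟨c + d, by simp [add_smul, Finset.sum_add_distrib]⟩
  let L : (Fin n → ℤ) →ₗ[ℤ] (Fin n → ℤ) := Fintype.linearCombination ℤ v
  have hL : ∀ c, L c = ∑ i, c i • v i := fun c => Fintype.linearCombination_apply _ _ _
  have hsurj : Function.Surjective L := by
    intro m
    obtain ⟨s, hs, hms⟩ := exists_sub_of_mem hσ m
    obtain ⟨c, hc⟩ := hSv s hs
    obtain ⟨d, hd⟩ := hSv _ hms
    refine ⟨fun i => (d i : ℤ) - c i, ?_⟩
    rw [hL]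
    simp only [sub_smul, Finset.sum_sub_distrib, natCast_zsmul]
    rw [← hc, ← hd]
    abel
  -- A surjective endomorphism of `ℤⁿ` is injective, so `n` generators of the lattice form a basis.
  have hinj := OrzechProperty.injective_of_surjective_endomorphism L hsurj
  have hli : LinearIndependent ℤ v := by
    rw [Fintype.linearIndependent_iff]
    intro g hg i
    have h1 : L g = L 0 := by rw [hL, hg, map_zero]
    exact congrFun (hinj h1) i
  have hsp : ⊤ ≤ Submodule.span ℤ (Set.range v) := by
    intro m _
    obtain ⟨c, rfl⟩ := hsurj m
    rw [hL]
    exact Submodule.sum_mem _ fun i _ => Submodule.smul_mem _ _ (Submodule.subset_span ⟨i, rfl⟩)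
  refine ⟨Module.Basis.mk hli hsp, fun m => ⟨fun hm i => ?_, fun h => ?_⟩⟩
  · obtain ⟨c, rfl⟩ := hSv m hm
    have : (∑ i, c i • v i) = ∑ i, (c i : ℤ) • (Module.Basis.mk hli hsp) i := by
      simp
    rw [this, Module.Basis.repr_sum_self]
    positivity
  · rw [← (Module.Basis.mk hli hsp).sum_repr m]
    refine sum_mem fun i _ => ?_
    rw [Module.Basis.mk_apply]
    obtain ⟨k, hk⟩ := Int.eq_ofNat_of_zero_le (h i)
    rw [hk, natCast_zsmul]
    exact nsmul_mem (hvS i) _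

end SmoothCones

/-! ### Affine space charts and their points. -/

section Charts

variable {n : ℕ}

theorem HasValueAt.unique {K : Type*} [Field K] [Algebra ℂ K] {f : K} {x : Point K} {c d : ℂ}
    (hc : HasValueAt f x c) (hd : HasValueAt f x d) : c = d := by
  have hf := hc.mem
  rw [hasValueAt_iff hf] at hc hd
  have h := Ideal.sub_mem _ hc hd
  rw [sub_sub_sub_cancel_left, ← map_sub] at h
  by_contra hne
  refine (mem_maximalIdeal _).1 h ?_
  exact (IsUnit.mk0 _ (sub_ne_zero.2 (Ne.symm hne))).map (algebraMap ℂ x.ring)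

/-- The basis of the dual lattice that is dual to `e`. -/
def dualBasis (e : Module.Basis (Fin n) ℤ (Fin n → ℤ)) (i : Fin n) : Fin n → ℤ :=
  fun j => e.repr (Pi.single j 1) i

theorem dotProduct_dualBasis (e : Module.Basis (Fin n) ℤ (Fin n → ℤ)) (m : Fin n → ℤ) (i : Fin n) :
    m ⬝ᵥ dualBasis e i = e.repr m i := by
  conv_rhs => rw [← Finset.univ_sum_single m, map_sum, Finsupp.finsetSum_apply]
  refine Finset.sum_congr rfl fun j _ => ?_
  have : (Pi.single j (m j) : Fin n → ℤ) = m j • Pi.single j 1 := by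
    rw [← Pi.single_smul]; simp
  rw [this, map_smul]
  rfl

theorem eq_sum_dualBasis (e : Module.Basis (Fin n) ℤ (Fin n → ℤ)) (w : Fin n → ℤ) :
    w = ∑ i, (e i ⬝ᵥ w) • dualBasis e i := by
  ext j
  have h1 : w j = (Pi.single j 1 : Fin n → ℤ) ⬝ᵥ w := by simp
  rw [h1]
  conv_lhs => rw [← e.sum_repr (Pi.single j 1), sum_dotProduct]
  rw [Finset.sum_apply]
  refine Finset.sum_congr rfl fun i _ => ?_
  rw [smul_dotProduct, Pi.smul_apply, smul_eq_mul, smul_eq_mul, mul_comm]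
  rfl

/-- `σ` is a maximal cone of `F`, and `e` is the basis of `M` that generates its dual. -/
structure IsChart (F : Fan n) (σ : PointedCone ℝ (Fin n → ℝ))
    (e : Module.Basis (Fin n) ℤ (Fin n → ℤ)) : Prop where
  mem : σ ∈ F.cones
  mem_dual : ∀ m, m ∈ dualMonoid σ ↔ ∀ i, 0 ≤ e.repr m i

variable {F : Fan n} {σ : PointedCone ℝ (Fin n → ℝ)} {e : Module.Basis (Fin n) ℤ (Fin n → ℤ)}

theorem IsChart.basis_mem (h : IsChart F σ e) (i : Fin n) : e i ∈ dualMonoid σ := by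
  rw [h.mem_dual]
  intro j
  rw [e.repr_self, Finsupp.single_apply]
  split_ifs <;> simp

theorem IsChart.dualBasis_mem (h : IsChart F σ e) (i : Fin n) : toReal (dualBasis e i) ∈ σ := by
  refine mem_of_forall_dualMonoid h.mem fun m hm => ?_
  rw [dotProduct_dualBasis]
  exact (h.mem_dual m).1 hm i

theorem toReal_sum_smul {ι : Type*} (s : Finset ι) (c : ι → ℤ) (u : ι → Fin n → ℤ) :
    toReal (∑ i ∈ s, c i • u i) = ∑ i ∈ s, (c i : ℝ) • toReal (u i) := by
  ext j
  simp [toReal]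

/-- If an interior vector of a face of `σ` has nonzero coordinate along a ray of `σ`, then the face
contains this ray. -/
theorem IsChart.dualBasis_mem_of_face (h : IsChart F σ e) {τ : PointedCone ℝ (Fin n → ℝ)}
    (hτ : τ.IsFaceOf σ) {w : Fin n → ℤ} (hw : toReal w ∈ τ) {i : Fin n} (hi : e i ⬝ᵥ w ≠ 0) :
    toReal (dualBasis e i) ∈ τ := by
  have hnn : ∀ i, 0 ≤ e i ⬝ᵥ w := fun i => dotProduct_nonneg_of_mem (h.basis_mem i) (hτ.le hw)
  have hmem : ∀ i, ((e i ⬝ᵥ w : ℤ) : ℝ) • toReal (dualBasis e i) ∈ σ := by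
    intro i
    exact Submodule.smul_mem σ (⟨((e i ⬝ᵥ w : ℤ) : ℝ), by exact_mod_cast hnn i⟩ : {c : ℝ // 0 ≤ c})
      (h.dualBasis_mem i)
  have hsum : ∑ i, ((e i ⬝ᵥ w : ℤ) : ℝ) • toReal (dualBasis e i) ∈ τ := by
    rw [← toReal_sum_smul, ← eq_sum_dualBasis]
    exact hw
  have h1 := hτ.mem_of_sum_mem hmem hsum i
  refine hτ.mem_of_smul_add_mem (a := ((e i ⬝ᵥ w : ℤ) : ℝ)) (y := 0) (h.dualBasis_mem i) (zero_mem _)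
    ?_ (by rwa [add_zero])
  exact_mod_cast lt_of_le_of_ne (hnn i) (Ne.symm hi)

theorem exists_isChart_ge (hs : IsSmooth (toricVariety F)) (hp : IsProjective (toricVariety F))
    {τ : PointedCone ℝ (Fin n → ℝ)} (hτ : τ ∈ F.cones) :
    ∃ σ e, IsChart F σ e ∧ τ ≤ σ := by
  obtain ⟨σ, hσ, hpt, hle⟩ := exists_pointed_ge hp hτ
  obtain ⟨e, he⟩ := exists_basis_of_isSmooth hs hσ hpt
  exact ⟨σ, e, ⟨hσ, he⟩, hle⟩

/-- A point of `U_τ` lies in `U_σ` if `x^{m+s} ∈ ℂ[σ^∨ ∩ M]` for suitable units `x^s`. -/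
theorem mem_affineVariety_of_units (hp : IsProjective (toricVariety F))
    {τ : PointedCone ℝ (Fin n → ℝ)} (hτ : τ ∈ F.cones)
    {z : Point (FunctionField n)} (hz : z ∈ affineVariety (coneAlgebra τ))
    (hle : monoidAlg (dualMonoid σ) ≤ z.ring)
    (h : ∀ m ∈ dualMonoid τ, ∃ s ∈ dualMonoid σ, m + s ∈ dualMonoid σ ∧ character (-s) ∈ z.ring) :
    z ∈ affineVariety (coneAlgebra σ) := by
  classical
  have hzX : z ∈ toricVariety F := ⟨τ, hτ, hz⟩
  -- A single character that is a unit at `z` moves all the monomials of `a` into the dual monoid of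
  -- `σ`; the units for the separate monomials are multiplied together.
  have key : ∀ a ∈ monoidAlg (dualMonoid τ), ∃ s ∈ dualMonoid σ, character (-s) ∈ z.ring ∧
      character s * a ∈ monoidAlg (dualMonoid σ) := by
    rintro _ ⟨g, hg, rfl⟩
    rw [algebraMap_eq_sum]
    generalize g.coeff.support = T at hg
    induction T using Finset.induction_on with
    | empty => exact ⟨0, zero_mem _, by simp [z.ring.one_mem], by simp⟩
    | insert m T hmT ih =>
      obtain ⟨s, hs, hs', hsT⟩ := ih fun m hm => hg m (Finset.mem_insert_of_mem hm)
      obtain ⟨t, ht, ht', htm⟩ := h m (hg m (Finset.mem_insert_self _ _))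
      refine ⟨s + t, add_mem hs ht, ?_, ?_⟩
      · rw [neg_add, character_add]
        exact mul_mem hs' htm
      · have : character (s + t) * ∑ m ∈ insert m T, g.coeff m • character m =
            g.coeff m • (character s * character (m + t)) +
            character t * (character s * ∑ m ∈ T, g.coeff m • character m) := by
          rw [Finset.sum_insert hmT, character_add, character_add, mul_add, mul_smul_comm]
          congr 1
          · congr 1
            ring
          · ring
        rw [this]
        exact add_mem (Subalgebra.smul_mem _
          (mul_mem (character_mem_monoidAlg.2 hs) (character_mem_monoidAlg.2 ht')) _)
          (mul_mem (character_mem_monoidAlg.2 ht) hsT)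
  rw [coneAlgebra_eq]
  refine mem_affineVariety_of_forall_eq_div (isRational_of_isProjective hp hzX) hle ?_
  rw [coneAlgebra_eq] at hz
  obtain ⟨𝔪, hmax, rfl⟩ := hz
  have := hmax.isPrime
  rintro _ ⟨a, t, ht, rfl⟩
  obtain ⟨s, hs, hs', hsa⟩ := key a a.2
  obtain ⟨s₂, hs₂, hs₂', hst⟩ := key t t.2
  have ht0 := Point.coe_ne_zero_of_notMem ht
  have h1 := character_ne_zero s
  have h2 := character_ne_zero s₂
  refine ⟨character s₂ * (character s * a), mul_mem (character_mem_monoidAlg.2 hs₂) hsa,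
    character s * (character s₂ * t), mul_mem (character_mem_monoidAlg.2 hs) hst,
    mul_ne_zero h1 (mul_ne_zero h2 ht0), ?_, ?_⟩
  · rw [mul_inv, mul_inv, ← character_neg, ← character_neg]
    exact mul_mem hs' (mul_mem hs₂' (Point.inv_mem_localization ht))
  · field_simp

/-- The affine toric variety of a face is open in that of the cone. -/
theorem affineVariety_coneAlgebra_mono (hp : IsProjective (toricVariety F)) (h : IsChart F σ e)
    {τ : PointedCone ℝ (Fin n → ℝ)} (hτ : τ ∈ F.cones) (hle : τ ≤ σ) :
    affineVariety (coneAlgebra τ) ⊆ affineVariety (coneAlgebra σ) := by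
  classical
  intro z hz
  have hz' := le_ring_of_mem_affineVariety hz
  rw [coneAlgebra_eq] at hz'
  refine mem_affineVariety_of_units hp hτ hz
    ((monoidAlg_mono (dualMonoid_anti hle)).trans hz') fun m hm => ?_
  obtain ⟨w, hw, -, hw0⟩ := exists_interior hτ
  have hface := isFaceOf_of_le h.mem hτ hle
  -- Coordinates `x^(e i)` with `e i ⬝ᵥ w = 0` are units on the chart of the face, so negative
  -- exponents there can be cancelled. In the other directions the ray lies in `τ` and the exponent
  -- is already nonnegative.
  refine ⟨∑ i with e i ⬝ᵥ w = 0, (e.repr m i).natAbs • e i,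
    sum_mem fun i _ => nsmul_mem (h.basis_mem i) _, ?_, ?_⟩
  · rw [h.mem_dual]
    intro j
    have h1 : e.repr (∑ i with e i ⬝ᵥ w = 0, (e.repr m i).natAbs • e i) j =
        if e j ⬝ᵥ w = 0 then ((e.repr m j).natAbs : ℤ) else 0 := by
      have h2 : ∀ b, e.repr ((e.repr m b).natAbs • e b) j =
          if b = j then ((e.repr m b).natAbs : ℤ) else 0 := by
        intro b
        rw [map_nsmul, e.repr_self, Finsupp.smul_apply, Finsupp.single_apply]
        split_ifs <;> simp
      rw [map_sum, Finsupp.finsetSum_apply]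
      simp only [h2]
      simp
    rw [map_add, Finsupp.add_apply, h1]
    split_ifs with hj
    · omega
    · rw [add_zero, ← dotProduct_dualBasis]
      exact dotProduct_nonneg_of_mem hm (h.dualBasis_mem_of_face hface hw hj)
  · refine hz' (character_mem_monoidAlg.2 ?_)
    rw [← Finset.sum_neg_distrib]
    refine sum_mem fun i hi => ?_
    rw [← smul_neg]
    exact nsmul_mem (hw0 _ (dualMonoid_anti hle (h.basis_mem i)) (Finset.mem_filter.1 hi).2) _

theorem exists_isChart_mem (hs : IsSmooth (toricVariety F)) (hp : IsProjective (toricVariety F))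
    {x : Point (FunctionField n)} (hx : x ∈ toricVariety F) :
    ∃ σ e, IsChart F σ e ∧ x ∈ affineVariety (coneAlgebra σ) := by
  obtain ⟨τ, hτ, hx⟩ := hx
  obtain ⟨σ, e, h, hle⟩ := exists_isChart_ge hs hp hτ
  exact ⟨σ, e, h, affineVariety_coneAlgebra_mono hp h hτ hle hx⟩

/-- The points of the torus lie in each affine toric variety of the fan. -/
theorem mem_affineVariety_of_torus (hp : IsProjective (toricVariety F)) (hσ : σ ∈ F.cones)
    {x : Point (FunctionField n)} (hx : x ∈ toricVariety F) (h : ∀ m, character m ∈ x.ring) :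
    x ∈ affineVariety (coneAlgebra σ) := by
  obtain ⟨τ, hτ, hx⟩ := hx
  refine mem_affineVariety_of_units hp hτ hx (monoidAlg_le fun m _ => h m) fun m _ => ?_
  obtain ⟨s, hs, hms⟩ := exists_sub_of_mem hσ m
  exact ⟨s, hs, hms, h _⟩

/-! #### Coordinates -/

/-- The lattice vector with coordinates `a` in the basis `e`. -/
def latticePoint (e : Module.Basis (Fin n) ℤ (Fin n → ℤ)) (a : Fin n →₀ ℕ) : Fin n → ℤ :=
  ∑ i, a i • e i

theorem repr_latticePoint (a : Fin n →₀ ℕ) (i : Fin n) : e.repr (latticePoint e a) i = a i := by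
  have : latticePoint e a = ∑ i, (a i : ℤ) • e i := by simp [latticePoint]
  rw [this, Module.Basis.repr_sum_self]

theorem latticePoint_injective : Function.Injective (latticePoint e) := by
  intro a b hab
  ext i
  have := congrArg (fun m => e.repr m i) hab
  simp only [repr_latticePoint] at this
  exact_mod_cast this

theorem latticePoint_add (a b : Fin n →₀ ℕ) :
    latticePoint e (a + b) = latticePoint e a + latticePoint e b := by
  simp [latticePoint, add_smul, Finset.sum_add_distrib]

@[simp]
theorem latticePoint_zero : latticePoint e 0 = 0 := by simp [latticePoint]

@[simp]
theorem latticePoint_single (i : Fin n) (k : ℕ) :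
    latticePoint e (Finsupp.single i k) = k • e i := by
  simp [latticePoint, Finsupp.single_apply, ite_smul]

theorem exists_latticePoint {m : Fin n → ℤ} (h : ∀ i, 0 ≤ e.repr m i) :
    ∃ a, m = latticePoint e a := by
  refine ⟨Finsupp.equivFunOnFinite.symm fun i => (e.repr m i).toNat, ?_⟩
  apply e.repr.injective
  ext i
  rw [repr_latticePoint]
  simpa using (h i)

theorem IsChart.mem_dual_iff (h : IsChart F σ e) {m : Fin n → ℤ} :
    m ∈ dualMonoid σ ↔ ∃ a, m = latticePoint e a := by
  rw [h.mem_dual]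
  refine ⟨exists_latticePoint, ?_⟩
  rintro ⟨a, rfl⟩ i
  rw [repr_latticePoint]
  positivity

/-- The coordinate functions `x^{e_1}, …, x^{e_n}`. -/
def chartHom (e : Module.Basis (Fin n) ℤ (Fin n → ℤ)) :
    MvPolynomial (Fin n) ℂ →ₐ[ℂ] FunctionField n :=
  MvPolynomial.aeval fun i => character (e i)

@[simp]
theorem chartHom_X (i : Fin n) : chartHom e (MvPolynomial.X i) = character (e i) :=
  MvPolynomial.aeval_X _ _

theorem chartHom_monomial (a : Fin n →₀ ℕ) (c : ℂ) :
    chartHom e (MvPolynomial.monomial a c) = c • character (latticePoint e a) := by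
  rw [chartHom, MvPolynomial.aeval_monomial, Algebra.smul_def, latticePoint, character_sum]
  congr 1
  rw [Finsupp.prod_fintype _ _ (fun i => pow_zero _)]
  exact Finset.prod_congr rfl fun i _ => (character_nsmul _ _).symm

theorem chartHom_eq_algebraMap (p : MvPolynomial (Fin n) ℂ) :
    chartHom e p = algebraMap _ (FunctionField n)
      (∑ a ∈ p.support, AddMonoidAlgebra.single (latticePoint e a) (p.coeff a)) := by
  conv_lhs => rw [p.as_sum]
  rw [map_sum, map_sum]
  refine Finset.sum_congr rfl fun a _ => ?_
  rw [chartHom_monomial, algebraMap_single]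

theorem chartHom_injective : Function.Injective (chartHom e) := by
  classical
  rw [injective_iff_map_eq_zero]
  intro p hp
  rw [chartHom_eq_algebraMap, IsFractionRing.to_map_eq_zero_iff] at hp
  ext a
  have := congrArg (fun f => f.coeff (latticePoint e a)) hp
  simp only [AddMonoidAlgebra.coeff_sum, Finsupp.finsetSum_apply, AddMonoidAlgebra.coeff_single,
    Finsupp.single_apply, latticePoint_injective.eq_iff, Finset.sum_ite_eq',
    MvPolynomial.mem_support_iff] at this
  by_contra h
  rw [if_pos (by simpa using h)] at this
  exact h (by simpa using this)

theorem IsChart.range_chartHom (h : IsChart F σ e) : (chartHom e).range = coneAlgebra σ := by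
  rw [coneAlgebra_eq]
  apply le_antisymm
  · rintro _ ⟨p, rfl⟩
    change chartHom e p ∈ _
    rw [p.as_sum, map_sum]
    refine sum_mem fun a _ => ?_
    rw [chartHom_monomial]
    exact Subalgebra.smul_mem _ (character_mem_monoidAlg.2 (h.mem_dual_iff.2 ⟨a, rfl⟩)) _
  · refine monoidAlg_le fun m hm => ?_
    obtain ⟨a, rfl⟩ := h.mem_dual_iff.1 hm
    exact ⟨MvPolynomial.monomial a 1, by
      change chartHom e _ = _
      rw [chartHom_monomial, one_smul]⟩

theorem exists_character_mul (e : Module.Basis (Fin n) ℤ (Fin n → ℤ))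
    (f : AddMonoidAlgebra ℂ (Fin n → ℤ)) : ∃ a p,
      character (latticePoint e a) * algebraMap _ (FunctionField n) f = chartHom e p := by
  rw [algebraMap_eq_sum]
  classical
  generalize f.coeff.support = T
  induction T using Finset.induction_on with
  | empty => exact ⟨0, 0, by simp⟩
  | insert m T hm ih =>
    obtain ⟨a, p, h⟩ := ih
    obtain ⟨b, hb⟩ : ∃ b : Fin n →₀ ℕ, ∀ i, 0 ≤ e.repr (m + latticePoint e b) i := by
      refine ⟨Finsupp.equivFunOnFinite.symm fun i => (e.repr m i).natAbs, fun i => ?_⟩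
      rw [map_add, Finsupp.add_apply, repr_latticePoint, Finsupp.equivFunOnFinite_symm_apply_apply]
      omega
    obtain ⟨c, hc⟩ := exists_latticePoint hb
    refine ⟨a + b, MvPolynomial.monomial (a + c) (f.coeff m) +
      MvPolynomial.monomial b 1 * p, ?_⟩
    rw [map_add, map_mul, chartHom_monomial, chartHom_monomial, one_smul, ← h,
      Finset.sum_insert hm, latticePoint_add, latticePoint_add, character_add, character_add, ← hc,
      character_add, mul_add, mul_smul_comm]
    congr 1
    · congr 1
      ring
    · ring

theorem exists_eq_chartHom_div (e : Module.Basis (Fin n) ℤ (Fin n → ℤ)) (f : FunctionField n) :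
    ∃ p q, q ≠ 0 ∧ f = chartHom e p / chartHom e q := by
  obtain ⟨a, b, hb, rfl⟩ := IsFractionRing.div_surjective (A := AddMonoidAlgebra ℂ (Fin n → ℤ)) f
  obtain ⟨c, p, hp⟩ := exists_character_mul e a
  obtain ⟨d, q, hq⟩ := exists_character_mul e b
  have h1 := character_ne_zero (latticePoint e c)
  have h2 := character_ne_zero (latticePoint e d)
  have hb0 : algebraMap _ (FunctionField n) b ≠ 0 := by
    rw [Ne, IsFractionRing.to_map_eq_zero_iff]
    exact nonZeroDivisors.ne_zero hb
  have hq0 : q ≠ 0 := by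
    rintro rfl
    rw [map_zero] at hq
    exact (mul_ne_zero h2 hb0) hq
  refine ⟨MvPolynomial.monomial d 1 * p, MvPolynomial.monomial c 1 * q,
    mul_ne_zero (by simp) hq0, ?_⟩
  rw [map_mul, map_mul, chartHom_monomial, chartHom_monomial, one_smul, one_smul, ← hp, ← hq]
  field_simp

theorem exists_eq_chartHom (z : (chartHom e).range) :
    ∃ p, z = ⟨chartHom e p, AlgHom.mem_range_self _ p⟩ := by
  obtain ⟨z, p, rfl⟩ := z
  exact ⟨p, rfl⟩

/-- Evaluation of functions on the chart. -/
def chartEval (e : Module.Basis (Fin n) ℤ (Fin n → ℤ)) (y : Fin n → ℂ) :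
    (chartHom e).range →ₐ[ℂ] ℂ :=
  (MvPolynomial.aeval y).comp (AlgEquiv.ofInjective (chartHom e) chartHom_injective).symm.toAlgHom

theorem chartEval_apply (y : Fin n → ℂ) (p : MvPolynomial (Fin n) ℂ)
    (h : chartHom e p ∈ (chartHom e).range) :
    chartEval e y ⟨chartHom e p, h⟩ = MvPolynomial.eval y p := by
  have : (⟨chartHom e p, h⟩ : (chartHom e).range) =
    AlgEquiv.ofInjective (chartHom e) chartHom_injective p := rfl
  rw [this]
  change MvPolynomial.aeval y ((AlgEquiv.ofInjective (chartHom e) chartHom_injective).symm _) = _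
  rw [AlgEquiv.symm_apply_apply]
  exact RingHom.congr_fun (MvPolynomial.coe_aeval_eq_eval y) p

/-- The point with coordinates `y` in the chart. -/
def chartPoint (e : Module.Basis (Fin n) ℤ (Fin n → ℤ)) (y : Fin n → ℂ) : Point (FunctionField n) :=
  Point.localization (chartHom e).range (RingHom.ker (chartEval e y))
    (h𝔭 := RingHom.ker_isPrime _)

theorem mem_chartPoint {y : Fin n → ℂ} {z : FunctionField n} :
    z ∈ (chartPoint e y).ring ↔
      ∃ p q, MvPolynomial.eval y q ≠ 0 ∧ z = chartHom e p / chartHom e q := by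
  constructor
  · rintro ⟨a, b, hq, rfl⟩
    obtain ⟨p, rfl⟩ := exists_eq_chartHom a
    obtain ⟨q, rfl⟩ := exists_eq_chartHom b
    refine ⟨p, q, ?_, rfl⟩
    rwa [RingHom.mem_ker, ← Ne, chartEval_apply] at hq
  · rintro ⟨p, q, hq, rfl⟩
    refine ⟨⟨_, AlgHom.mem_range_self _ p⟩, ⟨_, AlgHom.mem_range_self _ q⟩, ?_, rfl⟩
    rwa [RingHom.mem_ker, chartEval_apply]

theorem mem_maximalIdeal_chartPoint {y : Fin n → ℂ} {z : (chartPoint e y).ring} :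
    z ∈ maximalIdeal (chartPoint e y).ring ↔
      ∃ p q, MvPolynomial.eval y p = 0 ∧ MvPolynomial.eval y q ≠ 0 ∧
        (z : FunctionField n) = chartHom e p / chartHom e q := by
  have : (RingHom.ker (chartEval e y)).IsPrime := RingHom.ker_isPrime _
  refine (Point.mem_maximalIdeal_localization z).trans ?_
  constructor
  · rintro ⟨a, b, hp, hq, hz⟩
    obtain ⟨p, rfl⟩ := exists_eq_chartHom a
    obtain ⟨q, rfl⟩ := exists_eq_chartHom b
    rw [RingHom.mem_ker, chartEval_apply] at hp hq
    exact ⟨p, q, hp, hq, hz⟩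
  · rintro ⟨p, q, hp, hq, hz⟩
    refine ⟨⟨_, AlgHom.mem_range_self _ p⟩, ⟨_, AlgHom.mem_range_self _ q⟩, ?_, ?_, hz⟩
    · rwa [RingHom.mem_ker, chartEval_apply]
    · rwa [RingHom.mem_ker, chartEval_apply]

theorem chartHom_ne_zero {y : Fin n → ℂ} {q : MvPolynomial (Fin n) ℂ}
    (hq : MvPolynomial.eval y q ≠ 0) : chartHom e q ≠ 0 := by
  rw [Ne, map_eq_zero_iff _ chartHom_injective]
  rintro rfl
  simp at hq

theorem hasValueAt_chartPoint {y : Fin n → ℂ} (p : MvPolynomial (Fin n) ℂ)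
    {q : MvPolynomial (Fin n) ℂ} (hq : MvPolynomial.eval y q ≠ 0) :
    HasValueAt (chartHom e p / chartHom e q) (chartPoint e y)
      (MvPolynomial.eval y p / MvPolynomial.eval y q) := by
  rw [hasValueAt_iff (mem_chartPoint.2 ⟨p, q, hq, rfl⟩), mem_maximalIdeal_chartPoint]
  refine ⟨p - MvPolynomial.C (MvPolynomial.eval y p / MvPolynomial.eval y q) * q, q, ?_, hq, ?_⟩
  · rw [map_sub, map_mul, MvPolynomial.eval_C, div_mul_cancel₀ _ hq, sub_self]
  · have h0 := chartHom_ne_zero (e := e) hq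
    rw [map_sub, map_mul, sub_div, mul_div_cancel_right₀ _ h0]
    simp [chartHom]

theorem chartHom_mem_chartPoint (y : Fin n → ℂ) (p : MvPolynomial (Fin n) ℂ) :
    chartHom e p ∈ (chartPoint e y).ring :=
  mem_chartPoint.2 ⟨p, 1, by simp, by simp⟩

theorem hasValueAt_chartPoint' (y : Fin n → ℂ) (p : MvPolynomial (Fin n) ℂ) :
    HasValueAt (chartHom e p) (chartPoint e y) (MvPolynomial.eval y p) := by
  have := hasValueAt_chartPoint (e := e) (y := y) p (q := 1) (by simp)
  simpa using this

/-- Nullstellensatz for the polynomial ring of the chart coordinates. -/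
theorem mem_affineVariety_range_iff {x : Point (FunctionField n)} :
    x ∈ affineVariety (chartHom e).range ↔ ∃ y, x = chartPoint e y := by
  constructor
  · rintro ⟨𝔪, hmax, rfl⟩
    let E := AlgEquiv.ofInjective (chartHom e) chartHom_injective
    have hmax' : (𝔪.comap (E : MvPolynomial (Fin n) ℂ →+* (chartHom e).range)).IsMaximal :=
      Ideal.comap_isMaximal_of_surjective _ E.surjective
    obtain ⟨y, hy⟩ := MvPolynomial.isMaximal_iff_eq_vanishingIdeal_singleton.1 hmax'
    refine ⟨y, ?_⟩
    have : 𝔪 = RingHom.ker (chartEval e y) := by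
      ext a
      obtain ⟨p, rfl⟩ := exists_eq_chartHom a
      have h1 : p ∈ 𝔪.comap (E : MvPolynomial (Fin n) ℂ →+* (chartHom e).range) ↔
          MvPolynomial.eval y p = 0 := by
        rw [hy, MvPolynomial.mem_vanishingIdeal_singleton_iff,
          ← RingHom.congr_fun (MvPolynomial.coe_aeval_eq_eval y) p]
        rfl
      rw [RingHom.mem_ker, chartEval_apply, ← h1]
      rfl
    subst this
    rfl
  · rintro ⟨y, rfl⟩
    refine ⟨RingHom.ker (chartEval e y), RingHom.ker_isMaximal_of_surjective _ fun c => ?_, rfl⟩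
    exact ⟨algebraMap ℂ _ c, (chartEval e y).commutes c⟩

theorem IsChart.mem_affineVariety_iff (h : IsChart F σ e) {x : Point (FunctionField n)} :
    x ∈ affineVariety (coneAlgebra σ) ↔ ∃ y, x = chartPoint e y := by
  rw [← h.range_chartHom, mem_affineVariety_range_iff]

theorem IsChart.chartPoint_mem (h : IsChart F σ e) (y : Fin n → ℂ) :
    chartPoint e y ∈ toricVariety F :=
  ⟨σ, h.mem, h.mem_affineVariety_iff.2 ⟨y, rfl⟩⟩

theorem exists_eq_chartPoint (hs : IsSmooth (toricVariety F)) (hp : IsProjective (toricVariety F))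
    {x : Point (FunctionField n)} (hx : x ∈ toricVariety F) :
    ∃ σ e, IsChart F σ e ∧ ∃ y, x = chartPoint e y := by
  obtain ⟨σ, e, h, hx⟩ := exists_isChart_mem hs hp hx
  exact ⟨σ, e, h, h.mem_affineVariety_iff.1 hx⟩

theorem ne_zero_of_character_mem {y : Fin n → ℂ} {i : Fin n}
    (h : character (-(e i)) ∈ (chartPoint e y).ring) : y i ≠ 0 := by
  intro hy
  have h1 := hasValueAt_chartPoint' (e := e) y (MvPolynomial.X i)
  rw [chartHom_X, MvPolynomial.eval_X, hy] at h1
  have hm : character (e i) ∈ (chartPoint e y).ring := h1.mem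
  rw [hasValueAt_iff hm, map_zero, sub_zero, Point.mem_maximalIdeal_iff, ← character_neg] at h1
  exact h1 ⟨character_ne_zero _, h⟩

theorem character_mem_chartPoint {y : Fin n → ℂ} (hy : ∀ i, y i ≠ 0) (m : Fin n → ℤ) :
    character m ∈ (chartPoint e y).ring := by
  have h1 : ∀ i (k : ℤ), character (k • e i) ∈ (chartPoint e y).ring := by
    intro i k
    obtain ⟨k, rfl | rfl⟩ := k.eq_nat_or_neg
    · rw [natCast_zsmul, character_nsmul, ← chartHom_X]
      exact pow_mem (chartHom_mem_chartPoint _ _) _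
    · rw [neg_smul, natCast_zsmul, character_neg, character_nsmul, ← inv_pow]
      refine pow_mem (mem_chartPoint.2 ⟨1, MvPolynomial.X i, by simpa using hy i, ?_⟩) _
      simp
  rw [← e.sum_repr m, character_sum]
  exact prod_mem fun i _ => h1 i _

/-- The points of the torus, in the coordinates of a chart. -/
theorem IsChart.exists_eq_chartPoint_of_torus (h : IsChart F σ e)
    (hp : IsProjective (toricVariety F)) {x : Point (FunctionField n)} (hx : x ∈ toricVariety F)
    (hm : ∀ m, character m ∈ x.ring) : ∃ y, x = chartPoint e y ∧ ∀ i, y i ≠ 0 := by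
  obtain ⟨y, rfl⟩ := h.mem_affineVariety_iff.1 (mem_affineVariety_of_torus hp h.mem hx hm)
  exact ⟨y, rfl, fun i => ne_zero_of_character_mem (hm _)⟩

end Charts

/-! ### Jets in chart coordinates. -/

section Jets

variable {n : ℕ}

/-- The exponents of degree at most `k`. -/
def exponents (n k : ℕ) : Finset (Fin n →₀ ℕ) :=
  (Finset.range (k + 1)).biUnion fun d => Finset.univ.finsuppAntidiag d

theorem mem_exponents {k : ℕ} {a : Fin n →₀ ℕ} : a ∈ exponents n k ↔ a.degree ≤ k := by
  simp [exponents, Finset.mem_finsuppAntidiag, Finsupp.degree_eq_sum]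

theorem card_exponents (n k : ℕ) : (exponents n k).card = (n + k).choose n := by
  rw [exponents, Finset.card_biUnion]
  · simp only [Finset.card_finsuppAntidiag_nat_eq_multichoose, Finset.card_univ, Fintype.card_fin]
    rw [Nat.sum_range_multichoose, add_comm]
  · intro d _ d' _ hd
    rw [Function.onFun, Finset.disjoint_left]
    intro a ha ha'
    rw [Finset.mem_finsuppAntidiag] at ha ha'
    exact hd (ha.1.symm.trans ha'.1)

variable {e : Module.Basis (Fin n) ℤ (Fin n → ℤ)}

theorem sub_eval_mem_span (y : Fin n → ℂ) (p : MvPolynomial (Fin n) ℂ) :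
    p - MvPolynomial.C (MvPolynomial.eval y p) ∈
      Ideal.span (Set.range fun i => MvPolynomial.X i - MvPolynomial.C (y i)) := by
  induction p using MvPolynomial.induction_on with
  | C a => simp
  | add p q hp hq =>
    have := add_mem hp hq
    rw [map_add, map_add]
    convert this using 1
    ring
  | mul_X p i hp =>
    have h1 := Ideal.mul_mem_right (MvPolynomial.X i) _ hp
    have h2 := Ideal.mul_mem_left (Ideal.span (Set.range fun i =>
      MvPolynomial.X i - MvPolynomial.C (y i))) (MvPolynomial.C (MvPolynomial.eval y p))
      (Ideal.subset_span ⟨i, rfl⟩)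
    have := add_mem h1 h2
    simp only at this
    rw [map_mul, MvPolynomial.eval_X, map_mul]
    convert this using 1
    ring

/-- The germ at a point of a polynomial in the coordinates. -/
def chartGerm (e : Module.Basis (Fin n) ℤ (Fin n → ℤ)) (y : Fin n → ℂ) :
    MvPolynomial (Fin n) ℂ →ₐ[ℂ] (chartPoint e y).ring :=
  (chartHom e).codRestrict _ fun p => chartHom_mem_chartPoint y p

@[simp]
theorem coe_chartGerm (y : Fin n → ℂ) (p : MvPolynomial (Fin n) ℂ) :
    (chartGerm e y p : FunctionField n) = chartHom e p := rfl

theorem chartGerm_mem_maximalIdeal {y : Fin n → ℂ} {p : MvPolynomial (Fin n) ℂ} :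
    chartGerm e y p ∈ maximalIdeal (chartPoint e y).ring ↔ MvPolynomial.eval y p = 0 := by
  constructor
  · intro h
    have h1 := hasValueAt_chartPoint' (e := e) y p
    refine h1.unique ?_
    rw [hasValueAt_iff (chartHom_mem_chartPoint y p), map_zero, sub_zero]
    exact h
  · intro h
    exact mem_maximalIdeal_chartPoint.2 ⟨p, 1, h, by simp, by simp⟩

theorem isUnit_chartGerm {y : Fin n → ℂ} {p : MvPolynomial (Fin n) ℂ}
    (hp : MvPolynomial.eval y p ≠ 0) : IsUnit (chartGerm e y p) := by
  by_contra h
  exact hp (chartGerm_mem_maximalIdeal.1 ((mem_maximalIdeal _).2 h))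

theorem exists_mul_chartGerm {y : Fin n → ℂ} (f : (chartPoint e y).ring) :
    ∃ p q, MvPolynomial.eval y q ≠ 0 ∧ f * chartGerm e y q = chartGerm e y p := by
  obtain ⟨p, q, hq, h⟩ := mem_chartPoint.1 f.2
  refine ⟨p, q, hq, Subtype.ext ?_⟩
  change (f : FunctionField n) * chartHom e q = chartHom e p
  rw [h, div_mul_cancel₀ _ (chartHom_ne_zero hq)]

/-- Write `f = p / q` with `q` nonzero at `y`. Replacing `p` by its linear part at `y` and `q` by
its value there changes `f` by an element of `𝔪 ^ 2`. -/
theorem exists_linear_germ {y : Fin n → ℂ} {f : (chartPoint e y).ring}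
    (hf : f ∈ maximalIdeal (chartPoint e y).ring) :
    ∃ l : MvPolynomial (Fin n) ℂ, l.totalDegree ≤ 1 ∧
      f - chartGerm e y l ∈ maximalIdeal (chartPoint e y).ring ^ 2 := by
  set 𝔪 := maximalIdeal (chartPoint e y).ring
  have hX : ∀ i, chartGerm e y (MvPolynomial.X i - MvPolynomial.C (y i)) ∈ 𝔪 := fun i => by
    rw [chartGerm_mem_maximalIdeal]; simp
  have hpoly : ∀ p : MvPolynomial (Fin n) ℂ,
      p ∈ Ideal.span (Set.range fun i => MvPolynomial.X i - MvPolynomial.C (y i)) →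
      ∃ l : MvPolynomial (Fin n) ℂ, l.totalDegree ≤ 1 ∧ chartGerm e y (p - l) ∈ 𝔪 ^ 2 := by
    intro p hp
    obtain ⟨c, rfl⟩ := Ideal.mem_span_range_iff_exists_fun.1 hp
    refine ⟨∑ i, MvPolynomial.C (MvPolynomial.eval y (c i)) *
      (MvPolynomial.X i - MvPolynomial.C (y i)), ?_, ?_⟩
    · refine MvPolynomial.totalDegree_finsetSum_le fun i _ => ?_
      refine (MvPolynomial.totalDegree_mul _ _).trans ?_
      rw [MvPolynomial.totalDegree_C, zero_add]
      refine (MvPolynomial.totalDegree_sub_C_le _ _).trans ?_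
      simp
    · rw [← Finset.sum_sub_distrib, map_sum]
      refine sum_mem fun i _ => ?_
      rw [← sub_mul, map_mul, pow_two]
      refine Ideal.mul_mem_mul ?_ (hX i)
      rw [chartGerm_mem_maximalIdeal]
      simp
  obtain ⟨p, q, hq, hpq⟩ := exists_mul_chartGerm f
  have hp0 : MvPolynomial.eval y p = 0 := by
    rw [← chartGerm_mem_maximalIdeal (e := e), ← hpq]
    exact Ideal.mul_mem_right _ _ hf
  obtain ⟨l, hl, hpl⟩ := hpoly p (by simpa [hp0] using sub_eval_mem_span y p)
  set c := MvPolynomial.eval y q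
  refine ⟨MvPolynomial.C c⁻¹ * l, (MvPolynomial.totalDegree_mul _ _).trans (by simpa using hl), ?_⟩
  have h1 : chartGerm e y (MvPolynomial.C c⁻¹) * chartGerm e y (MvPolynomial.C c) = 1 := by
    rw [← map_mul, ← MvPolynomial.C_mul, inv_mul_cancel₀ hq, MvPolynomial.C_1, map_one]
  have h2 : f - chartGerm e y (MvPolynomial.C c⁻¹ * l) =
      chartGerm e y (MvPolynomial.C c⁻¹) * (chartGerm e y (p - l) -
        f * chartGerm e y (q - MvPolynomial.C c)) := by
    rw [map_sub, map_sub, ← hpq, map_mul]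
    linear_combination (-f) * h1
  rw [h2]
  refine Ideal.mul_mem_left _ _ (Ideal.sub_mem _ hpl ?_)
  rw [pow_two]
  refine Ideal.mul_mem_mul hf ?_
  rw [chartGerm_mem_maximalIdeal]
  simp [c]

/-- The polynomials of degree at most `k` generate the `k`-jets of functions. -/
theorem exists_jet {y : Fin n → ℂ} (k : ℕ) (f : (chartPoint e y).ring) :
    ∃ p : MvPolynomial (Fin n) ℂ, p.totalDegree ≤ k ∧
      f - chartGerm e y p ∈ maximalIdeal (chartPoint e y).ring ^ (k + 1) := by
  set 𝔪 := maximalIdeal (chartPoint e y).ring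
  have h0 : ∀ f : (chartPoint e y).ring, ∃ c : ℂ, f - chartGerm e y (MvPolynomial.C c) ∈ 𝔪 := by
    intro f
    obtain ⟨p, q, hq, h⟩ := mem_chartPoint.1 f.2
    have h1 := hasValueAt_chartPoint (e := e) p hq
    rw [← h, hasValueAt_iff f.2] at h1
    refine ⟨MvPolynomial.eval y p / MvPolynomial.eval y q, ?_⟩
    have h2 : ∀ c : ℂ, chartGerm e y (MvPolynomial.C c) = algebraMap ℂ _ c :=
      (chartGerm e y).commutes
    rwa [h2]
  -- Modulo `𝔪 ^ (k + 1)`, the ideal `𝔪 ^ k` is spanned by products of `k` linear germs; the jet is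
  -- then assembled degree by degree.
  have key : ∀ k, ∀ f ∈ 𝔪 ^ k, ∃ p : MvPolynomial (Fin n) ℂ, p.totalDegree ≤ k ∧
      f - chartGerm e y p ∈ 𝔪 ^ (k + 1) := by
    intro k
    induction k with
    | zero =>
      intro f _
      obtain ⟨c, hc⟩ := h0 f
      exact ⟨MvPolynomial.C c, by simp, by simpa using hc⟩
    | succ k ih =>
      intro f hf
      rw [pow_succ'] at hf
      refine Submodule.mul_induction_on hf ?_ ?_
      · intro a ha b hb
        obtain ⟨l, hl, hal⟩ := exists_linear_germ ha
        obtain ⟨q, hq, hbq⟩ := ih b hb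
        refine ⟨l * q, (MvPolynomial.totalDegree_mul _ _).trans (by omega), ?_⟩
        have hl𝔪 : chartGerm e y l ∈ 𝔪 := by
          have := Ideal.sub_mem _ ha (Ideal.pow_le_self two_ne_zero hal)
          rwa [sub_sub_cancel] at this
        have h1 : a * b - chartGerm e y (l * q) =
            (a - chartGerm e y l) * b + chartGerm e y l * (b - chartGerm e y q) := by
          rw [map_mul]; ring
        rw [h1]
        refine Ideal.add_mem _ ?_ ?_
        · have := Ideal.mul_mem_mul hal hb
          rwa [← pow_add, show 2 + k = k + 1 + 1 by ring] at this
        · have := Ideal.mul_mem_mul hl𝔪 hbq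
          rwa [← pow_succ'] at this
      · rintro f g ⟨p, hp, hfp⟩ ⟨q, hq, hgq⟩
        refine ⟨p + q, (MvPolynomial.totalDegree_add _ _).trans (by simp [hp, hq]), ?_⟩
        rw [map_add, add_sub_add_comm]
        exact Ideal.add_mem _ hfp hgq
  induction k with
  | zero => exact key 0 f (by simp)
  | succ k ih =>
    obtain ⟨p, hp, hfp⟩ := ih
    obtain ⟨q, hq, h⟩ := key (k + 1) _ hfp
    refine ⟨p + q, (MvPolynomial.totalDegree_add _ _).trans (max_le (by omega) hq), ?_⟩
    rwa [map_add, ← sub_sub]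

variable {X : Set (Point (FunctionField n))} {L : LineBundle X}

theorem LineBundle.exists_stalk_eq_span (L : LineBundle X) (x : X) :
    ∃ g, g ≠ 0 ∧ L.stalk x = Submodule.span x.1.ring {g} := by
  obtain ⟨U, -, hx, g, hg, h⟩ := L.locallyTrivial x
  exact ⟨g, hg, h x hx⟩

theorem LineBundle.mem_stalkℂ_iff {x : X} {g : FunctionField n}
    (hg : L.stalk x = Submodule.span x.1.ring {g}) {v : FunctionField n} :
    v ∈ L.stalkℂ x ↔ ∃ z : x.1.ring, v = z * g := by
  rw [LineBundle.stalkℂ, Submodule.restrictScalars_mem, hg, Submodule.mem_span_singleton]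
  exact exists_congr fun z => eq_comm

theorem LineBundle.mem_vanishingGerms_iff {x : X} {g : FunctionField n}
    (hg : L.stalk x = Submodule.span x.1.ring {g}) {k : ℕ} {v : FunctionField n} :
    v ∈ L.vanishingGerms k x ↔ ∃ z ∈ maximalIdeal x.1.ring ^ (k + 1), v = z * g := by
  rw [LineBundle.vanishingGerms, Submodule.restrictScalars_mem, hg, Submodule.mem_smul_span_singleton]
  exact exists_congr fun z => and_congr_right fun _ => eq_comm

theorem LineBundle.jetMap_eq_zero_iff {k : ℕ} {x : X} (v : L.globalSections) :
    L.jetMap k x v = 0 ↔ (v : FunctionField n) ∈ L.vanishingGerms k x := by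
  rw [LineBundle.jetMap, LinearMap.comp_apply, Submodule.mkQ_apply, Submodule.Quotient.mk_eq_zero]
  exact Iff.rfl

/-- The monomials of degree at most `k` generate the `k`-jets of sections. -/
theorem LineBundle.top_le_span_jets {y : Fin n → ℂ} (hx : chartPoint e y ∈ X) {g : FunctionField n}
    (hg : L.stalk ⟨chartPoint e y, hx⟩ = Submodule.span _ {g}) (k : ℕ)
    (v : exponents n k → L.stalkℂ ⟨chartPoint e y, hx⟩)
    (hv : ∀ a, (v a : FunctionField n) = character (latticePoint e a) * g) :
    ⊤ ≤ Submodule.span ℂ (Set.range fun a =>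
      (Submodule.Quotient.mk (v a) : L.JetFibre k ⟨chartPoint e y, hx⟩)) := by
  classical
  intro j _
  obtain ⟨⟨s, hs⟩, rfl⟩ := Submodule.Quotient.mk_surjective _ j
  obtain ⟨f, rfl⟩ := (LineBundle.mem_stalkℂ_iff hg).1 hs
  obtain ⟨p, hp, hfp⟩ := exists_jet k f
  have h1 : (Submodule.Quotient.mk ⟨f * g, hs⟩ : L.JetFibre k ⟨chartPoint e y, hx⟩) =
      ∑ a : exponents n k, p.coeff a • Submodule.Quotient.mk (v a) := by
    simp_rw [← Submodule.Quotient.mk_smul]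
    rw [← Submodule.mkQ_apply]
    simp_rw [← Submodule.mkQ_apply]
    rw [← map_sum, ← sub_eq_zero, ← map_sub, Submodule.mkQ_apply, Submodule.Quotient.mk_eq_zero]
    refine (LineBundle.mem_vanishingGerms_iff hg).2 ⟨_, hfp, ?_⟩
    rw [map_sub, map_sum]
    simp only [map_smul, Submodule.subtype_apply, hv]
    push_cast
    rw [sub_mul]
    congr 1
    rw [coe_chartGerm]
    conv_rhs => rw [p.as_sum]
    rw [map_sum, Finset.sum_mul]
    simp_rw [chartHom_monomial, smul_mul_assoc]
    rw [Finset.sum_coe_sort (exponents n k)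
      (fun a => p.coeff a • (character (latticePoint e a) * g))]
    symm
    refine Finset.sum_subset ?_ ?_
    · intro a ha
      rw [mem_exponents]
      exact (MvPolynomial.le_totalDegree ha).trans hp
    · intro a _ ha
      rw [MvPolynomial.notMem_support_iff.1 ha, zero_smul]
  rw [h1]
  exact Submodule.sum_mem _ fun a _ => Submodule.smul_mem _ _ (Submodule.subset_span ⟨a, rfl⟩)

/-- At a point of a chart, the jets of a jet spanned line bundle have as a basis the monomials of
degree at most `k`, and come from global sections. -/
theorem LineBundle.IsJetSpanned.jets {k : ℕ} (hL : L.IsJetSpanned n k)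
    {y : Fin n → ℂ} (hx : chartPoint e y ∈ X) {g : FunctionField n}
    (hg : L.stalk ⟨chartPoint e y, hx⟩ = Submodule.span _ {g})
    (v : exponents n k → L.stalkℂ ⟨chartPoint e y, hx⟩)
    (hv : ∀ a, (v a : FunctionField n) = character (latticePoint e a) * g) :
    Function.Surjective (L.jetMap k ⟨chartPoint e y, hx⟩) ∧
      LinearIndependent ℂ fun a =>
        (Submodule.Quotient.mk (v a) : L.JetFibre k ⟨chartPoint e y, hx⟩) := by
  have hspan := LineBundle.top_le_span_jets hx hg k v hv
  have hfd : FiniteDimensional ℂ (L.JetFibre k ⟨chartPoint e y, hx⟩) :=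
    ⟨⟨(Set.finite_range _).toFinset, by
      rw [Set.Finite.coe_toFinset]; exact top_le_iff.1 hspan⟩⟩
  have hcard : Fintype.card (exponents n k) = (n + k).choose n := by
    rw [Fintype.card_coe, card_exponents]
  -- The monomials bound the dimension of the jet fibre from above, the rank of the jet map bounds
  -- it from below. Equality gives surjectivity of the jet map and independence of the monomials at
  -- once.
  have h1 : Module.finrank ℂ (L.JetFibre k ⟨chartPoint e y, hx⟩) ≤ (n + k).choose n := by
    rw [← hcard, ← finrank_top ℂ (L.JetFibre k ⟨chartPoint e y, hx⟩), ← top_le_iff.1 hspan]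
    exact finrank_range_le_card _
  have h2 := hL ⟨chartPoint e y, hx⟩
  have h3 := Submodule.finrank_le (L.jetMap k ⟨chartPoint e y, hx⟩).range
  have h4 : Module.finrank ℂ (L.JetFibre k ⟨chartPoint e y, hx⟩) = (n + k).choose n :=
    le_antisymm h1 (h2.ge.trans h3)
  refine ⟨?_, linearIndependent_of_top_le_span_of_card_eq_finrank hspan (hcard.trans h4.symm)⟩
  rw [← LinearMap.range_eq_top]
  exact Submodule.eq_top_of_finrank_eq (h2.trans h4.symm)

theorem LineBundle.exists_monomials {y : Fin n → ℂ} (hx : chartPoint e y ∈ X) {g : FunctionField n}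
    (hg : L.stalk ⟨chartPoint e y, hx⟩ = Submodule.span _ {g}) (k : ℕ) :
    ∃ v : exponents n k → L.stalkℂ ⟨chartPoint e y, hx⟩,
      ∀ a, (v a : FunctionField n) = character (latticePoint e a) * g := by
  refine ⟨fun a => ⟨character (latticePoint e a) * g, ?_⟩, fun a => rfl⟩
  refine (LineBundle.mem_stalkℂ_iff hg).2 ⟨chartGerm e y (MvPolynomial.monomial a 1), ?_⟩
  rw [coe_chartGerm, chartHom_monomial, one_smul]

/-- Jet spanned line bundles are globally generated. -/
theorem LineBundle.IsJetSpanned.exists_generator {k : ℕ} (hL : L.IsJetSpanned n k)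
    {y : Fin n → ℂ} (hx : chartPoint e y ∈ X) :
    ∃ v ∈ L.globalSections, v ≠ 0 ∧ L.stalk ⟨chartPoint e y, hx⟩ = Submodule.span _ {v} := by
  obtain ⟨g, hg0, hg⟩ := L.exists_stalk_eq_span ⟨chartPoint e y, hx⟩
  obtain ⟨w, hw⟩ := LineBundle.exists_monomials hx hg k
  -- A section with the same `k`-jet as the local generator `g` has the form `(1 + z) * g` with `z`
  -- in the maximal ideal, hence is a generator too.
  obtain ⟨v, hv⟩ := (hL.jets hx hg w hw).1 (Submodule.Quotient.mk
    ⟨g, (LineBundle.mem_stalkℂ_iff hg).2 ⟨1, by simp⟩⟩)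
  rw [LineBundle.jetMap, LinearMap.comp_apply, ← Submodule.mkQ_apply, ← sub_eq_zero, ← map_sub,
    Submodule.mkQ_apply, Submodule.Quotient.mk_eq_zero] at hv
  obtain ⟨z, hz, h⟩ := (LineBundle.mem_vanishingGerms_iff hg).1 hv
  have h' : (v : FunctionField n) = (((1 : (chartPoint e y).ring) + z : _) : FunctionField n) * g := by
    have h2 : (v : FunctionField n) - g = z * g := h
    push_cast
    linear_combination h2
  have hunit : IsUnit ((1 : (chartPoint e y).ring) + z) := by
    by_contra hu
    have h3 := Ideal.sub_mem _ ((mem_maximalIdeal _).2 hu)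
      (Ideal.pow_le_self (Nat.succ_ne_zero k) hz)
    rw [add_sub_cancel_right] at h3
    exact (Ideal.ne_top_iff_one _).1 (maximalIdeal.isMaximal _).ne_top h3
  refine ⟨v, v.2, ?_, ?_⟩
  · rw [h']
    exact mul_ne_zero (fun h => hunit.ne_zero (Subtype.ext h)) hg0
  · rw [hg, h']
    exact (Submodule.span_singleton_smul_eq hunit g).symm

end Jets

/-! ### Line bundles on affine space and units on the torus. -/

section Trivialization

variable {n : ℕ} {e : Module.Basis (Fin n) ℤ (Fin n → ℤ)}

/-- A fraction `p / q` is regular wherever `q` does not vanish, so the subbasic open sets contain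
principal ones around each of their chart points. -/
theorem exists_basicOpen {U : Set (Point (FunctionField n))} (hU : IsOpen U) {y : Fin n → ℂ}
    (hy : chartPoint e y ∈ U) : ∃ q, MvPolynomial.eval y q ≠ 0 ∧
      ∀ y', MvPolynomial.eval y' q ≠ 0 → chartPoint e y' ∈ U := by
  induction hU with
  | basic s hs =>
    obtain ⟨f, rfl⟩ := hs
    obtain ⟨p, q, hq, rfl⟩ := mem_chartPoint.1 hy
    exact ⟨q, hq, fun y' hy' => mem_chartPoint.2 ⟨p, q, hy', rfl⟩⟩
  | univ => exact ⟨1, by simp, fun _ _ => trivial⟩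
  | inter s t _ _ hs ht =>
    obtain ⟨q, hq, h⟩ := hs hy.1
    obtain ⟨q', hq', h'⟩ := ht hy.2
    refine ⟨q * q', by simp [hq, hq'], fun y' hy' => ?_⟩
    rw [map_mul] at hy'
    exact ⟨h _ (left_ne_zero_of_mul hy'), h' _ (right_ne_zero_of_mul hy')⟩
  | sUnion S _ hS =>
    obtain ⟨s, hs, hy⟩ := hy
    obtain ⟨q, hq, h⟩ := hS s hs hy
    exact ⟨q, hq, fun y' hy' => ⟨s, hs, h y' hy'⟩⟩

variable {X : Set (Point (FunctionField n))} {L : LineBundle X}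

theorem isOpen_setOf_mem_ring (f : FunctionField n) :
    IsOpen {x : Point (FunctionField n) | f ∈ x.ring} :=
  TopologicalSpace.isOpen_generateFrom_of_mem ⟨f, rfl⟩

/-- A section that generates a line bundle at a point generates it in a neighbourhood. -/
theorem LineBundle.exists_open_generator {x : X} {v : FunctionField n}
    (hv : L.stalk x = Submodule.span _ {v}) : ∃ U : Set (Point (FunctionField n)),
      IsOpen U ∧ x.1 ∈ U ∧ ∀ y : X, y.1 ∈ U → L.stalk y = Submodule.span _ {v} := by
  obtain ⟨U, hU, hx, g, hg0, hg⟩ := L.locallyTrivial x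
  have h1 : v ∈ L.stalk x := hv ▸ Submodule.mem_span_singleton_self v
  have h2 : g ∈ L.stalk x := hg x hx ▸ Submodule.mem_span_singleton_self g
  rw [hg x hx, Submodule.mem_span_singleton] at h1
  rw [hv, Submodule.mem_span_singleton] at h2
  obtain ⟨a, ha⟩ := h1
  obtain ⟨b, hb⟩ := h2
  change (a : FunctionField n) * g = v at ha
  change (b : FunctionField n) * v = g at hb
  refine ⟨U ∩ ({z | (a : FunctionField n) ∈ z.ring} ∩ {z | (b : FunctionField n) ∈ z.ring}),
    hU.inter ((isOpen_setOf_mem_ring _).inter (isOpen_setOf_mem_ring _)),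
    ⟨hx, a.2, b.2⟩, fun y hy => ?_⟩
  rw [hg y hy.1]
  apply le_antisymm
  · rw [Submodule.span_singleton_le_iff_mem, Submodule.mem_span_singleton]
    exact ⟨⟨b, hy.2.2⟩, hb⟩
  · rw [Submodule.span_singleton_le_iff_mem, Submodule.mem_span_singleton]
    exact ⟨⟨a, hy.2.1⟩, ha⟩

theorem span_eq_top_of_forall_exists_eval_ne_zero {S : Set (MvPolynomial (Fin n) ℂ)}
    (h : ∀ y, ∃ q ∈ S, MvPolynomial.eval y q ≠ 0) : Ideal.span S = ⊤ := by
  by_contra hne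
  obtain ⟨𝔪, hmax, hle⟩ := Ideal.exists_le_maximal _ hne
  obtain ⟨y, rfl⟩ := MvPolynomial.isMaximal_iff_eq_vanishingIdeal_singleton.1 hmax
  obtain ⟨q, hq, hqy⟩ := h y
  have := hle (Ideal.subset_span hq)
  rw [MvPolynomial.mem_vanishingIdeal_singleton_iff] at this
  exact hqy ((RingHom.congr_fun (MvPolynomial.coe_aeval_eq_eval y) q).symm.trans this)

theorem exists_irreducible_factor {p : MvPolynomial (Fin n) ℂ} (hp : p ≠ 0) {y : Fin n → ℂ}
    (hy : MvPolynomial.eval y p = 0) :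
    ∃ r, Prime r ∧ r ∣ p ∧ MvPolynomial.eval y r = 0 := by
  induction p using UniqueFactorizationMonoid.induction_on_prime with
  | h₁ => exact absurd rfl hp
  | h₂ x hx => exact absurd hy ((hx.map (MvPolynomial.eval y)).ne_zero)
  | h₃ a r ha hr ih =>
    rw [map_mul, mul_eq_zero] at hy
    rcases hy with hy | hy
    · exact ⟨r, hr, dvd_mul_right _ _, hy⟩
    · obtain ⟨r', hr', hd, h⟩ := ih ha hy
      exact ⟨r', hr', hd.mul_left _, h⟩

/-- A globally generated line bundle is trivial on an affine space. -/
theorem LineBundle.exists_trivialization (hX : ∀ y, chartPoint e y ∈ X)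
    (hgen : ∀ y, ∃ v ∈ L.globalSections, v ≠ 0 ∧
      L.stalk ⟨chartPoint e y, hX y⟩ = Submodule.span _ {v}) :
    ∃ g, g ≠ 0 ∧ ∀ y, L.stalk ⟨chartPoint e y, hX y⟩ = Submodule.span _ {g} := by
  classical
  choose v hvV hv0 hv using hgen
  have hq : ∀ y, ∃ q : MvPolynomial (Fin n) ℂ, MvPolynomial.eval y q ≠ 0 ∧ ∀ y',
      MvPolynomial.eval y' q ≠ 0 →
        L.stalk ⟨chartPoint e y', hX y'⟩ = Submodule.span _ {v y} := by
    intro y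
    obtain ⟨U, hU, hyU, h⟩ := LineBundle.exists_open_generator (hv y)
    obtain ⟨q, hq, h'⟩ := exists_basicOpen hU hyU
    exact ⟨q, hq, fun y' hy' => h _ (h' y' hy')⟩
  choose q hq hqv using hq
  -- Quasi-compactness: a partition of unity selects finitely many generating sections.
  have htop : Ideal.span (Set.range q) = ⊤ :=
    span_eq_top_of_forall_exists_eval_ne_zero fun y => ⟨q y, ⟨y, rfl⟩, hq y⟩
  have h1 : (1 : MvPolynomial (Fin n) ℂ) ∈ Ideal.span (Set.range q) := htop ▸ Submodule.mem_top
  obtain ⟨c, hc⟩ := (Finsupp.mem_ideal_span_range_iff_exists_finsupp).1 h1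
  set Y := c.support
  have hcover : ∀ y', ∃ y ∈ Y, MvPolynomial.eval y' (q y) ≠ 0 := by
    intro y'
    by_contra! h
    have h2 := congrArg (MvPolynomial.eval y') hc
    rw [Finsupp.sum, map_sum, Finset.sum_eq_zero] at h2
    · simp at h2
    · intro y hy
      rw [map_mul, h y hy, mul_zero]
  have hYne : Y.Nonempty := by
    obtain ⟨y, hy, -⟩ := hcover 0
    exact ⟨y, hy⟩
  choose a b hb hab using fun y => exists_eq_chartHom_div e (v y)
  have hb0 : ∀ y, chartHom e (b y) ≠ 0 := fun y => by
    rw [Ne, map_eq_zero_iff _ chartHom_injective]; exact hb y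
  set D := ∏ y ∈ Y, b y
  have hD : chartHom e D ≠ 0 := by
    rw [Ne, map_eq_zero_iff _ chartHom_injective]
    exact Finset.prod_ne_zero_iff.2 fun y _ => hb y
  have hp : ∀ y, ∃ p, y ∈ Y → chartHom e p = chartHom e D * v y := by
    intro y
    by_cases hy : y ∈ Y
    · refine ⟨a y * ∏ y' ∈ Y.erase y, b y', fun _ => ?_⟩
      have : D = b y * ∏ y' ∈ Y.erase y, b y' := (Finset.mul_prod_erase Y b hy).symm
      rw [hab y, this, map_mul, map_mul]
      have := hb0 y
      field_simp
    · exact ⟨0, fun h => absurd h hy⟩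
  choose p hp using hp
  let _ : NormalizedGCDMonoid (MvPolynomial (Fin n) ℂ) :=
    Nonempty.some inferInstance
  -- Over the common denominator `D` the chosen sections have numerators `p y`; with `d` their
  -- greatest common divisor, `d / D` is the global generator.
  obtain ⟨p', hpp', hgcd⟩ := Finset.extract_gcd p hYne
  set d := Y.gcd p
  have hvp : ∀ y ∈ Y, v y = chartHom e d / chartHom e D * chartHom e (p' y) := by
    intro y hy
    have h3 := hp y hy
    rw [hpp' y hy, map_mul] at h3
    field_simp
    rw [mul_comm, ← h3]
  have hd0 : chartHom e d ≠ 0 := by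
    obtain ⟨y, hy⟩ := hYne
    intro h
    refine hv0 y ?_
    rw [hvp y hy, h]
    simp
  have hp'0 : ∀ y ∈ Y, p' y ≠ 0 := by
    intro y hy h
    refine hv0 y ?_
    rw [hvp y hy, h, map_zero, mul_zero]
  refine ⟨chartHom e d / chartHom e D, div_ne_zero hd0 hD, fun y' => ?_⟩
  obtain ⟨y, hy, hyq⟩ := hcover y'
  have hst := hqv y y' hyq
  -- Where `v y` generates, all quotients `p' z / p' y` are regular. A prime factor of `p' y`
  -- vanishing at `y'` would then divide every `p' z`, contradicting coprimality.
  have hne : MvPolynomial.eval y' (p' y) ≠ 0 := by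
    intro h0
    obtain ⟨r, hr, hrp, hr0⟩ := exists_irreducible_factor (hp'0 y hy) h0
    have hall : ∀ z ∈ Y, r ∣ p' z := by
      intro z hz
      have hz1 : v z ∈ L.stalkℂ ⟨chartPoint e y', hX y'⟩ :=
        (Submodule.mem_iInf _).1 (hvV z) ⟨chartPoint e y', hX y'⟩
      obtain ⟨f, hf⟩ := (LineBundle.mem_stalkℂ_iff hst).1 hz1
      obtain ⟨s, t, ht, hst'⟩ := mem_chartPoint.1 f.2
      have ht0 := chartHom_ne_zero (e := e) ht
      have h5 : p' z * t = s * p' y := by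
        apply chartHom_injective (e := e)
        rw [map_mul, map_mul]
        rw [hvp z hz, hvp y hy, hst'] at hf
        field_simp at hf
        rw [hf]
      have h6 : r ∣ p' z * t := h5 ▸ hrp.mul_left _
      refine (hr.dvd_or_dvd h6).resolve_right fun hrt => ht ?_
      obtain ⟨w, rfl⟩ := hrt
      rw [map_mul, hr0, zero_mul]
    have := Finset.dvd_gcd hall
    rw [hgcd] at this
    exact hr.not_isUnit (isUnit_of_dvd_one this)
  rw [hst, hvp y hy]
  have := Submodule.span_singleton_smul_eq (isUnit_chartGerm (e := e) hne)
    (chartHom e d / chartHom e D)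
  rw [← this]
  congr 2
  exact mul_comm _ _

/-- A rational function without zeros and poles on the torus is a multiple of a character. -/
theorem exists_eq_smul_character {f : FunctionField n} (hf0 : f ≠ 0)
    (h : ∀ y : Fin n → ℂ, (∀ i, y i ≠ 0) →
      f ∈ (chartPoint e y).ring ∧ f⁻¹ ∈ (chartPoint e y).ring) :
    ∃ (c : ℂ) (m : Fin n → ℤ), c ≠ 0 ∧ f = c • character m := by
  obtain ⟨p₀, q₀, hq₀, rfl⟩ := exists_eq_chartHom_div e f
  obtain ⟨p, q, r, hrel, rfl, rfl⟩ := UniqueFactorizationMonoid.exists_reduced_factors' p₀ q₀ hq₀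
  have hr0 : chartHom e r ≠ 0 := by
    rw [Ne, map_eq_zero_iff _ chartHom_injective]; exact left_ne_zero_of_mul hq₀
  rw [map_mul, map_mul, mul_div_mul_left _ _ hr0] at h hf0 ⊢
  have hunit : ∀ p q : MvPolynomial (Fin n) ℂ, chartHom e p ≠ 0 → chartHom e q ≠ 0 → IsRelPrime p q →
      (∀ y : Fin n → ℂ, (∀ i, y i ≠ 0) → chartHom e p / chartHom e q ∈ (chartPoint e y).ring) →
      ∃ a c, c ≠ 0 ∧ q = MvPolynomial.monomial a c := by
    intro p q hp0 hq0 hrel h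
    have hne : ∀ y : Fin n → ℂ, (∀ i, y i ≠ 0) → MvPolynomial.eval y q ≠ 0 := by
      intro y hy
      obtain ⟨s, t, ht, hst⟩ := mem_chartPoint.1 (h y hy)
      have ht0 := chartHom_ne_zero (e := e) ht
      have h1 : p * t = s * q := by
        apply chartHom_injective (e := e)
        rw [map_mul, map_mul]
        field_simp at hst
        rw [hst, mul_comm]
      have h2 : q ∣ t := hrel.symm.dvd_of_dvd_mul_left (h1 ▸ dvd_mul_left _ _)
      obtain ⟨w, rfl⟩ := h2
      rw [map_mul] at ht
      exact left_ne_zero_of_mul ht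
    -- The reduced denominator `q` has no zeros on the torus, so by the Nullstellensatz it divides a
    -- power of the product of the coordinates and is therefore a monomial.
    have h3 : (∏ i : Fin n, MvPolynomial.X i : MvPolynomial (Fin n) ℂ) ∈
        MvPolynomial.vanishingIdeal ℂ (MvPolynomial.zeroLocus ℂ (Ideal.span {q})) := by
      rw [MvPolynomial.mem_vanishingIdeal_iff]
      intro y hy
      rw [MvPolynomial.mem_zeroLocus_iff] at hy
      have hy' := hy q (Ideal.subset_span rfl)
      by_contra hprod
      refine hne y (fun i hi => hprod ?_)
        ((RingHom.congr_fun (MvPolynomial.coe_aeval_eq_eval y) q).symm.trans hy')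
      rw [map_prod]
      exact Finset.prod_eq_zero (Finset.mem_univ i) (by simpa using hi)
    rw [MvPolynomial.vanishingIdeal_zeroLocus_eq_radical] at h3
    obtain ⟨N, hN⟩ := h3
    rw [Ideal.mem_span_singleton] at hN
    have h4 : (∏ i : Fin n, MvPolynomial.X i : MvPolynomial (Fin n) ℂ) ^ N =
        MvPolynomial.monomial (N • ∑ i, Finsupp.single i 1) 1 := by
      rw [show (∏ i : Fin n, MvPolynomial.X i : MvPolynomial (Fin n) ℂ) =
        MvPolynomial.monomial (∑ i, Finsupp.single i 1) 1 from
          (MvPolynomial.monomial_sum_one _ _).symm, MvPolynomial.monomial_pow, one_pow]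
    rw [h4, MvPolynomial.dvd_monomial_one_iff_exists] at hN
    obtain ⟨a, c, -, hc, rfl⟩ := hN
    exact ⟨a, c, hc.ne_zero, rfl⟩
  have hp0 : chartHom e p ≠ 0 := fun h0 => hf0 (by rw [h0, zero_div])
  have hq0 : chartHom e q ≠ 0 := fun h0 => hf0 (by rw [h0, div_zero])
  obtain ⟨a, c, hc, hqa⟩ := hunit p q hp0 hq0 hrel fun y hy => (h y hy).1
  obtain ⟨b, d, hd, hpb⟩ := hunit q p hq0 hp0 hrel.symm fun y hy => by
    have := (h y hy).2
    rwa [inv_div] at this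
  refine ⟨d / c, latticePoint e b - latticePoint e a, div_ne_zero hd hc, ?_⟩
  rw [hqa, hpb, chartHom_monomial, chartHom_monomial, character_sub, Algebra.smul_def, Algebra.smul_def,
    Algebra.smul_def, map_div₀, div_mul_div_comm]

end Trivialization

/-! ### Monomial description of line bundles and sections. -/

section Linearization

variable {n : ℕ} {F : Fan n}

/-- A torus-equivariant description of a line bundle: on the chart of the basis `e` it is generated
by `character (w e) * g`. -/
structure LineBundle.IsLinearization (L : LineBundle (toricVariety F)) (g : FunctionField n)
    (w : Module.Basis (Fin n) ℤ (Fin n → ℤ) → Fin n → ℤ) : Prop where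
  ne_zero : g ≠ 0
  stalk_eq : ∀ {σ e} (h : IsChart F σ e) (y : Fin n → ℂ),
    L.stalk ⟨chartPoint e y, h.chartPoint_mem y⟩ = Submodule.span _ {character (w e) * g}

variable {L : LineBundle (toricVariety F)}

theorem LineBundle.stalk_eq_of_eq {x y : toricVariety F} (h : x.1 = y.1) {g : FunctionField n}
    (hg : L.stalk x = Submodule.span _ {g}) : L.stalk y = Submodule.span _ {g} := by
  obtain rfl : x = y := Subtype.ext h
  exact hg

theorem LineBundle.div_mem_of_stalk_eq {x : toricVariety F} {g g' : FunctionField n} (hg0 : g ≠ 0)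
    (hg : L.stalk x = Submodule.span _ {g}) (hg' : L.stalk x = Submodule.span _ {g'}) :
    g' / g ∈ x.1.ring := by
  have h1 : g' ∈ L.stalk x := hg' ▸ Submodule.mem_span_singleton_self g'
  rw [hg, Submodule.mem_span_singleton] at h1
  obtain ⟨a, ha⟩ := h1
  rw [← ha]
  change (a : FunctionField n) * g / g ∈ _
  rw [mul_div_cancel_right₀ _ hg0]
  exact a.2

/-- Jet spanned line bundles on smooth projective toric varieties can be linearized. -/
theorem LineBundle.IsJetSpanned.exists_isLinearization (hs : IsSmooth (toricVariety F))
    (hp : IsProjective (toricVariety F)) {k : ℕ} (hL : L.IsJetSpanned n k) :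
    ∃ g w, L.IsLinearization g w := by
  obtain ⟨τ, hτ⟩ := F.nonempty
  obtain ⟨σ, e, h, -⟩ := exists_isChart_ge hs hp hτ
  obtain ⟨g, hg0, hg⟩ := LineBundle.exists_trivialization (L := L) h.chartPoint_mem
    fun y => hL.exists_generator _
  have key : ∀ e', ∃ m : Fin n → ℤ, ∀ σ' (h' : IsChart F σ' e') (y : Fin n → ℂ),
      L.stalk ⟨chartPoint e' y, h'.chartPoint_mem y⟩ = Submodule.span _ {character m * g} := by
    intro e'
    by_cases hex : ∃ σ', IsChart F σ' e'
    · obtain ⟨σ', h'⟩ := hex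
      obtain ⟨g', hg'0, hg'⟩ := LineBundle.exists_trivialization (L := L) h'.chartPoint_mem
        fun y => hL.exists_generator _
      -- The torus lies in both charts, so the ratio of the two generators has neither zeros nor
      -- poles there.
      obtain ⟨c, m, hc, hcm⟩ := exists_eq_smul_character (e := e') (div_ne_zero hg'0 hg0) (by
        intro y hy
        obtain ⟨y', hy', -⟩ := h.exists_eq_chartPoint_of_torus hp (h'.chartPoint_mem y)
          (character_mem_chartPoint hy)
        have h1 : L.stalk ⟨chartPoint e' y, h'.chartPoint_mem y⟩ = Submodule.span _ {g} :=
          LineBundle.stalk_eq_of_eq hy'.symm (hg y')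
        refine ⟨LineBundle.div_mem_of_stalk_eq hg0 h1 (hg' y), ?_⟩
        rw [inv_div]
        exact LineBundle.div_mem_of_stalk_eq hg'0 (hg' y) h1)
      refine ⟨m, fun σ'' _ y => ?_⟩
      rw [hg' y]
      have h2 : g' = algebraMap ℂ (FunctionField n) c * (character m * g) := by
        rw [div_eq_iff hg0] at hcm
        rw [hcm, Algebra.smul_def, mul_assoc]
      have hu : IsUnit (algebraMap ℂ (chartPoint e' y).ring c) :=
        (IsUnit.mk0 c hc).map _
      rw [h2]
      exact Submodule.span_singleton_smul_eq hu _
    -- A basis that belongs to no chart gets the default value `0`.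
    · exact ⟨0, fun σ' h' => absurd ⟨σ', h'⟩ hex⟩
  choose w hw using key
  exact ⟨g, w, hg0, fun h y => hw _ _ h y⟩

namespace LineBundle.IsLinearization

variable {g : FunctionField n} {w : Module.Basis (Fin n) ℤ (Fin n → ℤ) → Fin n → ℤ}

theorem mem_globalSections_iff (hw : L.IsLinearization g w) (hs : IsSmooth (toricVariety F))
    (hp : IsProjective (toricVariety F)) {v : FunctionField n} :
    v ∈ L.globalSections ↔
      ∀ σ e, IsChart F σ e → character (-w e) * (v / g) ∈ coneAlgebra σ := by
  have hg0 := hw.ne_zero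
  have hstalk : ∀ {σ e} (h : IsChart F σ e) (y : Fin n → ℂ),
      v ∈ L.stalkℂ ⟨chartPoint e y, h.chartPoint_mem y⟩ ↔
        character (-w e) * (v / g) ∈ (chartPoint e y).ring := by
    intro σ e h y
    rw [LineBundle.mem_stalkℂ_iff (hw.stalk_eq h y)]
    have hχ := character_ne_zero (w e)
    rw [character_neg]
    constructor
    · rintro ⟨z, rfl⟩
      have : (character (w e))⁻¹ * (z * (character (w e) * g) / g) = z := by field_simp
      rw [this]
      exact z.2
    · intro hz
      refine ⟨⟨_, hz⟩, ?_⟩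
      change v = (character (w e))⁻¹ * (v / g) * (character (w e) * g)
      field_simp
  rw [LineBundle.globalSections, Submodule.mem_iInf]
  constructor
  · intro hv σ e h
    refine mem_of_forall_mem_affineVariety fun x hx => ?_
    obtain ⟨y, rfl⟩ := h.mem_affineVariety_iff.1 hx
    exact (hstalk h y).1 (hv _)
  · rintro hv ⟨x, hx⟩
    obtain ⟨σ, e, h, y, rfl⟩ := exists_eq_chartPoint hs hp hx
    exact (hstalk h y).2 (le_ring_of_mem_affineVariety (h.mem_affineVariety_iff.2 ⟨y, rfl⟩) (hv σ e h))

theorem character_mul_mem_iff (hw : L.IsLinearization g w) (hs : IsSmooth (toricVariety F))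
    (hp : IsProjective (toricVariety F)) {m : Fin n → ℤ} :
    character m * g ∈ L.globalSections ↔ ∀ σ e, IsChart F σ e → m - w e ∈ dualMonoid σ := by
  rw [hw.mem_globalSections_iff hs hp]
  refine forall_congr' fun σ => forall_congr' fun e => imp_congr_right fun _ => ?_
  rw [mul_div_cancel_right₀ _ hw.ne_zero, ← character_add, coneAlgebra_eq, character_mem_monoidAlg,
    neg_add_eq_sub]

/-- The exponents, in the coordinates of the chart of `e`, of the monomial sections. -/
def sectionExponents (_ : L.IsLinearization g w) (e : Module.Basis (Fin n) ℤ (Fin n → ℤ)) :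
    Set (Fin n →₀ ℕ) :=
  {b | character (w e + latticePoint e b) * g ∈ L.globalSections}

/-- Regularity on another chart passes from a section to its monomials: distinct monomials stay
distinct characters there, and a monoid algebra contains all the monomials of its elements. -/
theorem exists_polynomial (hw : L.IsLinearization g w) (hs : IsSmooth (toricVariety F))
    (hp : IsProjective (toricVariety F)) {σ e} (h : IsChart F σ e) {v : FunctionField n}
    (hv : v ∈ L.globalSections) :
    ∃ p : MvPolynomial (Fin n) ℂ, v = chartHom e p * (character (w e) * g) ∧
      ∀ b ∈ p.support, b ∈ hw.sectionExponents e := by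
  classical
  have hg0 := hw.ne_zero
  have hv' := (hw.mem_globalSections_iff hs hp).1 hv
  have h1 := hv' σ e h
  rw [← h.range_chartHom] at h1
  obtain ⟨p, hpv⟩ := h1
  have hχ := character_ne_zero (w e)
  replace hpv : chartHom e p = character (-w e) * (v / g) := hpv
  have hpv' : v = chartHom e p * (character (w e) * g) := by
    rw [hpv, character_neg]
    field_simp
  refine ⟨p, hpv', fun b hb => (hw.character_mul_mem_iff hs hp).2 fun σ' e' h' => ?_⟩
  have h2 := hv' σ' e' h'
  rw [coneAlgebra_eq, mem_monoidAlg] at h2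
  obtain ⟨f, hf, hfv⟩ := h2
  set s : (Fin n →₀ ℕ) → Fin n → ℤ := fun b => w e + latticePoint e b - w e' with hsdef
  have hsinj : Function.Injective s := fun a b hab =>
    latticePoint_injective (add_left_cancel (sub_left_injective hab))
  have h3 : f = ∑ b ∈ p.support, AddMonoidAlgebra.single (s b) (p.coeff b) := by
    apply IsFractionRing.injective _ (FunctionField n)
    rw [hfv, map_sum, hpv', ← mul_assoc, mul_div_cancel_right₀ _ hg0]
    conv_lhs => rw [p.as_sum]
    rw [map_sum, Finset.sum_mul, Finset.mul_sum]
    refine Finset.sum_congr rfl fun b _ => ?_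
    rw [chartHom_monomial, algebraMap_single, smul_mul_assoc, mul_smul_comm, ← character_add,
      ← character_add]
    congr 2
    simp only [hsdef]
    abel
  apply hf
  rw [Finsupp.mem_support_iff, h3, AddMonoidAlgebra.coeff_sum, Finsupp.finsetSum_apply,
    Finset.sum_eq_single b]
  · rw [AddMonoidAlgebra.coeff_single, Finsupp.single_eq_same]
    exact MvPolynomial.mem_support_iff.1 hb
  · intro b' _ hb'
    rw [AddMonoidAlgebra.coeff_single, Finsupp.single_eq_of_ne (hsinj.ne hb'.symm)]
  · exact fun h => absurd hb h

theorem chartHom_mul_mem (hw : L.IsLinearization g w) {e : Module.Basis (Fin n) ℤ (Fin n → ℤ)}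
    {p : MvPolynomial (Fin n) ℂ} (hpe : ∀ b ∈ p.support, b ∈ hw.sectionExponents e) :
    chartHom e p * (character (w e) * g) ∈ L.globalSections := by
  rw [p.as_sum, map_sum, Finset.sum_mul]
  refine Submodule.sum_mem _ fun b hb => ?_
  rw [chartHom_monomial, smul_mul_assoc]
  refine Submodule.smul_mem _ _ ?_
  rw [← mul_assoc, ← character_add, add_comm]
  exact hpe b hb

theorem jetMap_eq_zero_iff (hw : L.IsLinearization g w) {σ e} (h : IsChart F σ e) {k : ℕ}
    {y : Fin n → ℂ} {p : MvPolynomial (Fin n) ℂ} {v : L.globalSections}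
    (hv : (v : FunctionField n) = chartHom e p * (character (w e) * g)) :
    L.jetMap k ⟨chartPoint e y, h.chartPoint_mem y⟩ v = 0 ↔
      chartGerm e y p ∈ maximalIdeal (chartPoint e y).ring ^ (k + 1) := by
  rw [LineBundle.jetMap_eq_zero_iff, LineBundle.mem_vanishingGerms_iff (hw.stalk_eq h y), hv]
  constructor
  · rintro ⟨z, hz, hzp⟩
    have : chartGerm e y p = z := by
      apply Subtype.ext
      rw [coe_chartGerm]
      exact mul_right_cancel₀ (mul_ne_zero (character_ne_zero _) hw.ne_zero) hzp
    rwa [this]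
  · intro hp
    exact ⟨_, hp, by rw [coe_chartGerm]⟩

end LineBundle.IsLinearization

/-- Independence of the monomial jets, in the form in which two Taylor polynomials at the same point
are compared. -/
theorem eq_zero_of_chartGerm_mem_pow {k : ℕ} (hL : L.IsJetSpanned n k) {σ e}
    (h : IsChart F σ e) {y : Fin n → ℂ} {p : MvPolynomial (Fin n) ℂ} (hpk : p.totalDegree ≤ k)
    (hp : chartGerm e y p ∈ maximalIdeal (chartPoint e y).ring ^ (k + 1)) : p = 0 := by
  obtain ⟨g, -, hg⟩ := L.exists_stalk_eq_span ⟨chartPoint e y, h.chartPoint_mem y⟩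
  obtain ⟨v, hv⟩ := LineBundle.exists_monomials (h.chartPoint_mem y) hg k
  have hli := (hL.jets (h.chartPoint_mem y) hg v hv).2
  rw [Fintype.linearIndependent_iff] at hli
  have hsupp : p.support ⊆ exponents n k := fun a ha =>
    mem_exponents.2 ((MvPolynomial.le_totalDegree ha).trans hpk)
  have h0 := hli (fun a => p.coeff a) (by
    simp_rw [← Submodule.Quotient.mk_smul, ← Submodule.mkQ_apply]
    rw [← map_sum, Submodule.mkQ_apply, Submodule.Quotient.mk_eq_zero]
    refine (LineBundle.mem_vanishingGerms_iff hg).2 ⟨_, hp, ?_⟩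
    rw [map_sum]
    simp only [map_smul, Submodule.subtype_apply, hv]
    rw [coe_chartGerm]
    conv_rhs => rw [p.as_sum]
    rw [map_sum, Finset.sum_mul]
    simp_rw [chartHom_monomial, smul_mul_assoc]
    rw [Finset.sum_coe_sort (exponents n k)
      (fun a => p.coeff a • (character (latticePoint e a) * g))]
    symm
    refine Finset.sum_subset hsupp fun a _ ha => ?_
    rw [MvPolynomial.notMem_support_iff.1 ha, zero_smul])
  ext a
  rw [MvPolynomial.coeff_zero]
  by_contra ha
  exact ha (h0 ⟨a, hsupp (MvPolynomial.mem_support_iff.2 ha)⟩)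

theorem chartGerm_monomial_mem_pow {e : Module.Basis (Fin n) ℤ (Fin n → ℤ)} {k : ℕ}
    {b : Fin n →₀ ℕ} (hb : k ≤ b.degree) (c : ℂ) :
    chartGerm e 0 (MvPolynomial.monomial b c) ∈ maximalIdeal (chartPoint e 0).ring ^ k := by
  refine Ideal.pow_le_pow_right hb ?_
  rw [MvPolynomial.monomial_eq, map_mul, Finsupp.degree_eq_sum, ← Finset.prod_pow_eq_pow_sum,
    Finsupp.prod_fintype _ _ (fun i => by simp), map_prod]
  refine Ideal.mul_mem_left _ _ (Ideal.prod_mem_prod fun i _ => ?_)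
  rw [map_pow]
  exact Ideal.pow_mem_pow (chartGerm_mem_maximalIdeal.2 (by simp)) _

/-- At the vertex of a chart, all monomials of degree at most `k` are global sections. -/
theorem LineBundle.IsLinearization.mem_sectionExponents_of_degree_le
    {g : FunctionField n} {w : Module.Basis (Fin n) ℤ (Fin n → ℤ) → Fin n → ℤ}
    (hw : L.IsLinearization g w) (hs : IsSmooth (toricVariety F))
    (hp : IsProjective (toricVariety F)) {k : ℕ} (hL : L.IsJetSpanned n k) {σ e}
    (h : IsChart F σ e) {a : Fin n →₀ ℕ} (ha : a.degree ≤ k) : a ∈ hw.sectionExponents e := by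
  classical
  by_contra hne
  have hst := hw.stalk_eq h 0
  obtain ⟨u, hu⟩ := LineBundle.exists_monomials (h.chartPoint_mem 0) hst k
  -- A section with the same jet as `x^a` at the origin must contain the monomial `x^a` itself, and
  -- its monomials are sections.
  obtain ⟨v, hv⟩ := (hL.jets (h.chartPoint_mem 0) hst u hu).1
    (Submodule.Quotient.mk (u ⟨a, mem_exponents.2 ha⟩))
  rw [LineBundle.jetMap, LinearMap.comp_apply, ← Submodule.mkQ_apply, ← sub_eq_zero, ← map_sub,
    Submodule.mkQ_apply, Submodule.Quotient.mk_eq_zero] at hv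
  obtain ⟨z, hz, hvz⟩ := (LineBundle.mem_vanishingGerms_iff hst).1 hv
  obtain ⟨p, hpv, hpe⟩ := hw.exists_polynomial hs hp h v.2
  have hvz' : (v : FunctionField n) - u ⟨a, mem_exponents.2 ha⟩ = z * (character (w e) * g) := hvz
  have hzp : chartGerm e 0 (p - MvPolynomial.monomial a 1) = z := by
    apply Subtype.ext
    rw [coe_chartGerm]
    refine mul_right_cancel₀ (mul_ne_zero (character_ne_zero (w e)) hw.ne_zero) ?_
    rw [← hvz', hu, hpv, map_sub, chartHom_monomial, one_smul, sub_mul]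
  set q := p - MvPolynomial.monomial a 1
  -- Monomials of degree above `k` vanish to order `k` at the origin, so the truncation of `q` also
  -- has zero jet and hence is zero.
  set q' := ∑ b ∈ q.support with b.degree ≤ k, MvPolynomial.monomial b (q.coeff b)
  have hq' : chartGerm e 0 q' ∈ maximalIdeal (chartPoint e 0).ring ^ (k + 1) := by
    have h1 : q' = q - ∑ b ∈ q.support with ¬ b.degree ≤ k, MvPolynomial.monomial b (q.coeff b) := by
      rw [eq_sub_iff_add_eq, Finset.sum_filter_add_sum_filter_not]
      exact q.as_sum.symm
    rw [h1, map_sub, hzp, map_sum]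
    refine Ideal.sub_mem _ hz (Ideal.sum_mem _ fun b hb => ?_)
    rw [Finset.mem_filter, not_le] at hb
    exact chartGerm_monomial_mem_pow hb.2 _
  have hdeg : q'.totalDegree ≤ k := by
    refine MvPolynomial.totalDegree_finsetSum_le fun b hb => ?_
    exact (MvPolynomial.totalDegree_monomial_le _ _).trans (Finset.mem_filter.1 hb).2
  have hq0 := eq_zero_of_chartGerm_mem_pow hL h hdeg hq'
  have hpa : p.coeff a = 0 := by
    by_contra hpa
    exact hne (hpe a (MvPolynomial.mem_support_iff.2 hpa))
  have hqa : q.coeff a = -1 := by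
    rw [MvPolynomial.coeff_sub, hpa, MvPolynomial.coeff_monomial, if_pos rfl, zero_sub]
  have h2 : q'.coeff a = q.coeff a := by
    rw [MvPolynomial.coeff_sum]
    simp_rw [MvPolynomial.coeff_monomial]
    rw [Finset.sum_ite_eq']
    refine if_pos (Finset.mem_filter.2 ⟨MvPolynomial.mem_support_iff.2 ?_, ha⟩)
    rw [hqa]
    exact neg_ne_zero.2 one_ne_zero
  rw [hq0, MvPolynomial.coeff_zero, hqa] at h2
  exact neg_ne_zero.2 one_ne_zero h2.symm

end Linearization

/-! ### Taylor polynomials of monomials. -/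

section Truncation

open Polynomial in
theorem coeff_one_sub_X_pow {R : Type*} [CommRing R] (m i : ℕ) :
    ((1 - X : R[X]) ^ m).coeff i = (-1) ^ i * (m.choose i : R) := by
  rcases lt_or_ge m i with h | h
  · rw [Nat.choose_eq_zero_of_lt h, Nat.cast_zero, mul_zero]
    refine Polynomial.coeff_eq_zero_of_natDegree_lt (lt_of_le_of_lt ?_ h)
    have h1 : (1 - X : R[X]).natDegree ≤ 1 := by
      rw [← neg_sub, Polynomial.natDegree_neg, ← C_1]
      exact Polynomial.natDegree_X_sub_C_le _
    simpa using Polynomial.natDegree_pow_le_of_le m h1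
  · have h1 : (1 - X : R[X]) = C (-1) * (X + C (-1)) := by
      simp [sub_eq_add_neg, add_comm]
    rw [h1, mul_pow, ← C_pow, coeff_C_mul, coeff_X_add_C_pow, ← mul_assoc, ← pow_add]
    congr 1
    have : m + (m - i) = i + 2 * (m - i) := by omega
    rw [this, pow_add, pow_mul]
    simp

open Polynomial in
-- The sum telescopes.
theorem sum_coeff_one_sub_X_mul {R : Type*} [CommRing R] (Q : R[X]) (k : ℕ) :
    ∑ j ∈ Finset.range (k + 1), ((1 - X) * Q).coeff j = Q.coeff k := by
  induction k with
  | zero => simp [sub_mul]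
  | succ k ih => rw [Finset.sum_range_succ, ih, sub_mul, one_mul, coeff_sub, coeff_X_mul]; ring

open Polynomial in
-- One factor `1 - X` is used up by telescoping, whence `m - 1`; the hypothesis `h` guarantees `m ≥
-- 1` when `d ≤ k`.
theorem sum_coeff_X_pow_mul_one_sub_X_pow {R : Type*} [CommRing R] {k d m : ℕ} (h : k < d + m) :
    ∑ j ∈ Finset.range (k + 1), (X ^ d * (1 - X : R[X]) ^ m).coeff j =
      if d ≤ k then (-1) ^ (k - d) * ((m - 1).choose (k - d) : R) else 0 := by
  split_ifs with hd
  · obtain ⟨m, rfl⟩ : ∃ m', m = m' + 1 := ⟨m - 1, by omega⟩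
    rw [pow_succ', mul_left_comm, sum_coeff_one_sub_X_mul, coeff_X_pow_mul', if_pos hd,
      coeff_one_sub_X_pow, Nat.add_sub_cancel]
  · refine Finset.sum_eq_zero fun j hj => ?_
    rw [coeff_X_pow_mul', if_neg]
    have := Finset.mem_range.1 hj
    omega

variable {n : ℕ}

/-- Up to powers of the `y i`, the coefficients of the Taylor polynomial of order `k` of the monomial
with exponent `b`. -/
def taylorCoeff (k : ℕ) (b a : Fin n →₀ ℕ) : ℂ :=
  (∏ i, ((b i).choose (a i) : ℂ)) *
    ((-1) ^ (k - a.degree) * ((b.degree - a.degree - 1).choose (k - a.degree) : ℂ))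

theorem taylorCoeff_eq_zero {k : ℕ} {b a : Fin n →₀ ℕ} (h : ¬ a ≤ b) : taylorCoeff k b a = 0 := by
  obtain ⟨i, hi⟩ := not_forall.1 h
  rw [taylorCoeff, Finset.prod_eq_zero (Finset.mem_univ i), zero_mul]
  rw [Nat.choose_eq_zero_of_lt (not_le.1 hi), Nat.cast_zero]

/-- The condition `k < b.degree` is what keeps `k - a.degree` within `b.degree - a.degree - 1`, so
the last binomial coefficient is positive. -/
theorem taylorCoeff_ne_zero {k : ℕ} {b a : Fin n →₀ ℕ} (h : a ≤ b) (ha : a.degree ≤ k)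
    (hb : k < b.degree) : taylorCoeff k b a ≠ 0 := by
  rw [taylorCoeff]
  refine mul_ne_zero (Finset.prod_ne_zero_iff.2 fun i _ => ?_) (mul_ne_zero (by simp) ?_)
  · exact Nat.cast_ne_zero.2 (Nat.choose_pos (h i)).ne'
  · exact Nat.cast_ne_zero.2 (Nat.choose_pos (by omega)).ne'

/-- The Taylor polynomial of order `k` at `y` of the monomial with exponent `b`. -/
def taylorMonomial (k : ℕ) (b : Fin n →₀ ℕ) (y : Fin n → ℂ) : MvPolynomial (Fin n) ℂ :=
  ∑ a ∈ exponents n k, MvPolynomial.monomial a (taylorCoeff k b a * ∏ i, y i ^ (b i - a i))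

theorem coeff_taylorMonomial {k : ℕ} (b : Fin n →₀ ℕ) (y : Fin n → ℂ) {a : Fin n →₀ ℕ}
    (ha : a.degree ≤ k) :
    (taylorMonomial k b y).coeff a = taylorCoeff k b a * ∏ i, y i ^ (b i - a i) := by
  classical
  rw [taylorMonomial, MvPolynomial.coeff_sum]
  simp_rw [MvPolynomial.coeff_monomial]
  rw [Finset.sum_ite_eq', if_pos (mem_exponents.2 ha)]

theorem totalDegree_taylorMonomial_le (k : ℕ) (b : Fin n →₀ ℕ) (y : Fin n → ℂ) :
    (taylorMonomial k b y).totalDegree ≤ k :=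
  MvPolynomial.totalDegree_finsetSum_le fun _ ha =>
    (MvPolynomial.totalDegree_monomial_le _ _).trans (mem_exponents.1 ha)

open Polynomial in
-- Each factor is `X * x i + (1 - X) * y i`, to which the binomial theorem applies.
theorem prod_pow_expand {R : Type*} [CommRing R] (x y : Fin n → R) (b : Fin n →₀ ℕ) :
    ∏ i, (C (y i) + X * C (x i - y i)) ^ b i =
      ∑ a ∈ Finset.Iic b, C (∏ i, (((b i).choose (a i) : R) * (x i ^ a i * y i ^ (b i - a i)))) *
        (X ^ a.degree * (1 - X) ^ (b.degree - a.degree)) := by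
  have h1 : ∀ i, (C (y i) + X * C (x i - y i)) ^ b i = ∑ j ∈ Finset.range (b i + 1),
      C (((b i).choose j : R) * (x i ^ j * y i ^ (b i - j))) * (X ^ j * (1 - X) ^ (b i - j)) := by
    intro i
    have : C (y i) + X * C (x i - y i) = X * C (x i) + (1 - X) * C (y i) := by
      rw [C_sub]; ring
    rw [this, add_pow]
    refine Finset.sum_congr rfl fun j _ => ?_
    rw [mul_pow, mul_pow]
    simp only [C_mul, C_pow, C_eq_natCast]
    ring
  simp_rw [h1]
  rw [Finset.prod_univ_sum]
  symm
  refine Finset.sum_bij (fun a _ => ⇑a) ?_ (fun _ _ _ _ h => DFunLike.coe_injective h) ?_ ?_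
  · intro a ha
    rw [Fintype.mem_piFinset]
    intro i
    rw [Finset.mem_range, Nat.lt_succ_iff]
    exact Finset.mem_Iic.1 ha i
  · intro a ha
    rw [Fintype.mem_piFinset] at ha
    refine ⟨Finsupp.equivFunOnFinite.symm a, Finset.mem_Iic.2 fun i => ?_, rfl⟩
    exact Nat.lt_succ_iff.1 (Finset.mem_range.1 (ha i))
  · intro a ha
    have ha' : a ≤ b := Finset.mem_Iic.1 ha
    have hdeg : ∀ (P : R[X]) (c : Fin n → ℕ), ∏ i, P ^ c i = P ^ ∑ i, c i := fun P c =>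
      Finset.prod_pow_eq_pow_sum _ _ _
    conv_rhs => rw [Finset.prod_mul_distrib, Finset.prod_mul_distrib]
    rw [hdeg, hdeg, ← Finsupp.degree_eq_sum, map_prod,
      Finset.sum_tsub_distrib _ fun i _ => ha' i, ← Finsupp.degree_eq_sum, ← Finsupp.degree_eq_sum]

open Polynomial in
-- The polynomial `G` interpolates between `y^b` at `X = 0` and `x^b` at `X = 1`. It lies in the
-- Rees algebra of `J`, so its coefficient of `X^j` is in `J^j`. Dropping the coefficients beyond
-- `k` changes `G(1)` by an element of `J^(k+1)`, and the rest is the Taylor polynomial.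
theorem prod_pow_sub_mem {R : Type*} [CommRing R] {J : Ideal R} (x y : Fin n → R)
    (hxy : ∀ i, x i - y i ∈ J) (b : Fin n →₀ ℕ) {k : ℕ} (hb : k < b.degree) :
    ∏ i, x i ^ b i - ∑ a ∈ Finset.Iic b,
      (∏ i, (((b i).choose (a i) : R) * (x i ^ a i * y i ^ (b i - a i)))) *
        (if a.degree ≤ k then (-1) ^ (k - a.degree) *
          ((b.degree - a.degree - 1).choose (k - a.degree) : R) else 0) ∈ J ^ (k + 1) := by
  set G : R[X] := ∏ i, (C (y i) + X * C (x i - y i)) ^ b i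
  have hG : G ∈ reesAlgebra J := by
    refine Subalgebra.prod_mem _ fun i _ => Subalgebra.pow_mem _ (Subalgebra.add_mem _ ?_ ?_) _
    · exact (reesAlgebra J).algebraMap_mem (y i)
    · intro j
      rw [mul_comm, coeff_C_mul, coeff_X]
      split_ifs with h
      · rw [← h, pow_one, mul_one]; exact hxy i
      · simp
  have h1 : ∏ i, x i ^ b i = G.eval 1 := by
    rw [eval_prod]
    exact Finset.prod_congr rfl fun i _ => by simp
  have h2 : ∑ j ∈ Finset.range (k + 1), G.coeff j = ∑ a ∈ Finset.Iic b,
      (∏ i, (((b i).choose (a i) : R) * (x i ^ a i * y i ^ (b i - a i)))) *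
        (if a.degree ≤ k then (-1) ^ (k - a.degree) *
          ((b.degree - a.degree - 1).choose (k - a.degree) : R) else 0) := by
    rw [show G = _ from prod_pow_expand x y b]
    simp_rw [finsetSum_coeff, coeff_C_mul]
    rw [Finset.sum_comm]
    refine Finset.sum_congr rfl fun a ha => ?_
    have hab : a.degree ≤ b.degree := Finsupp.degree_mono (Finset.mem_Iic.1 ha)
    rw [← Finset.mul_sum, sum_coeff_X_pow_mul_one_sub_X_pow (by omega)]
  rw [← h2, h1, eval_eq_sum_range' (n := k + 1 + (G.natDegree + 1)) (by omega), Finset.sum_range_add]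
  simp only [one_pow, mul_one, add_sub_cancel_left]
  exact Ideal.sum_mem _ fun j _ => Ideal.pow_le_pow_right (by omega) (hG _)

theorem chartGerm_sub_taylorMonomial_mem {e : Module.Basis (Fin n) ℤ (Fin n → ℤ)} {k : ℕ}
    {b : Fin n →₀ ℕ} (hb : k < b.degree) (y : Fin n → ℂ) :
    chartGerm e y (MvPolynomial.monomial b 1 - taylorMonomial k b y) ∈
      maximalIdeal (chartPoint e y).ring ^ (k + 1) := by
  set J : Ideal (MvPolynomial (Fin n) ℂ) := (maximalIdeal (chartPoint e y).ring).comap (chartGerm e y)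
  have h := prod_pow_sub_mem (J := J) (fun i => MvPolynomial.X i) (fun i => MvPolynomial.C (y i))
    (fun i => by
      rw [Ideal.mem_comap, chartGerm_mem_maximalIdeal]
      simp) b hb
  refine Ideal.le_comap_pow (chartGerm e y) (k + 1) ?_
  convert h using 2
  · rw [MvPolynomial.monomial_eq, Finsupp.prod_fintype _ _ (fun i => by simp)]
    simp
  · have hterm : ∀ a : Fin n →₀ ℕ, a.degree ≤ k →
        MvPolynomial.monomial a (taylorCoeff k b a * ∏ i, y i ^ (b i - a i)) =
        (∏ i, (((b i).choose (a i) : MvPolynomial (Fin n) ℂ) *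
          (MvPolynomial.X i ^ a i * MvPolynomial.C (y i) ^ (b i - a i)))) *
        (if a.degree ≤ k then (-1) ^ (k - a.degree) *
          ((b.degree - a.degree - 1).choose (k - a.degree) : MvPolynomial (Fin n) ℂ) else 0) := by
      intro a ha
      rw [if_pos ha, MvPolynomial.monomial_eq, Finsupp.prod_fintype _ _ (fun i => by simp),
        Finset.prod_mul_distrib, Finset.prod_mul_distrib, taylorCoeff]
      simp only [map_mul, map_prod, map_pow, map_neg, map_one, map_natCast]
      ring
    rw [taylorMonomial]
    classical
    -- One sum runs over `|a| ≤ k`, the other over `a ≤ b`; both are supported on the intersection.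
    refine (Finset.sum_subset (s₁ := exponents n k ∩ Finset.Iic b) Finset.inter_subset_left
      fun a ha ha' => ?_).symm.trans ((Finset.sum_congr rfl fun a ha =>
        hterm a (mem_exponents.1 (Finset.mem_inter.1 ha).1)).trans
          (Finset.sum_subset Finset.inter_subset_right fun a ha ha' => ?_))
    · rw [taylorCoeff_eq_zero, zero_mul, map_zero]
      exact fun h => ha' (Finset.mem_inter.2 ⟨ha, Finset.mem_Iic.2 h⟩)
    · rw [if_neg, mul_zero]
      exact fun h => ha' (Finset.mem_inter.2 ⟨mem_exponents.2 h, ha⟩)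

end Truncation

/-! ### Adjacent maximal cones. -/

section Adjacent

variable {n : ℕ} {F : Fan n} {σ σ' : PointedCone ℝ (Fin n → ℝ)}
  {e e' : Module.Basis (Fin n) ℤ (Fin n → ℤ)}

theorem IsChart.reindex (h : IsChart F σ e) (π : Fin n ≃ Fin n) : IsChart F σ (e.reindex π) where
  mem := h.mem
  mem_dual m := by
    rw [h.mem_dual]
    simp_rw [Module.Basis.repr_reindex_apply]
    exact ⟨fun H i => H _, fun H i => by simpa using H (π i)⟩

theorem toReal_dualBasis_sum_mem (h : IsChart F σ e) (s : Finset (Fin n)) :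
    toReal (∑ i ∈ s, dualBasis e i) ∈ σ := by
  refine mem_of_forall_dualMonoid h.mem fun m hm => ?_
  rw [dotProduct_sum]
  refine Finset.sum_nonneg fun i _ => ?_
  rw [dotProduct_dualBasis]
  exact (h.mem_dual m).1 hm i

/-- A ray of one chart that lies in the cone of another chart is a ray of the latter. -/
theorem IsChart.exists_dualBasis_eq (h : IsChart F σ e) (h' : IsChart F σ' e') {i : Fin n}
    (hi : toReal (dualBasis e i) ∈ σ') : ∃ l, dualBasis e' l = dualBasis e i := by
  have hface : (σ' ⊓ σ).IsFaceOf σ' := F.inf_isFaceOf _ h'.mem _ h.mem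
  -- Expand the ray in the rays of `σ'`. Those that occur lie in the common face, hence in `σ`, so
  -- all terms are nonnegative integers. As the terms for `e i` add up to `1`, one of them is `1`,
  -- and its ray has the same coordinates as the given one.
  have hnn : ∀ i' l, 0 ≤ (e' l ⬝ᵥ dualBasis e i) * (e i' ⬝ᵥ dualBasis e' l) := by
    intro i' l
    by_cases hl : e' l ⬝ᵥ dualBasis e i = 0
    · rw [hl, zero_mul]
    · refine mul_nonneg (dotProduct_nonneg_of_mem (h'.basis_mem l) hi)
        (dotProduct_nonneg_of_mem (h.basis_mem i') ?_)
      exact (h'.dualBasis_mem_of_face hface ⟨hi, h.dualBasis_mem i⟩ hl).2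
  have hsum : ∀ i', e i' ⬝ᵥ dualBasis e i =
      ∑ l, (e' l ⬝ᵥ dualBasis e i) * (e i' ⬝ᵥ dualBasis e' l) := by
    intro i'
    conv_lhs => rw [eq_sum_dualBasis e' (dualBasis e i), dotProduct_sum]
    exact Finset.sum_congr rfl fun l _ => by rw [dotProduct_smul, smul_eq_mul]
  have h1 : e i ⬝ᵥ dualBasis e i = 1 := by
    rw [dotProduct_dualBasis, Module.Basis.repr_self, Finsupp.single_eq_same]
  obtain ⟨l, hl⟩ : ∃ l, (e' l ⬝ᵥ dualBasis e i) * (e i ⬝ᵥ dualBasis e' l) ≠ 0 := by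
    by_contra! hall
    rw [hsum, Finset.sum_eq_zero fun l _ => hall l] at h1
    exact zero_ne_one h1
  have hlt : (e' l ⬝ᵥ dualBasis e i) * (e i ⬝ᵥ dualBasis e' l) ≤ 1 := by
    rw [← h1, hsum]
    exact Finset.single_le_sum (fun l _ => hnn i l) (Finset.mem_univ l)
  have hl1 : (e' l ⬝ᵥ dualBasis e i) * (e i ⬝ᵥ dualBasis e' l) = 1 := by
    have := hnn i l
    omega
  have hpos : 0 ≤ e' l ⬝ᵥ dualBasis e i := dotProduct_nonneg_of_mem (h'.basis_mem l) hi
  have hone : e i ⬝ᵥ dualBasis e' l = 1 := by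
    rcases Int.eq_one_or_neg_one_of_mul_eq_one' hl1 with h | h
    · exact h.2
    · omega
  refine ⟨l, ?_⟩
  have hzero : ∀ i', i' ≠ i → e i' ⬝ᵥ dualBasis e' l = 0 := by
    intro i' hi'
    have h2 := hsum i'
    rw [dotProduct_dualBasis, Module.Basis.repr_self, Finsupp.single_eq_of_ne hi'.symm] at h2
    have h3 := (Finset.sum_eq_zero_iff_of_nonneg fun l _ => hnn i' l).1 h2.symm l (Finset.mem_univ l)
    exact (mul_eq_zero.1 h3).resolve_left (left_ne_zero_of_mul hl)
  rw [eq_sum_dualBasis e (dualBasis e' l), Finset.sum_eq_single i, hone, one_smul]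
  · intro i' _ hi'
    rw [hzero i' hi', zero_smul]
  · exact fun h => absurd (Finset.mem_univ i) h

/-- Across the `j`-th wall of a maximal cone of the fan lies another maximal cone. -/
theorem IsChart.exists_adjacent (hs : IsSmooth (toricVariety F)) (hp : IsProjective (toricVariety F))
    (h : IsChart F σ e) (j : Fin n) : ∃ σ' e', IsChart F σ' e' ∧ e' j = -e j ∧
      ∃ c : Fin n → ℤ, ∀ i, i ≠ j → e' i = e i + c i • e j := by
  classical
  -- The first weight is interior to the `j`-th wall, so the new cone contains the wall; the second
  -- weight pushes it to the far side.
  set w₁ := ∑ i ∈ Finset.univ.erase j, dualBasis e i with hw₁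
  obtain ⟨σ', hσ', hlex, hpt⟩ := exists_cone_of_weights hp (pairing w₁) (-pairing (dualBasis e j))
  obtain ⟨e', he'⟩ := exists_basis_of_isSmooth hs hσ' hpt
  have h' : IsChart F σ' e' := ⟨hσ', he'⟩
  have hw₁σ' : toReal w₁ ∈ σ' := mem_of_forall_dualMonoid hσ' fun m hm => by
    simpa [pairing_apply] using (hlex m hm).1
  have hface : (σ ⊓ σ').IsFaceOf σ := F.inf_isFaceOf _ h.mem _ hσ'
  have hrepr : ∀ i, i ≠ j → e i ⬝ᵥ w₁ = 1 := by
    intro i hi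
    rw [hw₁, dotProduct_sum, Finset.sum_eq_single i]
    · rw [dotProduct_dualBasis, Module.Basis.repr_self, Finsupp.single_eq_same]
    · intro i' _ hi'
      rw [dotProduct_dualBasis, Module.Basis.repr_self, Finsupp.single_eq_of_ne hi']
    · exact fun hi' => absurd (Finset.mem_erase.2 ⟨hi, Finset.mem_univ i⟩) hi'
  have hl : ∀ i : {i // i ≠ j}, ∃ l, dualBasis e' l = dualBasis e i := fun i =>
    h.exists_dualBasis_eq h' (h.dualBasis_mem_of_face hface
      ⟨toReal_dualBasis_sum_mem h _, hw₁σ'⟩ (by rw [hrepr i i.2]; exact one_ne_zero)).2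
  choose l hl using hl
  have hdinj : Function.Injective (dualBasis e) := by
    intro a b hab
    have h1 := dotProduct_dualBasis e (e a) a
    rw [hab, dotProduct_dualBasis, Module.Basis.repr_self, Finsupp.single_eq_same] at h1
    by_contra hne
    rw [Finsupp.single_eq_of_ne (Ne.symm hne)] at h1
    exact zero_ne_one h1
  have hlinj : Function.Injective l := fun a b hab =>
    Subtype.ext (hdinj (by rw [← hl a, ← hl b, hab]))
  -- Renumbering `e'` gives the shared rays the same indices in both charts, so all coordinates but
  -- the `j`-th agree.
  obtain ⟨π, hπ⟩ : ∃ π : Fin n ≃ Fin n, ∀ i : {i // i ≠ j}, π i = l i := by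
    let f := Equiv.ofInjective l hlinj
    exact ⟨f.extendSubtype (q := fun i => i ∈ Set.range l), fun i => f.extendSubtype_apply_of_mem i i.2⟩
  set e'' := e'.reindex π.symm
  have h'' : IsChart F σ' e'' := h'.reindex _
  have hcoord : ∀ m i, i ≠ j → e''.repr m i = e.repr m i := by
    intro m i hi
    rw [Module.Basis.repr_reindex_apply, Equiv.symm_symm, hπ ⟨i, hi⟩, ← dotProduct_dualBasis,
      hl ⟨i, hi⟩, dotProduct_dualBasis]
  have hexp : ∀ m, m = e.repr m j • e j + ∑ i ∈ Finset.univ.erase j, e.repr m i • e i := fun m => by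
    conv_lhs => rw [← e.sum_repr m, ← Finset.add_sum_erase _ _ (Finset.mem_univ j)]
  have hexp'' : ∀ m, m = e''.repr m j • e'' j + ∑ i ∈ Finset.univ.erase j, e''.repr m i • e'' i :=
    fun m => by
    conv_lhs => rw [← e''.sum_repr m, ← Finset.add_sum_erase _ _ (Finset.mem_univ j)]
  have hej : e'' j = e.repr (e'' j) j • e j := by
    conv_lhs => rw [hexp (e'' j)]
    rw [Finset.sum_eq_zero, add_zero]
    intro i hi
    rw [← hcoord _ _ (Finset.ne_of_mem_erase hi), Module.Basis.repr_self,
      Finsupp.single_eq_of_ne (Finset.ne_of_mem_erase hi), zero_smul]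
  have hej' : e j = e''.repr (e j) j • e'' j := by
    conv_lhs => rw [hexp'' (e j)]
    rw [Finset.sum_eq_zero, add_zero]
    intro i hi
    rw [hcoord _ _ (Finset.ne_of_mem_erase hi), Module.Basis.repr_self,
      Finsupp.single_eq_of_ne (Finset.ne_of_mem_erase hi), zero_smul]
  have hunit : e.repr (e'' j) j * e''.repr (e j) j = 1 := by
    have h1 := congrArg (fun m => e.repr m j) hej'
    simp only [map_smul, Module.Basis.repr_self, Finsupp.single_eq_same, Finsupp.smul_apply,
      smul_eq_mul] at h1
    rw [mul_comm, ← h1]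
  -- The two bases leave only the sign `±1`; the second weight excludes `+1`, which would be the
  -- original side of the wall.
  have hsign : e.repr (e'' j) j = -1 := by
    have h1 := (hlex _ (h''.basis_mem j)).2 (by
      rw [pairing_apply, hw₁, dotProduct_sum]
      refine Finset.sum_eq_zero fun i hi => ?_
      rw [dotProduct_dualBasis, ← hcoord _ _ (Finset.ne_of_mem_erase hi), Module.Basis.repr_self,
        Finsupp.single_eq_of_ne (Finset.ne_of_mem_erase hi)])
    rw [AddMonoidHom.neg_apply, pairing_apply, dotProduct_dualBasis] at h1
    rcases Int.eq_one_or_neg_one_of_mul_eq_one hunit with h | h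
    · omega
    · exact h
  refine ⟨σ', e'', h'', by rw [hej, hsign, neg_one_smul], fun i => e.repr (e'' i) j, fun i hi => ?_⟩
  conv_lhs => rw [hexp (e'' i)]
  rw [Finset.sum_eq_single i, ← hcoord _ _ hi, Module.Basis.repr_self, Finsupp.single_eq_same, one_smul,
    add_comm]
  · intro i' hi' hne
    rw [← hcoord _ _ (Finset.ne_of_mem_erase hi'), Module.Basis.repr_self,
      Finsupp.single_eq_of_ne hne, zero_smul]
  · exact fun hi' => absurd (Finset.mem_erase.2 ⟨hi, Finset.mem_univ i⟩) hi'

end Adjacent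

/-! ### Transport of affine varieties along isomorphisms of function fields. -/

section Transport

variable {K K' : Type*} [Field K] [Algebra ℂ K] [Field K'] [Algebra ℂ K']

theorem map_symm_map (φ : K ≃ₐ[ℂ] K') (A : Subalgebra ℂ K) :
    (A.map φ.toAlgHom).map φ.symm.toAlgHom = A := by
  ext z
  constructor
  · rintro ⟨_, ⟨a, ha, rfl⟩, rfl⟩
    have h : φ.symm.toAlgHom (φ.toAlgHom a) = a := φ.symm_apply_apply a
    exact h.symm ▸ ha
  · exact fun hz => ⟨_, ⟨z, hz, rfl⟩, φ.symm_apply_apply z⟩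

theorem exists_mem_affineVariety_map (φ : K ≃ₐ[ℂ] K') {A : Subalgebra ℂ K} {x : Point K}
    (hx : x ∈ affineVariety A) :
    ∃ x' ∈ affineVariety (A.map φ.toAlgHom), x'.ring = x.ring.map φ.toAlgHom := by
  obtain ⟨𝔪, hmax, rfl⟩ := hx
  set ψ := A.equivMapOfInjective φ.toAlgHom φ.injective
  have hψ : ∀ a : A, ((ψ a : A.map φ.toAlgHom) : K') = φ a := fun a =>
    Subalgebra.coe_equivMapOfInjective_apply _ _ _ a
  have hmax' : (𝔪.comap ψ.symm).IsMaximal := Ideal.comap_isMaximal_of_equiv ψ.symm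
  refine ⟨_, ⟨_, hmax', rfl⟩, ?_⟩
  have := hmax.isPrime
  have := hmax'.isPrime
  ext z
  rw [Subalgebra.mem_map]
  constructor
  · rintro ⟨a, s, hs, rfl⟩
    refine ⟨(ψ.symm a : A) / (ψ.symm s : A), ⟨_, _, hs, rfl⟩, ?_⟩
    change φ _ = _
    rw [map_div₀, ← hψ, ← hψ, AlgEquiv.apply_symm_apply, AlgEquiv.apply_symm_apply]
  · rintro ⟨_, ⟨a, s, hs, rfl⟩, rfl⟩
    refine ⟨ψ a, ψ s, ?_, ?_⟩
    · rwa [Ideal.mem_comap, AlgEquiv.symm_apply_apply]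
    · change φ _ = _
      rw [map_div₀, hψ, hψ]

end Transport

/-! ### Recognizing projective space. -/

section ProjectiveSpace

variable {n : ℕ} {F : Fan n} {σ : PointedCone ℝ (Fin n → ℝ)}
  {e : Module.Basis (Fin n) ℤ (Fin n → ℤ)}

theorem IsChart.coneAlgebra_eq_adjoin (h : IsChart F σ e) {ι : Type*} {d : ι → Fin n → ℤ}
    (hd : ∀ l, d l ∈ dualMonoid σ) (he : ∀ i, ∃ l, e i = d l) :
    coneAlgebra σ = Algebra.adjoin ℂ (Set.range fun l => character (d l)) := by
  apply le_antisymm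
  · rw [coneAlgebra_eq]
    refine monoidAlg_le fun m hm => ?_
    obtain ⟨a, rfl⟩ := h.mem_dual_iff.1 hm
    rw [latticePoint, character_sum]
    refine Subalgebra.prod_mem _ fun i _ => ?_
    rw [character_nsmul]
    refine Subalgebra.pow_mem _ (Algebra.subset_adjoin ?_) _
    obtain ⟨l, hl⟩ := he i
    exact ⟨l, by rw [hl]⟩
  · rw [Algebra.adjoin_le_iff, coneAlgebra_eq]
    rintro _ ⟨l, rfl⟩
    exact character_mem_monoidAlg.2 (hd l)

/-- The automorphism of the function field of the torus induced by a change of basis of the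
lattice. -/
def latticeEquiv (ψ : (Fin n → ℤ) ≃+ (Fin n → ℤ)) : FunctionField n ≃ₐ[ℂ] FunctionField n :=
  IsFractionRing.algEquivOfAlgEquiv (AddMonoidAlgebra.domCongr ℂ ℂ ψ)

theorem latticeEquiv_character (ψ : (Fin n → ℤ) ≃+ (Fin n → ℤ)) (m : Fin n → ℤ) :
    latticeEquiv ψ (character m) = character (ψ m) := by
  rw [character, latticeEquiv, IsFractionRing.algEquivOfAlgEquiv_algebraMap,
    AddMonoidAlgebra.domCongr_single, character]

theorem span_range_eq_of_div_mem {r : ℕ} {f : Fin (r + 1) → FunctionField n} (hf : ∀ i, f i ≠ 0)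
    {R : Subalgebra ℂ (FunctionField n)} {i : Fin (r + 1)} (h : ∀ j, f j / f i ∈ R) :
    Submodule.span R (Set.range f) = Submodule.span R {f i} := by
  apply le_antisymm
  · rw [Submodule.span_le]
    rintro _ ⟨j, rfl⟩
    refine Submodule.mem_span_singleton.2 ⟨⟨_, h j⟩, ?_⟩
    change f j / f i * f i = f j
    exact div_mul_cancel₀ _ (hf i)
  · exact Submodule.span_mono (by simp)

variable {L : LineBundle (toricVariety F)} {g : FunctionField n}
  {w : Module.Basis (Fin n) ℤ (Fin n → ℤ) → Fin n → ℤ}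

/-- A fan that has the `n + 1` charts of projective space is the fan of projective space. -/
theorem LineBundle.IsLinearization.isoPair (hw : L.IsLinearization g w)
    (hp : IsProjective (toricVariety F)) (e : Module.Basis (Fin n) ℤ (Fin n → ℤ)) {k : ℕ}
    {d : Fin (n + 1) → Fin n → ℤ} (hd : d = Fin.cons 0 e)
    (hcharts : ∀ i, ∃ σ' e', IsChart F σ' e' ∧ (∀ l, d l - d i ∈ dualMonoid σ') ∧
      (∀ l, ∃ l', e' l = d l' - d i) ∧ w e' = w e + k • d i) :
    IsoPair L (projectiveSpaceO n k) := by
  choose σ' e' h' hdual hgen hwt using hcharts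
  -- The coordinate functions of the chart of `e` go to the affine coordinates of `ℙⁿ`.
  set φ := latticeEquiv e.equivFun.toAddEquiv with hφ
  have hφd : ∀ i, φ (character (d i)) = projectiveCoordinates n i := by
    intro i
    rw [hφ, latticeEquiv_character, hd]
    refine Fin.cases ?_ (fun j => ?_) i
    · simp [projectiveCoordinates]
    · simp only [projectiveCoordinates, Fin.cons_succ]
      congr 1
      ext l
      simp [Pi.single_apply, eq_comm]
  have hφdd : ∀ l i, φ (character (d l - d i)) =
      projectiveCoordinates n l / projectiveCoordinates n i := by
    intro l i
    rw [character_sub, map_div₀, hφd, hφd]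
  have hmap : ∀ i, (coneAlgebra (σ' i)).map φ.toAlgHom = Algebra.adjoin ℂ
      (Set.range fun j => projectiveCoordinates n j / projectiveCoordinates n i) := by
    intro i
    rw [(h' i).coneAlgebra_eq_adjoin (hdual i) (hgen i), AlgHom.map_adjoin, ← Set.range_comp]
    congr 2
    ext l
    exact hφdd l i
  have hmap' : ∀ i, (Algebra.adjoin ℂ (Set.range fun j =>
      projectiveCoordinates n j / projectiveCoordinates n i)).map φ.symm.toAlgHom =
        coneAlgebra (σ' i) := by
    intro i
    rw [← hmap i, map_symm_map]
  -- The `n + 1` charts exhaust the fan: for `u` interior to `τ` and `i` minimizing `d i ⬝ᵥ u`, all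
  -- generators `d l - d i` are nonnegative on `u`, so the `i`-th cone contains `τ`.
  have hcover : ∀ x ∈ toricVariety F, ∃ i, x ∈ affineVariety (coneAlgebra (σ' i)) := by
    rintro x ⟨τ, hτ, hx⟩
    obtain ⟨u, hu, hmin, -⟩ := exists_interior hτ
    obtain ⟨i, hi⟩ := Finite.exists_min fun i => d i ⬝ᵥ u
    refine ⟨i, affineVariety_coneAlgebra_mono hp (h' i) hτ (hmin _ (h' i).mem ?_) hx⟩
    refine mem_of_forall_dualMonoid (h' i).mem fun m hm => ?_
    obtain ⟨a, rfl⟩ := (h' i).mem_dual_iff.1 hm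
    rw [latticePoint, sum_dotProduct]
    refine Finset.sum_nonneg fun l _ => ?_
    obtain ⟨l', hl'⟩ := hgen i l
    rw [smul_dotProduct, hl', sub_dotProduct]
    exact nsmul_nonneg (sub_nonneg.2 (hi l')) _
  -- Dividing by the generator on the chart of `e` leaves, by the weight condition, the `k`-th power
  -- of the `i`-th coordinate on the `i`-th chart.
  refine ⟨φ, ?_, ?_, (φ (character (w e) * g))⁻¹, ?_, ?_⟩
  · intro x hx
    obtain ⟨i, hi⟩ := hcover x hx
    obtain ⟨x', hx', hr⟩ := exists_mem_affineVariety_map φ hi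
    rw [hmap i] at hx'
    exact ⟨x', ⟨i, hx'⟩, hr⟩
  · rintro x' ⟨i, hi⟩
    obtain ⟨x, hx, hr⟩ := exists_mem_affineVariety_map φ.symm hi
    rw [hmap' i] at hx
    refine ⟨x, ⟨_, (h' i).mem, hx⟩, ?_⟩
    rw [hr]
    exact (map_symm_map φ.symm _).symm
  · rw [Ne, inv_eq_zero, map_eq_zero_iff φ φ.injective]
    exact mul_ne_zero (character_ne_zero _) hw.ne_zero
  · rintro ⟨x, hx⟩ ⟨x', hx'⟩ hr
    change x'.ring = x.ring.map φ.toAlgHom at hr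
    obtain ⟨i, hi⟩ := hcover x hx
    obtain ⟨y, rfl⟩ := (h' i).mem_affineVariety_iff.1 hi
    have hG : φ (character (w e) * g) ≠ 0 := by
      rw [Ne, map_eq_zero_iff φ φ.injective]
      exact mul_ne_zero (character_ne_zero _) hw.ne_zero
    have hgen' : φ (character (w (e' i)) * g) =
        projectiveCoordinates n i ^ k * φ (character (w e) * g) := by
      rw [hwt, character_add, character_nsmul, map_mul, map_mul, map_mul, map_pow, hφd]
      ring
    have hdiv : ∀ j, projectiveCoordinates n j / projectiveCoordinates n i ∈ x'.ring := by
      intro j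
      rw [hr, ← hφdd]
      refine ⟨_, ?_, rfl⟩
      refine le_ring_of_mem_affineVariety hi ?_
      rw [coneAlgebra_eq]
      exact character_mem_monoidAlg.2 (hdual i j)
    ext t
    change t ∈ Submodule.span x'.ring (Set.range (projectiveCoordinates n)) ^ k ↔ _
    rw [span_range_eq_of_div_mem (projectiveCoordinates_ne_zero n) hdiv, Submodule.span_pow,
      Set.singleton_pow, Submodule.mem_span_singleton, hw.stalk_eq (h' i) y]
    constructor
    · rintro ⟨⟨a, ha⟩, rfl⟩
      rw [hr] at ha
      obtain ⟨b, hb, rfl⟩ := ha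
      refine ⟨_, Submodule.mem_span_singleton.2 ⟨⟨b, hb⟩, rfl⟩, ?_⟩
      change φ b * _ = _ * φ (b * _)
      rw [map_mul φ b, hgen']
      field_simp
    · rintro ⟨s, hs, rfl⟩
      obtain ⟨⟨b, hb⟩, rfl⟩ := Submodule.mem_span_singleton.1 hs
      refine ⟨⟨φ b, hr ▸ ⟨b, hb, rfl⟩⟩, ?_⟩
      change φ b * _ = _ * φ (b * _)
      rw [map_mul φ b, hgen']
      field_simp

end ProjectiveSpace

/-! ### Sections of high degree, or projective space. -/

section Dichotomy

variable {n : ℕ} {F : Fan n} {σ : PointedCone ℝ (Fin n → ℝ)}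
  {e : Module.Basis (Fin n) ℤ (Fin n → ℤ)} {L : LineBundle (toricVariety F)} {g : FunctionField n}
  {w : Module.Basis (Fin n) ℤ (Fin n → ℤ) → Fin n → ℤ}

theorem LineBundle.IsLinearization.exists_eq_latticePoint (hw : L.IsLinearization g w)
    (hs : IsSmooth (toricVariety F)) (hp : IsProjective (toricVariety F)) (h : IsChart F σ e)
    {m : Fin n → ℤ} (hm : character m * g ∈ L.globalSections) :
    ∃ b ∈ hw.sectionExponents e, m = w e + latticePoint e b := by
  obtain ⟨b, hb⟩ := h.mem_dual_iff.1 ((hw.character_mul_mem_iff hs hp).1 hm σ e h)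
  refine ⟨b, ?_, by rw [← hb]; abel⟩
  change character (w e + latticePoint e b) * g ∈ L.globalSections
  rwa [← hb, add_sub_cancel]

theorem latticePoint_eq_iff {a : Fin n →₀ ℕ} {m : Fin n → ℤ} :
    m = latticePoint e a ↔ ∀ i, e.repr m i = a i := by
  constructor
  · rintro rfl i
    exact repr_latticePoint a i
  · intro h
    apply e.repr.injective
    ext i
    rw [h, repr_latticePoint]

/-- If no monomial section of order greater than `k` is divisible by the coordinate `x_j`, then all
monomial sections have order at most `k`, and the chart adjacent along `x_j = 0` is the one of
projective space. -/
theorem LineBundle.IsLinearization.exists_adjacent (hw : L.IsLinearization g w)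
    (hs : IsSmooth (toricVariety F)) (hp : IsProjective (toricVariety F)) {k : ℕ} (hk : 1 ≤ k)
    (hL : L.IsJetSpanned n k) (h : IsChart F σ e) {j : Fin n}
    (hj : ∀ b ∈ hw.sectionExponents e, k < b.degree → b j = 0) :
    (∃ σ' e', IsChart F σ' e' ∧ e' j = -e j ∧ (∀ i, i ≠ j → e' i = e i - e j) ∧
      w e' = w e + k • e j) ∧ ∀ b ∈ hw.sectionExponents e, b.degree ≤ k := by
  classical
  obtain ⟨σ', e', h', hej, c, hc⟩ := h.exists_adjacent hs hp j
  have hejr : ∀ i, e.repr (e' j) i = if i = j then -1 else 0 := by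
    intro i
    rw [hej, map_neg, Module.Basis.repr_self, Finsupp.neg_apply, Finsupp.single_apply]
    simp only [eq_comm]
    split_ifs <;> rfl
  have hcr : ∀ l, l ≠ j → ∀ i, e.repr (e' l) i =
      (if i = l then 1 else 0) + c l * if i = j then 1 else 0 := by
    intro l hl i
    rw [hc l hl, map_add, map_smul, Module.Basis.repr_self, Module.Basis.repr_self,
      Finsupp.add_apply, Finsupp.smul_apply, Finsupp.single_apply, Finsupp.single_apply, smul_eq_mul]
    simp only [eq_comm]
  have hrepr : ∀ m i, e.repr m i = ∑ l, e'.repr m l * e.repr (e' l) i := by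
    intro m i
    conv_lhs => rw [← e'.sum_repr m, map_sum, Finsupp.finsetSum_apply]
    exact Finset.sum_congr rfl fun l _ => by rw [map_smul, Finsupp.smul_apply, smul_eq_mul]
  have hreprne : ∀ m i, i ≠ j → e'.repr m i = e.repr m i := by
    intro m i hi
    rw [hrepr m i, Finset.sum_eq_single i]
    · rw [hcr i hi, if_pos rfl, if_neg hi]; ring
    · intro l _ hl
      by_cases hlj : l = j
      · rw [hlj, hejr, if_neg hi, mul_zero]
      · rw [hcr l hlj, if_neg hl.symm, if_neg hi]; ring
    · exact fun hi => absurd (Finset.mem_univ i) hi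
  have hreprj : ∀ m, e'.repr m j = -e.repr m j + ∑ i ∈ Finset.univ.erase j, c i * e.repr m i := by
    intro m
    have h1 := hrepr m j
    rw [← Finset.add_sum_erase _ _ (Finset.mem_univ j), hejr, if_pos rfl] at h1
    have h2 : ∑ l ∈ Finset.univ.erase j, e'.repr m l * e.repr (e' l) j =
        ∑ i ∈ Finset.univ.erase j, c i * e.repr m i := by
      refine Finset.sum_congr rfl fun l hl => ?_
      have hl := Finset.ne_of_mem_erase hl
      rw [hcr l hl, if_neg hl.symm, if_pos rfl, hreprne m l hl]
      ring
    rw [h2] at h1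
    linarith
  have hsec : ∀ a : Fin n →₀ ℕ, a.degree ≤ k → a ∈ hw.sectionExponents e := fun a ha =>
    hw.mem_sectionExponents_of_degree_le hs hp hL h ha
  have hsec' : ∀ a : Fin n →₀ ℕ, a.degree ≤ k → a ∈ hw.sectionExponents e' := fun a ha =>
    hw.mem_sectionExponents_of_degree_le hs hp hL h' ha
  have hA' : ∀ {m}, character m * g ∈ L.globalSections → ∀ i, 0 ≤ e'.repr (m - w e') i := fun hm =>
    (h'.mem_dual _).1 ((hw.character_mul_mem_iff hs hp).1 hm σ' e' h')
  have hwmem : character (w e) * g ∈ L.globalSections := by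
    simpa [LineBundle.IsLinearization.sectionExponents, latticePoint_zero] using hsec 0 (by simp)
  have hwmem' : character (w e') * g ∈ L.globalSections := by
    simpa [LineBundle.IsLinearization.sectionExponents, latticePoint_zero] using hsec' 0 (by simp)
  obtain ⟨b₀, hb₀, hwb₀⟩ := hw.exists_eq_latticePoint hs hp h hwmem'
  -- Seen from the neighbouring chart, the vertex `w e` has `i`-th coordinate `-b₀ i`, which must be
  -- nonnegative: both vertices lie on one edge in direction `e j`.
  have hb₀i : ∀ i, i ≠ j → b₀ i = 0 := by
    intro i hi
    have h1 := hA' hwmem i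
    rw [hreprne _ _ hi, hwb₀, sub_add_cancel_left, map_neg, Finsupp.neg_apply,
      repr_latticePoint] at h1
    omega
  have hb₀deg : b₀.degree = b₀ j := by
    rw [Finsupp.degree_eq_sum, Finset.sum_eq_single j (fun i _ hi => hb₀i i hi)
      (fun hi => absurd (Finset.mem_univ j) hi)]
  -- Nonnegativity of the `j`-th coordinate in the neighbouring chart, written in the coordinates of
  -- `e`.
  have hbound : ∀ b ∈ hw.sectionExponents e,
      (b j : ℤ) ≤ b₀ j + ∑ i ∈ Finset.univ.erase j, c i * b i := by
    intro b hb
    have h1 := hA' hb j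
    rw [hwb₀, add_sub_add_left_eq_sub, hreprj] at h1
    simp only [map_sub, Finsupp.sub_apply, repr_latticePoint] at h1
    have h2 : ∑ i ∈ Finset.univ.erase j, c i * ((b i : ℤ) - b₀ i) =
        ∑ i ∈ Finset.univ.erase j, c i * b i := by
      refine Finset.sum_congr rfl fun i hi => ?_
      rw [hb₀i i (Finset.ne_of_mem_erase hi), Nat.cast_zero, sub_zero]
    rw [h2] at h1
    linarith
  -- A longer edge would end in a forbidden section, and `x_j^k` is a section by jet spannedness.
  have hb₀k : b₀ j = k := by
    apply le_antisymm
    · by_contra! hlt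
      have := hj b₀ hb₀ (hb₀deg ▸ hlt)
      omega
    · have h1 := hbound (Finsupp.single j k) (hsec _ (by simp))
      rw [Finset.sum_eq_zero] at h1
      · simpa using h1
      · intro i hi
        rw [Finsupp.single_eq_of_ne (Finset.ne_of_mem_erase hi), Nat.cast_zero, mul_zero]
  have hci : ∀ i, i ≠ j → c i = -1 := by
    intro i hi
    -- Apply the inequality to the section `x_j^(k-1) x_i`.
    have hlow : -1 ≤ c i := by
      have h1 := hbound (Finsupp.single j (k - 1) + Finsupp.single i 1) (hsec _ (by
        rw [map_add, Finsupp.degree_single, Finsupp.degree_single]; omega))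
      rw [Finset.sum_eq_single i] at h1
      · simp [hi, hi.symm, hb₀k, hk] at h1
        omega
      · intro l hl hli
        simp [Finset.ne_of_mem_erase hl, hli]
      · exact fun h => absurd (Finset.mem_erase.2 ⟨hi, Finset.mem_univ i⟩) h
    -- By jet spannedness at the neighbouring vertex this is a section. In the chart of `e` it is
    -- `x_i x_j^(k + c i)`, which for `c i ≥ 0` has degree above `k` and is divisible by `x_j`.
    have hmem : character (w e' + e' i) * g ∈ L.globalSections := by
      have h1 := hsec' (Finsupp.single i 1) (by simpa using hk)
      simpa [LineBundle.IsLinearization.sectionExponents, latticePoint_single] using h1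
    obtain ⟨b, hb, hwb⟩ := hw.exists_eq_latticePoint hs hp h hmem
    rw [hwb₀, add_assoc] at hwb
    have hwb := latticePoint_eq_iff.1 (add_left_cancel hwb)
    have hbi : b i = 1 := by
      have h1 := hwb i
      rw [map_add, Finsupp.add_apply, repr_latticePoint, hcr i hi, hb₀i i hi, if_pos rfl,
        if_neg hi] at h1
      push_cast at h1
      omega
    have hbj : (b j : ℤ) = k + c i := by
      have h1 := hwb j
      rw [map_add, Finsupp.add_apply, repr_latticePoint, hcr i hi, hb₀k, if_pos rfl,
        if_neg hi.symm] at h1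
      linarith
    have hdeg : b i + b j ≤ b.degree := by
      rw [Finsupp.degree_eq_sum, ← Finset.add_sum_erase _ _ (Finset.mem_univ i)]
      exact Nat.add_le_add_left (Finset.single_le_sum (fun _ _ => Nat.zero_le _)
        (Finset.mem_erase.2 ⟨hi.symm, Finset.mem_univ j⟩)) _
    by_contra hne
    have := hj b hb (by omega)
    omega
  refine ⟨⟨σ', e', h', hej, fun i hi => by rw [hc i hi, hci i hi]; module, ?_⟩, fun b hb => ?_⟩
  · rw [hwb₀, show b₀ = Finsupp.single j k from ?_, latticePoint_single]
    ext i
    by_cases hi : i = j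
    · rw [hi, hb₀k, Finsupp.single_eq_same]
    · rw [hb₀i i hi, Finsupp.single_eq_of_ne hi]
  · have h1 := hbound b hb
    -- With all `c i = -1` and `b₀ j = k` the inequality reads `|b| ≤ k`.
    have h2 : ∑ i ∈ Finset.univ.erase j, c i * (b i : ℤ) = -∑ i ∈ Finset.univ.erase j, (b i : ℤ) := by
      rw [← Finset.sum_neg_distrib]
      refine Finset.sum_congr rfl fun i hi => ?_
      rw [hci i (Finset.ne_of_mem_erase hi)]
      ring
    rw [h2, hb₀k] at h1
    have h3 : (b.degree : ℤ) = b j + ∑ i ∈ Finset.univ.erase j, (b i : ℤ) := by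
      rw [Finsupp.degree_eq_sum, Nat.cast_sum]
      exact (Finset.add_sum_erase _ (fun i => (b i : ℤ)) (Finset.mem_univ j)).symm
    omega

/-- Unless the toric variety is projective space with the bundle `𝒪(k)`, every coordinate of a chart
divides some monomial section of order greater than `k`. -/
theorem LineBundle.IsLinearization.exists_mem_sectionExponents (hw : L.IsLinearization g w)
    (hs : IsSmooth (toricVariety F)) (hp : IsProjective (toricVariety F)) {k : ℕ} (hk : 1 ≤ k)
    (hL : L.IsJetSpanned n k) (hne : ¬ IsoPair L (projectiveSpaceO n k)) (h : IsChart F σ e)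
    (j : Fin n) : ∃ b ∈ hw.sectionExponents e, k < b.degree ∧ b j ≠ 0 := by
  by_contra! hj
  -- Failure for a single `j` bounds all degrees by `k`, so the hypothesis of the comparison holds
  -- vacuously for every coordinate.
  have hdeg := (hw.exists_adjacent hs hp hk hL h hj).2
  refine hne (hw.isoPair hp e (d := Fin.cons 0 e) rfl fun i => ?_)
  refine Fin.cases ?_ (fun i => ?_) i
  · refine ⟨σ, e, h, fun l => ?_, fun l => ⟨l.succ, by simp⟩, by simp⟩
    refine Fin.cases ?_ (fun l => ?_) l
    · simp
    · simpa using h.basis_mem l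
  · obtain ⟨σ', e', h', he'i, he', hwe'⟩ := (hw.exists_adjacent hs hp hk hL h (j := i)
      fun b hb hkb => absurd (hdeg b hb) (not_le.2 hkb)).1
    refine ⟨σ', e', h', fun l => ?_, fun l => ?_, by simpa using hwe'⟩
    · refine Fin.cases ?_ (fun l => ?_) l
      · simpa [he'i] using h'.basis_mem i
      · by_cases hl : l = i
        · simp [hl]
        · simpa [he' l hl] using h'.basis_mem l
    · by_cases hl : l = i
      · exact ⟨0, by simp [hl, he'i]⟩
      · exact ⟨l.succ, by simp [he' l hl]⟩

end Dichotomy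

/-! ### Plücker coordinates as determinants. -/

section Pluecker

open scoped Module.Grassmannian

variable {V : Type*} [AddCommGroup V] [Module ℂ V] {q : ℕ}

/-- The entries are exchanged one at a time. -/
theorem map_eq_map_of_forall_sub_mem {W : Submodule ℂ V} {ω : V [⋀^Fin q]→ₗ[ℂ] ℂ}
    (hω : ∀ v : Fin q → V, (∃ i, v i ∈ W) → ω v = 0) {v v' : Fin q → V}
    (h : ∀ i, v' i - v i ∈ W) : ω v' = ω v := by
  classical
  have key : ∀ s : Finset (Fin q), ω (s.piecewise v' v) = ω v := by
    intro s
    induction s using Finset.induction_on with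
    | empty => rw [Finset.piecewise_empty]
    | insert a s ha ih =>
      rw [Finset.piecewise_insert, ← ih, ← sub_eq_zero]
      have h1 : s.piecewise v' v = Function.update (s.piecewise v' v) a (v a) := by
        rw [eq_comm, Function.update_eq_self_iff, Finset.piecewise_eq_of_notMem _ _ _ ha]
      conv_lhs => rw [h1, Function.update_idem]
      rw [← ω.map_update_sub]
      exact hω _ ⟨a, by rw [Function.update_self]; exact h a⟩
  simpa using key Finset.univ

variable {W : G(q, V; ℂ)} {ω : V [⋀^Fin q]→ₗ[ℂ] ℂ}

/-- Modulo `W` all vectors are combinations of the `q` vectors `v₀`, so the alternating form is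
determined by its value on `v₀`. -/
theorem IsPlueckerVector.map_ne_zero (hω : IsPlueckerVector W ω) {v₀ : Fin q → V}
    (hspan : ∀ v, ∃ c : Fin q → ℂ, v - ∑ j, c j • v₀ j ∈ W.toSubmodule) : ω v₀ ≠ 0 := by
  intro h0
  refine hω.1 (AlternatingMap.ext fun v => ?_)
  choose c hc using fun i => hspan (v i)
  rw [map_eq_map_of_forall_sub_mem hω.2 hc]
  set T : (Fin q → ℂ) →ₗ[ℂ] V := Fintype.linearCombination ℂ v₀
  have h1 : ω.compLinearMap T = 0 := by
    rw [← AlternatingMap.map_basis_eq_zero_iff (Pi.basisFun ℂ (Fin q)), ← h0]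
    change ω (fun i => T (Pi.basisFun ℂ (Fin q) i)) = _
    congr 1
    ext i
    rw [Pi.basisFun_apply, Fintype.linearCombination_apply_single, one_smul]
  have h2 := DFunLike.congr_fun h1 c
  exact h2

/-- Cramer's rule: the coefficients of a vector modulo `W` are ratios of Plücker coordinates. -/
theorem IsPlueckerVector.map_update (hω : IsPlueckerVector W ω) {v₀ : Fin q → V} {u : V}
    {c : Fin q → ℂ} (hu : u - ∑ j, c j • v₀ j ∈ W.toSubmodule) (j : Fin q) :
    ω (Function.update v₀ j u) = c j * ω v₀ := by
  classical
  have h1 : ω (Function.update v₀ j u) = ω (Function.update v₀ j (∑ j, c j • v₀ j)) := by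
    rw [← sub_eq_zero, ← ω.map_update_sub]
    exact hω.2 _ ⟨j, by rwa [Function.update_self]⟩
  rw [h1, ω.map_update_sum, Finset.sum_eq_single j]
  · rw [ω.map_update_smul, Function.update_eq_self, smul_eq_mul]
  · intro i _ hi
    rw [ω.map_update_smul, ω.map_update_self _ hi.symm, smul_zero]
  · exact fun h => absurd (Finset.mem_univ j) h

end Pluecker

/-! ### From polynomials in ratios to homogeneous polynomials. -/

section Homogenization

variable {n : ℕ} {τ : Type*}

/-- The homogeneous polynomial obtained from `p` by substituting `κ_i Z_i / T_i` for the `i`-th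
variable and clearing denominators. -/
def homogenizeRatios (κ : Fin n → ℂ) (Z T : Fin n → τ) (D : ℕ) (p : MvPolynomial (Fin n) ℂ) :
    MvPolynomial τ ℂ :=
  ∑ m ∈ p.support, MvPolynomial.C (p.coeff m) *
    ∏ i, ((MvPolynomial.C (κ i) * MvPolynomial.X (Z i)) ^ m i * MvPolynomial.X (T i) ^ (D - m i))

/-- Denominators are cleared for each variable separately with exponent `D`, hence the degree `n *
D`. It depends only on `D`, so numerator and denominator of a fraction can share it. -/
theorem isHomogeneous_homogenizeRatios (κ : Fin n → ℂ) (Z T : Fin n → τ) {D : ℕ}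
    {p : MvPolynomial (Fin n) ℂ} (hp : p.totalDegree ≤ D) :
    (homogenizeRatios κ Z T D p).IsHomogeneous (n * D) := by
  refine MvPolynomial.IsHomogeneous.sum _ _ _ fun m hm => ?_
  rw [← zero_add (n * D)]
  refine (MvPolynomial.isHomogeneous_C _ _).mul ?_
  have h1 : n * D = ∑ _i : Fin n, D := by simp
  rw [h1]
  refine MvPolynomial.IsHomogeneous.prod _ _ _ fun i _ => ?_
  have hmi : m i ≤ D :=
    (Finsupp.le_degree i m).trans ((MvPolynomial.le_totalDegree hm).trans hp)
  have h2 : D = (0 + 1) * m i + 1 * (D - m i) := by omega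
  conv_rhs => rw [h2]
  exact (((MvPolynomial.isHomogeneous_C _ _).mul (MvPolynomial.isHomogeneous_X _ _)).pow _).mul
    ((MvPolynomial.isHomogeneous_X _ _).pow _)

theorem eval_homogenizeRatios {κ : Fin n → ℂ} {Z T : Fin n → τ} {D : ℕ}
    {p : MvPolynomial (Fin n) ℂ} (hp : p.totalDegree ≤ D) {ω : τ → ℂ} {y : Fin n → ℂ}
    (h : ∀ i, κ i * ω (Z i) = y i * ω (T i)) :
    MvPolynomial.eval ω (homogenizeRatios κ Z T D p) =
      (∏ i, ω (T i) ^ D) * MvPolynomial.eval y p := by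
  rw [homogenizeRatios, map_sum, MvPolynomial.eval_eq', Finset.mul_sum]
  refine Finset.sum_congr rfl fun m hm => ?_
  rw [map_mul, MvPolynomial.eval_C, map_prod, mul_left_comm, ← Finset.prod_mul_distrib]
  congr 1
  refine Finset.prod_congr rfl fun i _ => ?_
  have hmi : m i ≤ D :=
    (Finsupp.le_degree i m).trans ((MvPolynomial.le_totalDegree hm).trans hp)
  simp only [map_mul, map_pow, MvPolynomial.eval_C, MvPolynomial.eval_X]
  rw [h, mul_pow, mul_assoc, ← pow_add, Nat.add_sub_cancel' hmi, mul_comm]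

end Homogenization

/-! ### Injectivity over the torus and birationality. -/

section GaussMap

variable {n : ℕ} {F : Fan n} {σ : PointedCone ℝ (Fin n → ℝ)}
  {e : Module.Basis (Fin n) ℤ (Fin n → ℤ)} {L : LineBundle (toricVariety F)} {g : FunctionField n}
  {w : Module.Basis (Fin n) ℤ (Fin n → ℤ) → Fin n → ℤ}

/-- The points of the torus. -/
def torus (n : ℕ) : Set (Point (FunctionField n)) :=
  {x | ∀ m, character m ∈ x.ring}

theorem isOpen_torus : IsOpen (torus n) := by
  have h : torus n = ⋂ i : Fin n, {x | character (Pi.single i 1) ∈ x.ring} ∩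
      {x | character (-Pi.single i 1) ∈ x.ring} := by
    ext x
    rw [Set.mem_iInter]
    refine ⟨fun h i => ⟨h _, h _⟩, fun h m => ?_⟩
    have hm : m = ∑ i, m i • Pi.single (M := fun _ => ℤ) i 1 := by
      ext j
      simp [Pi.single_apply]
    rw [hm, character_sum]
    refine Subalgebra.prod_mem _ fun i _ => ?_
    obtain ⟨d, hd | hd⟩ := Int.eq_nat_or_neg (m i)
    · rw [hd, natCast_zsmul, character_nsmul]
      exact Subalgebra.pow_mem _ (h i).1 _
    · rw [hd, neg_smul, natCast_zsmul, ← smul_neg, character_nsmul]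
      exact Subalgebra.pow_mem _ (h i).2 _
  rw [h]
  exact isOpen_iInter_of_finite fun i => (isOpen_setOf_mem_ring _).inter (isOpen_setOf_mem_ring _)

theorem inv_chartHom_mem_chartPoint_iff {y : Fin n → ℂ} {q : MvPolynomial (Fin n) ℂ} (hq : q ≠ 0) :
    (chartHom e q)⁻¹ ∈ (chartPoint e y).ring ↔ MvPolynomial.eval y q ≠ 0 := by
  have hq0 : chartHom e q ≠ 0 := by rwa [Ne, map_eq_zero_iff _ chartHom_injective]
  constructor
  · intro h h0
    rw [← chartGerm_mem_maximalIdeal (e := e), mem_maximalIdeal, mem_nonunits_iff] at h0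
    refine h0 (IsUnit.of_mul_eq_one ⟨_, h⟩ (Subtype.ext ?_))
    change (chartGerm e y q : FunctionField n) * (chartHom e q)⁻¹ = 1
    rw [coe_chartGerm, mul_inv_cancel₀ hq0]
  · exact fun h => mem_chartPoint.2 ⟨1, q, h, by rw [map_one, one_div]⟩

theorem prod_pow_sub_single_mul (y : Fin n → ℂ) {b : Fin n →₀ ℕ} {i : Fin n} (hi : b i ≠ 0) :
    ∏ l, y l ^ b l = y i * ∏ l, y l ^ (b l - Finsupp.single i 1 l) := by
  classical
  rw [← Finset.mul_prod_erase _ _ (Finset.mem_univ i),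
    ← Finset.mul_prod_erase _ (fun l => y l ^ (b l - Finsupp.single i 1 l)) (Finset.mem_univ i),
    ← mul_assoc]
  congr 1
  · rw [Finsupp.single_eq_same, ← pow_succ', Nat.sub_add_cancel (Nat.one_le_iff_ne_zero.2 hi)]
  · refine Finset.prod_congr rfl fun l hl => ?_
    rw [Finsupp.single_eq_of_ne (Finset.ne_of_mem_erase hl), Nat.sub_zero]

theorem single_one_le {b : Fin n →₀ ℕ} {i : Fin n} (hi : b i ≠ 0) : Finsupp.single i 1 ≤ b := by
  rw [Finsupp.single_le_iff]
  exact Nat.one_le_iff_ne_zero.2 hi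

namespace LineBundle.IsLinearization

/-- The osculating spaces of the Gauss map at points of the torus determine the point. -/
theorem eq_of_ker_jetMap_eq (hw : L.IsLinearization g w) (hs : IsSmooth (toricVariety F))
    (hp : IsProjective (toricVariety F)) {k : ℕ} (hk : 1 ≤ k) (hL : L.IsJetSpanned n k)
    (hne : ¬ IsoPair L (projectiveSpaceO n k)) {x z : toricVariety F} (hx : x.1 ∈ torus n)
    (h : (L.jetMap k z).ker = (L.jetMap k x).ker) : z = x := by
  obtain ⟨x, hxX⟩ := x
  obtain ⟨z, hzX⟩ := z
  -- The chart is chosen around the arbitrary point `z`; the torus point `x` lies in every chart.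
  obtain ⟨σ, e, hc, y, rfl⟩ := exists_eq_chartPoint hs hp hzX
  obtain ⟨t, rfl, ht⟩ := hc.exists_eq_chartPoint_of_torus hp hxX hx
  have hty : t = y := by
    ext i
    obtain ⟨b, hb, hbk, hbi⟩ := hw.exists_mem_sectionExponents hs hp hk hL hne hc i
    -- This section has zero jet at `t`, hence also at `y` by the equality of kernels.
    set p := MvPolynomial.monomial b 1 - taylorMonomial k b t
    have hpe : ∀ a ∈ p.support, a ∈ hw.sectionExponents e := by
      classical
      intro a ha
      rcases Finset.mem_union.1 (MvPolynomial.support_sub _ _ _ ha) with ha | ha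
      · rwa [Finset.mem_singleton.1 (MvPolynomial.support_monomial_subset ha)]
      · exact hw.mem_sectionExponents_of_degree_le hs hp hL hc
          ((MvPolynomial.le_totalDegree ha).trans (totalDegree_taylorMonomial_le k b t))
    have hker : (⟨_, hw.chartHom_mul_mem hpe⟩ : L.globalSections) ∈
        (L.jetMap k ⟨chartPoint e t, hxX⟩).ker :=
      (hw.jetMap_eq_zero_iff hc rfl).2 (chartGerm_sub_taylorMonomial_mem hbk t)
    rw [← h, LinearMap.mem_ker, hw.jetMap_eq_zero_iff hc rfl] at hker
    -- The Taylor polynomials of `x^b` at `y` and at `t` now have the same `k`-jet at `y`; having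
    -- degree at most `k`, they are equal.
    have hdiff := Ideal.sub_mem _ hker (chartGerm_sub_taylorMonomial_mem (e := e) hbk y)
    rw [← map_sub, sub_sub_sub_cancel_left] at hdiff
    have h0 := eq_zero_of_chartGerm_mem_pow hL hc ((MvPolynomial.totalDegree_sub _ _).trans
      (max_le (totalDegree_taylorMonomial_le k b y) (totalDegree_taylorMonomial_le k b t))) hdiff
    have hcoeff : ∀ a : Fin n →₀ ℕ, a ≤ b → a.degree ≤ k →
        ∏ l, y l ^ (b l - a l) = ∏ l, t l ^ (b l - a l) := by
      intro a hab hak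
      have h1 := congrArg (MvPolynomial.coeff a) h0
      rw [MvPolynomial.coeff_sub, MvPolynomial.coeff_zero, sub_eq_zero, coeff_taylorMonomial _ _ hak,
        coeff_taylorMonomial _ _ hak] at h1
      exact mul_left_cancel₀ (taylorCoeff_ne_zero hab hak hbk) h1
    -- Comparing coefficients at `0` and `e_i` gives `y^b = t^b` and `y^(b-e_i) = t^(b-e_i)`. The
    -- latter is nonzero because `t` is in the torus, so division yields `y_i = t_i`.
    have h1 := hcoeff 0 zero_le (by simp)
    have h2 := hcoeff (Finsupp.single i 1) (single_one_le hbi) (by simpa using hk)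
    simp only [Finsupp.coe_zero, Pi.zero_apply, Nat.sub_zero] at h1
    rw [prod_pow_sub_single_mul y hbi, prod_pow_sub_single_mul t hbi, h2] at h1
    exact (mul_right_cancel₀ (Finset.prod_ne_zero_iff.2 fun l _ => pow_ne_zero _ (ht l)) h1).symm
  subst hty
  rfl

/-- A global section agrees modulo sections vanishing to order `k` with its Taylor polynomial. -/
theorem sub_sum_mem_ker (hw : L.IsLinearization g w) (h : IsChart F σ e) {k N : ℕ}
    (ε : Fin N ≃ exponents n k) {v₀ : Fin N → L.globalSections}
    (hv₀ : ∀ j, (v₀ j : FunctionField n) =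
      chartHom e (MvPolynomial.monomial (ε j) 1) * (character (w e) * g))
    {y : Fin n → ℂ} {v : L.globalSections} {p r : MvPolynomial (Fin n) ℂ}
    (hv : (v : FunctionField n) = chartHom e p * (character (w e) * g)) (hr : r.totalDegree ≤ k)
    (hpr : chartGerm e y (p - r) ∈ maximalIdeal (chartPoint e y).ring ^ (k + 1)) :
    v - ∑ j, r.coeff (ε j) • v₀ j ∈ (L.jetMap k ⟨chartPoint e y, h.chartPoint_mem y⟩).ker := by
  rw [LinearMap.mem_ker]
  refine (hw.jetMap_eq_zero_iff h ?_).2 hpr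
  have hsum : r = ∑ j, MvPolynomial.monomial (ε j : Fin n →₀ ℕ) (r.coeff (ε j)) := by
    rw [ε.sum_comp fun a : exponents n k => MvPolynomial.monomial (a : Fin n →₀ ℕ) (r.coeff a),
      Finset.sum_coe_sort (exponents n k) fun a => MvPolynomial.monomial a (r.coeff a)]
    conv_lhs => rw [r.as_sum]
    refine Finset.sum_subset (fun a ha => mem_exponents.2 ((MvPolynomial.le_totalDegree ha).trans hr))
      fun a _ ha => ?_
    rw [MvPolynomial.notMem_support_iff.1 ha, map_zero]
  conv_rhs => rw [hsum]
  rw [map_sub, sub_mul, ← hv, map_sum, Finset.sum_mul]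
  push_cast
  congr 1
  refine Finset.sum_congr rfl fun j _ => ?_
  rw [hv₀, chartHom_monomial, chartHom_monomial, one_smul, smul_mul_assoc]

/-- Every chart coordinate is a constant times a ratio of two Plücker coordinates on the torus, and
the chart coordinates generate the function field. -/
theorem isBirationalOntoImage (hw : L.IsLinearization g w) (hs : IsSmooth (toricVariety F))
    (hp : IsProjective (toricVariety F)) {k : ℕ} (hk : 1 ≤ k) (hL : L.IsJetSpanned n k)
    (hne : ¬ IsoPair L (projectiveSpaceO n k)) (hc : IsChart F σ e) :
    IsBirationalOntoImage (LineBundle.gaussMap hL) := by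
  classical
  refine Set.eq_univ_of_forall fun f => ?_
  obtain ⟨p, q, hq, rfl⟩ := exists_eq_chartHom_div e f
  let ε : Fin ((n + k).choose n) ≃ exponents n k :=
    (finCongr (card_exponents n k).symm).trans (exponents n k).equivFin.symm
  have hmono : ∀ b ∈ hw.sectionExponents e, chartHom e (MvPolynomial.monomial b 1) *
      (character (w e) * g) ∈ L.globalSections := fun b hb =>
    hw.chartHom_mul_mem fun a ha => by
      rwa [Finset.mem_singleton.1 (MvPolynomial.support_monomial_subset ha)]
  let v₀ : Fin ((n + k).choose n) → L.globalSections := fun j =>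
    ⟨_, hmono (ε j) (hw.mem_sectionExponents_of_degree_le hs hp hL hc (mem_exponents.1 (ε j).2))⟩
  choose b hb hbk hbi using hw.exists_mem_sectionExponents hs hp hk hL hne hc
  let u : Fin n → L.globalSections := fun i => ⟨_, hmono (b i) (hb i)⟩
  have h0mem : (0 : Fin n →₀ ℕ) ∈ exponents n k := mem_exponents.2 (by simp)
  have h1mem : ∀ i : Fin n, Finsupp.single i 1 ∈ exponents n k := fun i =>
    mem_exponents.2 (by simpa using hk)
  -- In the basis of monomials of degree at most `k`, `Z i` replaces `1` and `T i` replaces `x_i` by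
  -- `x^(b i)`. By Cramer's rule their Plücker coordinates are the Taylor coefficients of `x^(b i)`
  -- at `0` and `e_i`, up to a common factor.
  let Z : Fin n → Fin ((n + k).choose n) → L.globalSections := fun i =>
    Function.update v₀ (ε.symm ⟨0, h0mem⟩) (u i)
  let T : Fin n → Fin ((n + k).choose n) → L.globalSections := fun i =>
    Function.update v₀ (ε.symm ⟨_, h1mem i⟩) (u i)
  -- The constant that turns the ratio of these two coefficients into exactly `y_i`.
  let κ : Fin n → ℂ := fun i => taylorCoeff k (b i) (Finsupp.single i 1) / taylorCoeff k (b i) 0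
  set D := max p.totalDegree q.totalDegree
  refine ⟨n * D, homogenizeRatios κ Z T D p, homogenizeRatios κ Z T D q,
    isHomogeneous_homogenizeRatios κ Z T (le_max_left _ _),
    isHomogeneous_homogenizeRatios κ Z T (le_max_right _ _),
    torus n ∩ {x | (chartHom e q)⁻¹ ∈ x.ring}, isOpen_torus.inter (isOpen_setOf_mem_ring _), ?_, ?_⟩
  · obtain ⟨y, hy⟩ : ∃ y, MvPolynomial.eval y (q * ∏ i, MvPolynomial.X i) ≠ 0 := by
      by_contra! hall
      have hX : (∏ i : Fin n, MvPolynomial.X i : MvPolynomial (Fin n) ℂ) ≠ 0 :=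
        Finset.prod_ne_zero_iff.2 fun i _ => MvPolynomial.X_ne_zero i
      refine mul_ne_zero hq hX (MvPolynomial.funext fun y => ?_)
      rw [hall, map_zero]
    rw [map_mul, map_prod] at hy
    refine ⟨chartPoint e y, ⟨character_mem_chartPoint fun i => ?_,
      (inv_chartHom_mem_chartPoint_iff hq).2 (left_ne_zero_of_mul hy)⟩, hc.chartPoint_mem y⟩
    simpa using Finset.prod_ne_zero_iff.1 (right_ne_zero_of_mul hy) i (Finset.mem_univ i)
  · rintro ⟨x, hxX⟩ ⟨hxT, hxq⟩ ω hω
    obtain ⟨y, rfl, hy⟩ := hc.exists_eq_chartPoint_of_torus hp hxX hxT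
    have hyq := (inv_chartHom_mem_chartPoint_iff hq).1 hxq
    -- Modulo the kernel every section equals its Taylor polynomial, so the sections `v₀` span the
    -- quotient.
    have hω0 : ω v₀ ≠ 0 := hω.map_ne_zero fun v => by
      obtain ⟨p, hpv, -⟩ := hw.exists_polynomial hs hp hc v.2
      obtain ⟨r, hr, hpr⟩ := exists_jet k (chartGerm e y p)
      rw [← map_sub] at hpr
      exact ⟨_, hw.sub_sum_mem_ker hc ε (fun _ => rfl) hpv hr hpr⟩
    have hupd : ∀ i (a : Fin n →₀ ℕ) (ha : a ∈ exponents n k),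
        ω (Function.update v₀ (ε.symm ⟨a, ha⟩) (u i)) =
          taylorCoeff k (b i) a * (∏ l, y l ^ (b i l - a l)) * ω v₀ := by
      intro i a ha
      rw [hω.map_update (hw.sub_sum_mem_ker hc ε (fun _ => rfl) rfl
        (totalDegree_taylorMonomial_le k (b i) y) (chartGerm_sub_taylorMonomial_mem (hbk i) y)),
        Equiv.apply_symm_apply, coeff_taylorMonomial _ _ (mem_exponents.1 ha)]
    have hT0 : ∀ i, ω (T i) ≠ 0 := by
      intro i
      rw [hupd]
      refine mul_ne_zero (mul_ne_zero (taylorCoeff_ne_zero (single_one_le (hbi i))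
        (mem_exponents.1 (h1mem i)) (hbk i)) ?_) hω0
      exact Finset.prod_ne_zero_iff.2 fun l _ => pow_ne_zero _ (hy l)
    have hratio : ∀ i, κ i * ω (Z i) = y i * ω (T i) := by
      intro i
      have hne0 : taylorCoeff k (b i) 0 ≠ 0 :=
        taylorCoeff_ne_zero zero_le (by simp) (hbk i)
      rw [hupd, hupd]
      simp only [Finsupp.coe_zero, Pi.zero_apply, Nat.sub_zero]
      rw [prod_pow_sub_single_mul y (hbi i)]
      simp only [κ]
      field_simp
    have hprod : ∏ i, ω (T i) ^ D ≠ 0 := Finset.prod_ne_zero_iff.2 fun i _ => pow_ne_zero _ (hT0 i)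
    rw [eval_homogenizeRatios (le_max_left _ _) hratio,
      eval_homogenizeRatios (le_max_right _ _) hratio, mul_div_mul_left _ _ hprod]
    exact ⟨mul_ne_zero hprod hyq, hasValueAt_chartPoint p hyq⟩

end LineBundle.IsLinearization

end GaussMap

end ToricGauss

end

theorem proposition4p4 (n k : ℕ) (hk : 1 ≤ k) (F : ToricGauss.Fan n)
    (hsmooth : ToricGauss.IsSmooth (ToricGauss.toricVariety F))
    (hproj : ToricGauss.IsProjective (ToricGauss.toricVariety F))
    (L : ToricGauss.LineBundle (ToricGauss.toricVariety F))
    (hL : L.IsJetSpanned n k)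
    (hne : ¬ ToricGauss.IsoPair L (ToricGauss.projectiveSpaceO n k)) :
    ToricGauss.HasFiniteGeneralFibre (ToricGauss.LineBundle.gaussMap hL) ∧
      ToricGauss.IsBirationalOntoImage (ToricGauss.LineBundle.gaussMap hL) := by
  obtain ⟨g, w, hw⟩ := hL.exists_isLinearization hsmooth hproj
  obtain ⟨τ, hτ⟩ := F.nonempty
  obtain ⟨σ, e, hc, -⟩ := ToricGauss.exists_isChart_ge hsmooth hproj hτ
  refine ⟨⟨ToricGauss.torus n, ToricGauss.isOpen_torus, ⟨ToricGauss.chartPoint e fun _ => 1,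
    ToricGauss.character_mem_chartPoint fun _ => one_ne_zero, hc.chartPoint_mem _⟩, fun x hx => ?_⟩,
    hw.isBirationalOntoImage hsmooth hproj hk hL hne hc⟩
  -- The fibre through a point of the torus is that point alone.
  refine (Set.finite_singleton x).subset fun z hz => ?_
  exact hw.eq_of_ker_jetMap_eq hsmooth hproj hk hL hne hx
    (congrArg Module.Grassmannian.toSubmodule hz)
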